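/- Let $d\ge 1$ and write $|x|_1=\sum_i|x_i|$, $|x|_\infty=\max_i|x_i|$ for $x\in\mathbb Z^d$. Let $\mu$ be a probability measure on $\mathbb R$ with a bounded, compactly supported density $\rho\in L^\infty(\mathbb R)$, and let $\omega=(\omega_k)_{k\in\mathbb Z^d}$ be independent random variables with distribution $\mu$; $\mathbb E$ denotes the expectation with respect to the product measure. Let $u:\mathbb Z^d\to\mathbb R$ have finite support $\Theta=\operatorname{supp}u$ with $0\in\Theta$, and assume that $u(k)>0$ for all $k\in\partial^{\rm i}\Theta=\{k\in\Theta : \#\{j\in\Theta:|k-j|_1=1\}<2d\}$. For $\lambda>0$ consider on $\ell^2(\mathbb Z^d)$ the operator $$H_\omega=-\Delta+\lambda V_\omega,\qquad (\Delta\psi)(x)=\sum_{|e|_1=1}\psi(x+e),\qquad (V_\omega\psi)(x)=\Big(\sum_{k\in\mathbb Z^d}\omega_k\,u(x-k)\Big)\psi(x),$$ which is almost surely bounded and self-adjoint. For $\Gamma\subset\mathbb Z^d$ let $P_\Gamma:\ell^2(\mathbb Z^d)\to\ell^2(\Gamma)$ be the restriction map, $H_{\omega,\Gamma}=P_\Gamma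 H_\omega P_\Gamma^*$, and $G_{\omega,\Gamma}(z;x,y)=\langle\delta_x,(H_{\omega,\Gamma}-z)^{-1}\delta_y\rangle$ for $x,y\in\Gamma$, $z\in\mathbb C\setminus\mathbb R$. Let $s\in(0,1/3)$. Then there is $\lambda_0>0$, depending only on $d,\rho,u,s$, such that for every $\lambda\ge\lambda_0$ there are constants $A,\gamma>0$, depending only on $d,\rho,u,s,\lambda$, such that for all $\Gamma\subset\mathbb Z^d$, all $z\in\mathbb C\setminus\mathbb R$ and all $x,y\in\Gamma$ the random variable $|G_{\omega,\Gamma}(z;x,y)|^{s/(2|\Theta|)}$ is integrable and $$\mathbb E\big\{|G_{\omega,\Gamma}(z;x,y)|^{s/(2|\Theta|)}\big\}\le A\,e^{-\gamma|x-y|_\infty}.$$ -/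

import Mathlib

open MeasureTheory
open scoped ENNReal lp

noncomputable section

namespace AlloyModel

/-- The lattice `ℤ^d`. Its norm `‖x‖` is the sup-norm `max |x i|`. -/
abbrev Lattice (d : ℕ) : Type := Fin d → ℤ

/-- The `ℓ¹`-norm on the lattice. -/
def l1Norm {d : ℕ} (x : Lattice d) : ℤ := ∑ i, |x i|

/-- The interior boundary of a set `S`: the points of `S` that have
fewer than `2 d` nearest neighbours in `S`. -/
def interiorBoundary {d : ℕ} (S : Set (Lattice d)) : Set (Lattice d) :=
  {k | k ∈ S ∧ {j | j ∈ S ∧ l1Norm (k - j) = 1}.ncard < 2 * d}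

/-- The finite set of all lattice vectors of `ℓ¹`-norm one. -/
def unitVectors (d : ℕ) : Finset (Lattice d) :=
  (Finset.Icc (-1) 1).filter (fun e => l1Norm e = 1)

theorem mem_unitVectors {d : ℕ} (e : Lattice d) : e ∈ unitVectors d ↔ l1Norm e = 1 := by
  simp only [unitVectors, Finset.mem_filter, Finset.mem_Icc, and_iff_right_iff_imp]
  intro h
  have key : ∀ i, |e i| ≤ 1 := fun i => by
    rw [← h]
    exact Finset.single_le_sum (f := fun j => |e j|) (fun j _ => abs_nonneg _) (Finset.mem_univ i)
  exact ⟨fun i => (abs_le.1 (key i)).1, fun i => (abs_le.1 (key i)).2⟩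

theorem memℓp_comp {α β : Type} {f : α → β} (hf : Function.Injective f) (ψ : ℓ²(β, ℂ)) :
    Memℓp (fun a => ψ (f a)) 2 :=
  memℓp_gen (((lp.memℓp ψ).summable (by norm_num)).comp_injective hf)

/-- The bounded operator `ψ ↦ ψ ∘ f` from `ℓ²(β)` to `ℓ²(α)`, for an injective map `f : α → β`. -/
def compOp {α β : Type} (f : α → β) (hf : Function.Injective f) : ℓ²(β, ℂ) →L[ℂ] ℓ²(α, ℂ) :=
  LinearMap.mkContinuous
    { toFun := fun ψ => ⟨fun a => ψ (f a), memℓp_comp hf ψ⟩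
      map_add' := fun _ _ => rfl
      map_smul' := fun _ _ => rfl } 1 (fun ψ => by
        rw [one_mul]
        refine lp.norm_le_of_tsum_le (by norm_num) (norm_nonneg _) ?_
        rw [lp.norm_rpow_eq_tsum (by norm_num)]
        have hs : Summable fun b => ‖ψ b‖ ^ (2 : ℝ≥0∞).toReal :=
          (lp.memℓp ψ).summable (by norm_num)
        exact (hs.comp_injective hf).tsum_le_tsum_of_inj f hf
          (fun _ _ => by positivity) (fun _ => le_rfl) hs)

theorem compOp_apply {α β : Type} (f : α → β) (hf : Function.Injective f) (ψ : ℓ²(β, ℂ)) (a : α) :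
    compOp f hf ψ a = ψ (f a) := rfl

/-- The discrete Laplace operator on `ℓ²(ℤ^d)`, without diagonal term:
`(Δ ψ)(x)` is the sum of `ψ (x + e)` over all `e` of `ℓ¹`-norm one. -/
def laplacian (d : ℕ) : ℓ²(Lattice d, ℂ) →L[ℂ] ℓ²(Lattice d, ℂ) :=
  ∑ e ∈ unitVectors d, compOp (fun x => x + e) (add_left_injective e)

open scoped Classical in
/-- The multiplication operator by a bounded real function `v` on `ℓ²(α)`.
For an unbounded `v`, where there is no bounded multiplication operator, the value is `0`;
the random potential below is almost surely bounded. -/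
def mulOp {α : Type} (v : α → ℝ) : ℓ²(α, ℂ) →L[ℂ] ℓ²(α, ℂ) :=
  if h : ∃ K : ℝ, 0 ≤ K ∧ ∀ a, |v a| ≤ K then
    lp.mapCLM 2 (fun a => (v a : ℂ) • ContinuousLinearMap.id ℂ ℂ) h.choose_spec.1
      (fun a => by simpa [norm_smul] using h.choose_spec.2 a)
  else 0

theorem mulOp_apply {α : Type} {v : α → ℝ} {K : ℝ} (hK : ∀ a, |v a| ≤ K)
    (ψ : ℓ²(α, ℂ)) (a : α) : mulOp v ψ a = (v a : ℂ) * ψ a := by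
  have h : ∃ K : ℝ, 0 ≤ K ∧ ∀ a, |v a| ≤ K := ⟨K, (abs_nonneg _).trans (hK a), hK⟩
  rw [mulOp, dif_pos h]
  simp

/-- The alloy-type potential with single-site potential `u`:
`V_ω(x) = ∑ k, ω k * u (x - k)`. -/
def potential {d : ℕ} (u : Lattice d → ℝ) (ω : Lattice d → ℝ) (x : Lattice d) : ℝ :=
  ∑' k, ω k * u (x - k)

/-- The discrete alloy-type Hamiltonian `H_ω = -Δ + lam V_ω` on `ℓ²(ℤ^d)`. -/
def hamiltonian {d : ℕ} (u : Lattice d → ℝ) (lam : ℝ) (ω : Lattice d → ℝ) :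
    ℓ²(Lattice d, ℂ) →L[ℂ] ℓ²(Lattice d, ℂ) :=
  -laplacian d + (lam : ℂ) • mulOp (potential u ω)

/-- The restriction `P_Γ : ℓ²(ℤ^d) → ℓ²(Γ)`. -/
def proj {d : ℕ} (Γ : Set (Lattice d)) : ℓ²(Lattice d, ℂ) →L[ℂ] ℓ²(Γ, ℂ) :=
  compOp (fun x : Γ => (x : Lattice d)) Subtype.val_injective

/-- The restricted Hamiltonian `H_{ω,Γ} = P_Γ H_ω P_Γ^*` on `ℓ²(Γ)`. -/
def hamiltonianOn {d : ℕ} (u : Lattice d → ℝ) (lam : ℝ) (ω : Lattice d → ℝ)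
    (Γ : Set (Lattice d)) : ℓ²(Γ, ℂ) →L[ℂ] ℓ²(Γ, ℂ) :=
  (proj Γ).comp ((hamiltonian u lam ω).comp (ContinuousLinearMap.adjoint (proj Γ)))

open scoped Classical in
/-- The Green function `G_{ω,Γ}(z; x, y) = ⟨δ_x, (H_{ω,Γ} - z)⁻¹ δ_y⟩`. -/
def green {d : ℕ} (u : Lattice d → ℝ) (lam : ℝ) (ω : Lattice d → ℝ) (Γ : Set (Lattice d))
    (z : ℂ) (x y : Γ) : ℂ :=
  inner ℂ (lp.single 2 x (1 : ℂ) : ℓ²(Γ, ℂ))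
    (Ring.inverse (hamiltonianOn u lam ω Γ - z • ContinuousLinearMap.id ℂ ℓ²(Γ, ℂ))
      (lp.single 2 y (1 : ℂ)))

/-- The law of the i.i.d. family `ω = (ω_k)`, each `ω_k` with distribution `μ`. -/
def law (d : ℕ) (μ : Measure ℝ) : Measure (Lattice d → ℝ) :=
  Measure.infinitePi (fun _ : Lattice d => μ)

end AlloyModel

end

noncomputable section

namespace AlloyModel

/-! This is the fractional moment method for a potential of indefinite sign. Near a site x two
groups of coupling constants are averaged, each for its own reason. Let the cell be x + Θ, and let
the shell consist of the sites outside the cell that lie in the support of a translate of u centred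
at a neighbour of x. Two geometric resolvent expansions, one removing the cell and one removing the
shell, bound |G(x,y)| by three kinds of factors: |G(x,k)| with k in the cell, Green functions
between shell sites in the region without the cell, and Green functions ending at y in the region
without cell and shell.

The first kind is averaged over ω_x. By the Schur complement formula, the Green function on the cell
is the inverse of a matrix λ(A + rD), where r = ω_x and D is diagonal with entries u(k-x) ≠ 0. The
determinant is a polynomial in r of degree at most N = |Θ|, so Cramer's rule bounds the τ-th moment
when Nτ ≤ 1/2. The signs of u play no role, but the bound carries λ^(-τ) and the power Nτ of the
size of A, that is, of the shell Green functions (`exists_lintegral_gr_le`).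

The second kind does not involve ω_x. It is averaged over a common shift t of the couplings at all
neighbours of x. A site θ of Θ whose translate by some e leaves Θ is a boundary site, so u(θ) > 0;
hence off the cell the shift moves the potential monotonically, and strictly on the shell. Boundary
values of analytic functions with positive real part then give a 1/2-moment bound, uniform in
everything else (`integral_sqrt_norm_le`, `lintegral_gr_le_of_monotone`). Together the two averages
need (N+1)τ ≤ 1/2.

The third kind depends on none of these couplings, so it decouples. The result
(`exists_lintegral_gr_le_tailSum`) is a moment at (x,y) bounded by Cλ^(-τ) times finitely many
moments of smaller regions, starting at bounded distance from x. For large λ the iteration contracts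
and yields exponential decay (`exists_lintegral_gr_le_exp`). -/

/-! ### Hopping and multiplication operators on the full lattice -/

theorem norm_le_of_forall_le {α : Type} {w : α → ℂ} (h : ∃ K : ℝ, ∀ a, ‖w a‖ ≤ K) :
    ∃ K : ℝ, 0 ≤ K ∧ ∀ a, ‖w a‖ ≤ K := by
  obtain ⟨K, hK⟩ := h
  exact ⟨max K 0, le_max_right _ _, fun a => (hK a).trans (le_max_left _ _)⟩

open scoped Classical in
/-- Multiplication by a bounded complex function `w`, with junk value `0` for unbounded `w`. -/
def mulC {α : Type} (w : α → ℂ) : ℓ²(α, ℂ) →L[ℂ] ℓ²(α, ℂ) :=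
  if h : ∃ K : ℝ, ∀ a, ‖w a‖ ≤ K then
    lp.mapCLM 2 (fun a => w a • ContinuousLinearMap.id ℂ ℂ)
      (norm_le_of_forall_le h).choose_spec.1
      (fun a => by simpa [norm_smul] using (norm_le_of_forall_le h).choose_spec.2 a)
  else 0

theorem mulC_apply {α : Type} {w : α → ℂ} (h : ∃ K : ℝ, ∀ a, ‖w a‖ ≤ K)
    (ψ : ℓ²(α, ℂ)) (a : α) : mulC w ψ a = w a * ψ a := by
  rw [mulC, dif_pos h]
  simp

theorem norm_lp_apply_le {α : Type} (ψ : ℓ²(α, ℂ)) (a : α) : ‖ψ a‖ ≤ ‖ψ‖ :=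
  lp.norm_apply_le_norm (by norm_num) ψ a

theorem compOp_norm_le {α β : Type} (f : α → β) (hf : Function.Injective f) :
    ‖compOp f hf‖ ≤ 1 :=
  LinearMap.mkContinuous_norm_le _ zero_le_one _

theorem laplacian_apply {d : ℕ} (ψ : ℓ²(Lattice d, ℂ)) (x : Lattice d) :
    laplacian d ψ x = ∑ e ∈ unitVectors d, ψ (x + e) := by
  simp only [laplacian, sum_apply, lp.coeFn_sum, Finset.sum_apply,
    compOp_apply]

theorem neg_mem_unitVectors {d : ℕ} {e : Lattice d} (he : e ∈ unitVectors d) :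
    -e ∈ unitVectors d := by
  rw [mem_unitVectors] at he ⊢
  simpa [l1Norm] using he

theorem adjoint_compOp_add {d : ℕ} (e : Lattice d) :
    ContinuousLinearMap.adjoint (compOp (fun x : Lattice d => x + e) (add_left_injective e)) =
      compOp (fun x : Lattice d => x + -e) (add_left_injective (-e)) := by
  symm
  rw [ContinuousLinearMap.eq_adjoint_iff]
  intro φ ψ
  rw [lp.inner_eq_tsum, lp.inner_eq_tsum, ← (Equiv.addRight e).tsum_eq]
  simp [compOp_apply]

theorem isSelfAdjoint_laplacian (d : ℕ) : IsSelfAdjoint (laplacian d) := by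
  rw [ContinuousLinearMap.isSelfAdjoint_iff']
  simp only [laplacian, map_sum, adjoint_compOp_add]
  exact Finset.sum_nbij' (fun e => -e) (fun e => -e) (fun e he => neg_mem_unitVectors he)
    (fun e he => neg_mem_unitVectors he) (fun e _ => neg_neg e) (fun e _ => neg_neg e)
    (fun e _ => rfl)

theorem isSelfAdjoint_mulC_ofReal {α : Type} {v : α → ℝ} (h : ∃ K : ℝ, ∀ a, ‖(v a : ℂ)‖ ≤ K) :
    IsSelfAdjoint (mulC fun a => (v a : ℂ)) := by
  rw [ContinuousLinearMap.isSelfAdjoint_iff']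
  symm
  rw [ContinuousLinearMap.eq_adjoint_iff]
  intro φ ψ
  rw [lp.inner_eq_tsum, lp.inner_eq_tsum]
  refine tsum_congr fun a => ?_
  simp only [mulC_apply h, RCLike.inner_apply, map_mul, Complex.conj_ofReal]
  ring

/-- Multiplication by the indicator function of `Γ`. -/
def cutoff {d : ℕ} (Γ : Set (Lattice d)) : ℓ²(Lattice d, ℂ) →L[ℂ] ℓ²(Lattice d, ℂ) :=
  mulC fun x => ((Γ.indicator 1 x : ℝ) : ℂ)

theorem indicator_bdd {d : ℕ} (Γ : Set (Lattice d)) :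
    ∃ K : ℝ, ∀ x, ‖((Γ.indicator 1 x : ℝ) : ℂ)‖ ≤ K := by
  refine ⟨1, fun x => ?_⟩
  by_cases h : x ∈ Γ <;> simp [h]

open scoped Classical in
theorem cutoff_apply {d : ℕ} (Γ : Set (Lattice d)) (ψ : ℓ²(Lattice d, ℂ)) (x : Lattice d) :
    cutoff Γ ψ x = if x ∈ Γ then ψ x else 0 := by
  rw [cutoff, mulC_apply (indicator_bdd Γ)]
  by_cases h : x ∈ Γ <;> simp [h]

theorem isSelfAdjoint_cutoff {d : ℕ} (Γ : Set (Lattice d)) : IsSelfAdjoint (cutoff Γ) :=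
  isSelfAdjoint_mulC_ofReal (indicator_bdd Γ)

/-- The hopping term `χ_Γ Δ χ_Γ` of the lattice restricted to `Γ`. -/
def hopping {d : ℕ} (Γ : Set (Lattice d)) : ℓ²(Lattice d, ℂ) →L[ℂ] ℓ²(Lattice d, ℂ) :=
  cutoff Γ * laplacian d * cutoff Γ

theorem isSelfAdjoint_hopping {d : ℕ} (Γ : Set (Lattice d)) : IsSelfAdjoint (hopping Γ) := by
  have h := (isSelfAdjoint_laplacian d).conjugate (cutoff Γ)
  rwa [(isSelfAdjoint_cutoff Γ).star_eq] at h

open scoped Classical in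
theorem hopping_apply {d : ℕ} (Γ : Set (Lattice d)) (ψ : ℓ²(Lattice d, ℂ)) (x : Lattice d) :
    hopping Γ ψ x =
      if x ∈ Γ then ∑ e ∈ unitVectors d, (if x + e ∈ Γ then ψ (x + e) else 0) else 0 := by
  simp only [hopping, mul_apply_eq_comp, cutoff_apply, laplacian_apply]

/-! ### Dissipative operators and their Green functions -/

/-- The operator `-χ_Γ Δ χ_Γ + w` with a complex potential `w`. -/
def op {d : ℕ} (Γ : Set (Lattice d)) (w : Lattice d → ℂ) :
    ℓ²(Lattice d, ℂ) →L[ℂ] ℓ²(Lattice d, ℂ) :=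
  -hopping Γ + mulC w

/-- Bounded potentials whose imaginary part is at least `c`. -/
structure IsDissipative {α : Type} (c : ℝ) (w : α → ℂ) : Prop where
  pos : 0 < c
  bdd : ∃ K : ℝ, ∀ a, ‖w a‖ ≤ K
  le_im : ∀ a, c ≤ (w a).im

open scoped Classical in
theorem op_apply {d : ℕ} (Γ : Set (Lattice d)) {c : ℝ} {w : Lattice d → ℂ}
    (hw : IsDissipative c w) (ψ : ℓ²(Lattice d, ℂ)) (x : Lattice d) :
    op Γ w ψ x = -(if x ∈ Γ then ∑ e ∈ unitVectors d, (if x + e ∈ Γ then ψ (x + e) else 0) else 0)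
      + w x * ψ x := by
  simp only [op, add_apply, neg_apply, lp.coeFn_add,
    lp.coeFn_neg, Pi.add_apply, Pi.neg_apply, hopping_apply, mulC_apply hw.bdd]

theorem hasSum_im_inner_op {d : ℕ} (Γ : Set (Lattice d)) {c : ℝ} {w : Lattice d → ℂ}
    (hw : IsDissipative c w) (ψ : ℓ²(Lattice d, ℂ)) :
    HasSum (fun x => (w x).im * ‖ψ x‖ ^ 2) (inner ℂ ψ (op Γ w ψ)).im := by
  have h0 : (inner ℂ ψ (hopping Γ ψ)).im = 0 :=
    (isSelfAdjoint_hopping Γ).isSymmetric.im_inner_self_apply ψ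
  have h1 : (inner ℂ ψ (op Γ w ψ)).im = (inner ℂ ψ (mulC w ψ)).im := by
    rw [op, add_apply, neg_apply, inner_add_right,
      inner_neg_right, Complex.add_im, Complex.neg_im, h0]
    ring
  rw [h1]
  convert Complex.hasSum_im (lp.hasSum_inner ψ (mulC w ψ)) using 2 with x
  rw [mulC_apply hw.bdd, RCLike.inner_apply, mul_assoc, Complex.mul_conj,
    Complex.normSq_eq_norm_sq, Complex.im_mul_ofReal]

theorem norm_sq_hasSum {α : Type} (ψ : ℓ²(α, ℂ)) : HasSum (fun x => ‖ψ x‖ ^ 2) (‖ψ‖ ^ 2) := by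
  have h := lp.hasSum_norm (p := 2) (by norm_num) ψ
  simpa using h

theorem le_im_inner_op {d : ℕ} (Γ : Set (Lattice d)) {c : ℝ} {w : Lattice d → ℂ}
    (hw : IsDissipative c w) (ψ : ℓ²(Lattice d, ℂ)) :
    c * ‖ψ‖ ^ 2 ≤ (inner ℂ ψ (op Γ w ψ)).im :=
  hasSum_le (fun x => mul_le_mul_of_nonneg_right (hw.le_im x) (by positivity))
    ((norm_sq_hasSum ψ).mul_left c) (hasSum_im_inner_op Γ hw ψ)

/-- The hopping is self-adjoint, so the imaginary part of the quadratic form comes from w alone and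
is coercive. -/
theorem isUnit_op {d : ℕ} (Γ : Set (Lattice d)) {c : ℝ} {w : Lattice d → ℂ}
    (hw : IsDissipative c w) : IsUnit (op Γ w) := by
  refine ContinuousLinearMap.isUnit_of_forall_le_norm_inner_map _ (c := ⟨c, hw.pos.le⟩) hw.pos
    fun ψ => ?_
  rw [norm_inner_symm]
  exact (mul_comm _ _).le.trans
    ((le_im_inner_op Γ hw ψ).trans ((le_abs_self _).trans (Complex.abs_im_le_norm _)))

/-- The resolvent `(-χ_Γ Δ χ_Γ + w)⁻¹`. -/
def res {d : ℕ} (Γ : Set (Lattice d)) (w : Lattice d → ℂ) :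
    ℓ²(Lattice d, ℂ) →L[ℂ] ℓ²(Lattice d, ℂ) :=
  Ring.inverse (op Γ w)

theorem op_res {d : ℕ} (Γ : Set (Lattice d)) {c : ℝ} {w : Lattice d → ℂ}
    (hw : IsDissipative c w) (ψ : ℓ²(Lattice d, ℂ)) : op Γ w (res Γ w ψ) = ψ := by
  have h := Ring.mul_inverse_cancel _ (isUnit_op Γ hw)
  exact congrArg (fun T => T ψ) h

theorem res_op {d : ℕ} (Γ : Set (Lattice d)) {c : ℝ} {w : Lattice d → ℂ}
    (hw : IsDissipative c w) (ψ : ℓ²(Lattice d, ℂ)) : res Γ w (op Γ w ψ) = ψ := by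
  have h := Ring.inverse_mul_cancel _ (isUnit_op Γ hw)
  exact congrArg (fun T => T ψ) h

theorem norm_res_apply_le {d : ℕ} (Γ : Set (Lattice d)) {c : ℝ} {w : Lattice d → ℂ}
    (hw : IsDissipative c w) (ψ : ℓ²(Lattice d, ℂ)) : ‖res Γ w ψ‖ ≤ c⁻¹ * ‖ψ‖ := by
  set φ := res Γ w ψ with hφ
  have h1 := le_im_inner_op Γ hw φ
  rw [hφ, op_res Γ hw, ← hφ] at h1
  have h2 : (inner ℂ φ ψ).im ≤ ‖φ‖ * ‖ψ‖ :=
    (le_abs_self _).trans ((Complex.abs_im_le_norm _).trans (norm_inner_le_norm _ _))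
  rw [inv_mul_eq_div, le_div_iff₀ hw.pos]
  rcases (norm_nonneg φ).eq_or_lt with h | h
  · rw [← h]; simp
  · nlinarith

/-- The Green function `⟨δ_x, (-χ_Γ Δ χ_Γ + w)⁻¹ δ_y⟩`. -/
def gr {d : ℕ} (Γ : Set (Lattice d)) (w : Lattice d → ℂ) (x y : Lattice d) : ℂ :=
  res Γ w (lp.single 2 y (1 : ℂ)) x

theorem norm_single_one {α : Type} [DecidableEq α] (y : α) :
    ‖(lp.single 2 y (1 : ℂ) : ℓ²(α, ℂ))‖ = 1 := by
  rw [lp.norm_single (by norm_num)]; simp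

theorem norm_gr_le {d : ℕ} (Γ : Set (Lattice d)) {c : ℝ} {w : Lattice d → ℂ}
    (hw : IsDissipative c w) (x y : Lattice d) : ‖gr Γ w x y‖ ≤ c⁻¹ :=
  (norm_lp_apply_le _ x).trans ((norm_res_apply_le Γ hw _).trans (by rw [norm_single_one, mul_one]))

theorem norm_le_of_apply_le {α : Type} {φ ψ : ℓ²(α, ℂ)} {K : ℝ} (hK : 0 ≤ K)
    (h : ∀ a, ‖φ a‖ ≤ K * ‖ψ a‖) : ‖φ‖ ≤ K * ‖ψ‖ := by
  refine le_of_sq_le_sq ?_ (by positivity)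
  rw [mul_pow]
  refine hasSum_le (fun a => ?_) (norm_sq_hasSum φ) ((norm_sq_hasSum ψ).mul_left (K ^ 2))
  rw [← mul_pow]
  exact pow_le_pow_left₀ (norm_nonneg _) (h a) 2

theorem norm_hopping_apply_le {d : ℕ} (Γ : Set (Lattice d)) (ψ : ℓ²(Lattice d, ℂ)) :
    ‖hopping Γ ψ‖ ≤ (unitVectors d).card * ‖ψ‖ := by
  classical
  have hc : ∀ φ : ℓ²(Lattice d, ℂ), ‖cutoff Γ φ‖ ≤ ‖φ‖ := fun φ => by
    refine (norm_le_of_apply_le zero_le_one fun a => ?_).trans_eq (one_mul _)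
    rw [cutoff_apply]
    split_ifs <;> simp
  have hl : ‖laplacian d‖ ≤ (unitVectors d).card := by
    refine (norm_sum_le_of_le _ fun e _ => compOp_norm_le _ _).trans_eq ?_
    simp
  calc ‖hopping Γ ψ‖ ≤ ‖laplacian d (cutoff Γ ψ)‖ := hc _
    _ ≤ ‖laplacian d‖ * ‖cutoff Γ ψ‖ := ContinuousLinearMap.le_opNorm _ _
    _ ≤ _ := mul_le_mul hl (hc ψ) (norm_nonneg _) (by positivity)

/-- When the potential dominates the norm of the hopping everywhere, the resolvent is small
deterministically. This handles the energies z that are large compared with λ, which averaging with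
constants uniform in z cannot reach. -/
theorem norm_gr_le_of_le_norm {d : ℕ} (Γ : Set (Lattice d)) {c L : ℝ} {w : Lattice d → ℂ}
    (hw : IsDissipative c w) (hL : 0 < L) (h : ∀ x, L + (unitVectors d).card ≤ ‖w x‖)
    (x y : Lattice d) : ‖gr Γ w x y‖ ≤ L⁻¹ := by
  refine (norm_lp_apply_le _ x).trans ?_
  set ψ := res Γ w (lp.single 2 y (1 : ℂ)) with hψ
  have h1 : op Γ w ψ = lp.single 2 y (1 : ℂ) := op_res Γ hw _
  have h2 : mulC w ψ = lp.single 2 y (1 : ℂ) + hopping Γ ψ := by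
    rw [← h1, op, add_apply, neg_apply]; abel
  have hpos : 0 < L + (unitVectors d).card := by positivity
  have h3 : ‖ψ‖ ≤ (L + (unitVectors d).card)⁻¹ * ‖mulC w ψ‖ := by
    refine norm_le_of_apply_le (by positivity) fun a => ?_
    rw [mulC_apply hw.bdd, norm_mul, inv_mul_eq_div, le_div_iff₀ hpos, mul_comm]
    exact mul_le_mul_of_nonneg_right (h a) (norm_nonneg _)
  have h4 : ‖mulC w ψ‖ ≤ 1 + (unitVectors d).card * ‖ψ‖ := by
    rw [h2]
    refine (norm_add_le _ _).trans (add_le_add (norm_single_one y).le (norm_hopping_apply_le Γ ψ))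
  rw [inv_mul_eq_div, le_div_iff₀ hpos] at h3
  rw [inv_eq_one_div, le_div_iff₀ hL]
  nlinarith

theorem IsDissipative.ne_zero {α : Type} {c : ℝ} {w : α → ℂ} (hw : IsDissipative c w) (a : α) :
    w a ≠ 0 := fun h => by
  have h1 := hw.le_im a
  rw [h] at h1
  exact absurd h1 (not_le.2 hw.pos)

/-- Off Γ the operator acts diagonally by w, which has no zeros. Thus all regions can share the
Hilbert space over the whole lattice, and the terms of an expansion that leave the region vanish. -/
theorem gr_eq_zero {d : ℕ} {Γ : Set (Lattice d)} {c : ℝ} {w : Lattice d → ℂ}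
    (hw : IsDissipative c w) {x y : Lattice d} (hx : x ∉ Γ) (hy : y ∈ Γ) : gr Γ w x y = 0 := by
  have h := congrArg (fun φ : ℓ²(Lattice d, ℂ) => φ x)
    (op_res Γ hw (lp.single 2 y (1 : ℂ)))
  simp only [op_apply Γ hw, if_neg hx, neg_zero, zero_add] at h
  have hxy : x ≠ y := fun hxy => hx (hxy ▸ hy)
  rw [lp.single_apply_ne _ _ _ hxy] at h
  exact (mul_eq_zero.1 h).resolve_left (hw.ne_zero x)

/-- The column with pole in Γ is supported in Γ, so it never sees the values of w elsewhere. All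
independence statements about Green functions rest on this. -/
theorem gr_congr {d : ℕ} {Γ : Set (Lattice d)} {c c' : ℝ} {w w' : Lattice d → ℂ}
    (hw : IsDissipative c w) (hw' : IsDissipative c' w') (h : ∀ x ∈ Γ, w x = w' x)
    (x : Lattice d) {y : Lattice d} (hy : y ∈ Γ) : gr Γ w x y = gr Γ w' x y := by
  have key : op Γ w' (res Γ w (lp.single 2 y (1 : ℂ))) = lp.single 2 y (1 : ℂ) := by
    nth_rw 2 [← op_res Γ hw (lp.single 2 y (1 : ℂ))]
    ext k
    rw [op_apply Γ hw, op_apply Γ hw']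
    by_cases hk : k ∈ Γ
    · rw [h k hk]
    · have h0 : res Γ w (lp.single 2 y (1 : ℂ)) k = 0 := gr_eq_zero hw hk hy
      rw [h0, mul_zero, mul_zero]
  have h2 := res_op Γ hw' (res Γ w (lp.single 2 y (1 : ℂ)))
  rw [key] at h2
  exact (congrArg (fun φ : ℓ²(Lattice d, ℂ) => φ x) h2).symm

/-! ### Resolvent expansions and the Schur complement -/

/-- The geometric resolvent identity. -/
theorem gr_expand {d : ℕ} {Γ Γ' : Set (Lattice d)} (hΓ : Γ' ⊆ Γ) {S : Finset (Lattice d)}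
    (hS : ∀ k, k ∈ S ↔ k ∈ Γ ∧ k ∉ Γ') {c : ℝ} {w : Lattice d → ℂ} (hw : IsDissipative c w)
    (x : Lattice d) {y : Lattice d} (hy : y ∈ Γ') :
    gr Γ w x y = gr Γ' w x y +
      ∑ k ∈ S, (∑ e ∈ unitVectors d, gr Γ' w (k + e) y) * gr Γ w x k := by
  classical
  set ψ := res Γ' w (lp.single 2 y (1 : ℂ)) with hψ
  have h0 : ∀ k ∉ Γ', ψ k = 0 := fun k hk => gr_eq_zero hw hk hy
  -- The function ψ lives on Γ', so passing from Γ' to Γ only adds the hopping out of Γ' into S;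
  -- applying the resolvent of Γ to this equation gives the identity.
  have key : op Γ w ψ =
      lp.single 2 y (1 : ℂ) - ∑ k ∈ S, (∑ e ∈ unitVectors d, ψ (k + e)) • lp.single 2 k (1 : ℂ) := by
    rw [← op_res Γ' hw (lp.single 2 y (1 : ℂ)), ← hψ]
    ext k
    simp only [lp.coeFn_sub, lp.coeFn_sum, lp.coeFn_smul, Pi.sub_apply, Finset.sum_apply,
      Pi.smul_apply, op_apply _ hw, lp.single_apply, Pi.single_apply, smul_eq_mul, mul_ite,
      mul_one, mul_zero, Finset.sum_ite_eq, hS]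
    have h1 : ∀ e, (if k + e ∈ Γ then ψ (k + e) else 0) = ψ (k + e) := fun e => by
      split_ifs with h
      · rfl
      · exact (h0 _ fun h' => h (hΓ h')).symm
    have h2 : ∀ e, (if k + e ∈ Γ' then ψ (k + e) else 0) = ψ (k + e) := fun e => by
      split_ifs with h
      · rfl
      · exact (h0 _ h).symm
    simp only [h1, h2]
    by_cases hk : k ∈ Γ'
    · simp [hk, hΓ hk]
    · by_cases hk' : k ∈ Γ
      · simp [hk, hk', h0 k hk]
      · simp [hk, hk']
  have h := congrArg (fun φ => res Γ w φ x) key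
  simp only [res_op Γ hw, map_sub, map_sum, map_smul, lp.coeFn_sub, lp.coeFn_sum, lp.coeFn_smul,
    Pi.sub_apply, Finset.sum_apply, Pi.smul_apply, smul_eq_mul] at h
  exact (sub_eq_iff_eq_add.1 h.symm)

-- This is the identity resolvent ∘ operator = 1 applied to the basis vector at y: the row equation
-- of G at x.
open scoped Classical in
theorem gr_row {d : ℕ} {Γ : Set (Lattice d)} {c : ℝ} {w : Lattice d → ℂ} (hw : IsDissipative c w)
    (x : Lattice d) {y : Lattice d} (hy : y ∈ Γ) :
    w y * gr Γ w x y - ∑ e ∈ unitVectors d, (if y + e ∈ Γ then gr Γ w x (y + e) else 0) =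
      if x = y then 1 else 0 := by
  have key : op Γ w (lp.single 2 y (1 : ℂ)) = w y • lp.single 2 y (1 : ℂ) -
      ∑ e ∈ unitVectors d, (if y + e ∈ Γ then lp.single 2 (y + e) (1 : ℂ) else 0) := by
    ext k
    simp only [lp.coeFn_sub, lp.coeFn_sum, lp.coeFn_smul, Pi.sub_apply, Finset.sum_apply,
      Pi.smul_apply, op_apply _ hw, smul_eq_mul, lp.single_apply, Pi.single_apply]
    have h1 : ∀ e ∈ unitVectors d, (if k + e ∈ Γ then if k + e = y then (1 : ℂ) else 0 else 0) =
        if k + e = y then 1 else 0 := fun e _ => by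
      split_ifs with h h' h'
      · rfl
      · rfl
      · exact absurd (h' ▸ hy) h
      · rfl
    have h2 : ∀ e ∈ unitVectors d,
        (if y + e ∈ Γ then (lp.single 2 (y + e) (1 : ℂ) : ℓ²(Lattice d, ℂ)) else 0) k =
        if k ∈ Γ then if k + -e = y then 1 else 0 else 0 := fun e _ => by
      have h3 : k + -e = y ↔ k = y + e := by rw [← sub_eq_add_neg, sub_eq_iff_eq_add]
      by_cases hk : k = y + e
      · subst hk
        split_ifs <;> simp_all
      · rw [if_neg (h3.not.2 hk), ite_self]
        split_ifs
        · exact lp.single_apply_ne _ _ _ hk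
        · rfl
    rw [Finset.sum_congr rfl h1, Finset.sum_congr rfl h2]
    have h4 : ∑ e ∈ unitVectors d, (if k + -e = y then (1 : ℂ) else 0) =
        ∑ e ∈ unitVectors d, (if k + e = y then (1 : ℂ) else 0) :=
      Finset.sum_nbij' (fun e => -e) (fun e => -e) (fun e he => neg_mem_unitVectors he)
        (fun e he => neg_mem_unitVectors he) (fun e _ => neg_neg e) (fun e _ => neg_neg e)
        (fun e _ => rfl)
    by_cases hk : k ∈ Γ
    · simp only [if_pos hk, h4]
      by_cases hky : k = y
      · subst hky; ring
      · simp only [if_neg hky]; ring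
    · have hky : k ≠ y := fun h => hk (h ▸ hy)
      simp [hk, hky]
  have h := congrArg (fun φ => res Γ w φ x) key
  simp only [res_op Γ hw, map_sub, map_sum, map_smul, lp.coeFn_sub, lp.coeFn_sum, lp.coeFn_smul,
    Pi.sub_apply, Finset.sum_apply, Pi.smul_apply, smul_eq_mul] at h
  rw [lp.single_apply, Pi.single_apply] at h
  rw [h, gr]
  congr 1
  refine Finset.sum_congr rfl fun e _ => ?_
  split_ifs
  · rfl
  · simp

open scoped Classical in
/-- The Schur complement of `-χ_Γ Δ χ_Γ + w` on `Γ \ Γ'`. -/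
def schur {d : ℕ} (Γ' : Set (Lattice d)) (w : Lattice d → ℂ) (k y : Lattice d) : ℂ :=
  (if k = y then w y else 0) - (∑ e ∈ unitVectors d, if k = y + e then 1 else 0) -
    ∑ e ∈ unitVectors d,
      if y + e ∈ Γ' then ∑ e' ∈ unitVectors d, gr Γ' w (k + e') (y + e) else 0

-- In the row equation at y, each G(x, y+e) with y+e in Γ' is eliminated by the geometric resolvent
-- identity. What remains involves only sites of S and displays G on S as a left inverse of the
-- finite Schur matrix.
open scoped Classical in
theorem gr_mul_schur {d : ℕ} {Γ Γ' : Set (Lattice d)} (hΓ : Γ' ⊆ Γ) {S : Finset (Lattice d)}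
    (hS : ∀ k, k ∈ S ↔ k ∈ Γ ∧ k ∉ Γ') {c : ℝ} {w : Lattice d → ℂ} (hw : IsDissipative c w)
    {x y : Lattice d} (hx : x ∈ S) (hy : y ∈ S) :
    ∑ k ∈ S, gr Γ w x k * schur Γ' w k y = if x = y then 1 else 0 := by
  rw [← gr_row hw x ((hS y).1 hy).1]
  simp only [schur, mul_sub, Finset.sum_sub_distrib]
  rw [sub_sub]
  congr 1
  · simp [hy, mul_comm]
  · simp only [Finset.mul_sum]
    rw [Finset.sum_comm, Finset.sum_comm (s := S), ← Finset.sum_add_distrib]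
    refine Finset.sum_congr rfl fun e _ => ?_
    by_cases h' : y + e ∈ Γ'
    · have hns : y + e ∉ S := fun h => ((hS _).1 h).2 h'
      have h1 : ∀ k ∈ S, gr Γ w x k * (if k = y + e then 1 else 0) = 0 := fun k hk => by
        rw [if_neg (fun h : k = y + e => hns (h ▸ hk)), mul_zero]
      rw [Finset.sum_eq_zero h1, zero_add, if_pos (hΓ h'), gr_expand hΓ hS hw x h',
        gr_eq_zero hw ((hS x).1 hx).2 h', zero_add]
      refine Finset.sum_congr rfl fun k _ => ?_
      rw [if_pos h', mul_comm]
    · simp only [if_neg h', mul_zero, Finset.sum_const_zero, add_zero]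
      by_cases h : y + e ∈ Γ
      · rw [if_pos h]
        simp [(hS (y + e)).2 ⟨h, h'⟩]
      · have hns : y + e ∉ S := fun h1 => h ((hS _).1 h1).1
        rw [if_neg h]
        refine Finset.sum_eq_zero fun k hk => ?_
        rw [if_neg (fun h : k = y + e => hns (h ▸ hk)), mul_zero]

/-- Pointwise convergence of uniformly bounded, uniformly dissipative potentials gives strong
resolvent convergence. Norm continuity would fail for configurations in the product topology; this
version gives the measurability in ω. -/
theorem continuous_gr {d : ℕ} (Γ : Set (Lattice d)) {X : Type*} [TopologicalSpace X]
    {w : X → Lattice d → ℂ} {c K : ℝ} (hw : ∀ t, IsDissipative c (w t))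
    (hK : ∀ t x, ‖w t x‖ ≤ K) (hcont : ∀ x, Continuous fun t => w t x) (x y : Lattice d) :
    Continuous fun t => gr Γ (w t) x y := by
  rw [continuous_iff_continuousAt]
  intro t₀
  set ψ := res Γ (w t₀) (lp.single 2 y (1 : ℂ)) with hψ
  have hc := (hw t₀).pos
  have happ : ∀ t k, (op Γ (w t₀) ψ - op Γ (w t) ψ) k = (w t₀ k - w t k) * ψ k := fun t k => by
    rw [lp.coeFn_sub, Pi.sub_apply, op_apply Γ (hw t₀), op_apply Γ (hw t)]; ring
  -- The second resolvent identity, with the resolvent at t estimated by 1/c.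
  have hdiff : ∀ t, ‖gr Γ (w t) x y - gr Γ (w t₀) x y‖ ≤
      c⁻¹ * ‖op Γ (w t₀) ψ - op Γ (w t) ψ‖ := fun t => by
    refine le_trans ?_ (norm_res_apply_le Γ (hw t) _)
    refine le_trans (le_of_eq ?_) (norm_lp_apply_le _ x)
    rw [map_sub, res_op Γ (hw t), op_res Γ (hw t₀)]
    rfl
  have hsq : Filter.Tendsto (fun t => ‖op Γ (w t₀) ψ - op Γ (w t) ψ‖ ^ 2) (nhds t₀) (nhds 0) := by
    have h1 : ∀ t, ‖op Γ (w t₀) ψ - op Γ (w t) ψ‖ ^ 2 = ∑' k, ‖(w t₀ k - w t k) * ψ k‖ ^ 2 :=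
      fun t => by
        rw [← (norm_sq_hasSum _).tsum_eq]
        exact tsum_congr fun k => by rw [happ]
    have h2 : (0 : ℝ) = ∑' k, ‖(w t₀ k - w t₀ k) * ψ k‖ ^ 2 := by simp
    simp only [h1]
    rw [h2]
    refine tendsto_tsum_of_dominated_convergence (bound := fun k => (2 * K) ^ 2 * ‖ψ k‖ ^ 2)
      ((norm_sq_hasSum ψ).summable.mul_left _) (fun k => ?_) (Filter.Eventually.of_forall ?_)
    · exact Continuous.tendsto
        (((continuous_const.sub (hcont k)).mul continuous_const).norm.pow 2) t₀
    · intro t k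
      rw [Real.norm_of_nonneg (by positivity), norm_mul, mul_pow]
      refine mul_le_mul_of_nonneg_right (pow_le_pow_left₀ (norm_nonneg _) ?_ 2) (by positivity)
      have := norm_sub_le (w t₀ k) (w t k)
      linarith [hK t₀ k, hK t k]
  have hnorm : Filter.Tendsto (fun t => ‖op Γ (w t₀) ψ - op Γ (w t) ψ‖) (nhds t₀) (nhds 0) := by
    have := hsq.sqrt
    simpa [Real.sqrt_sq] using this
  rw [ContinuousAt, tendsto_iff_norm_sub_tendsto_zero]
  refine squeeze_zero (fun _ => norm_nonneg _) hdiff ?_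
  simpa using hnorm.const_mul c⁻¹

/-! ### Half moments under monotone perturbations -/

/-- The square root maps the right half-plane into the sector |arg| ≤ π/4, where the modulus is
controlled by the real part. An integral of moduli is thereby reduced to a contour integral. -/
theorem norm_cpow_half_le {z : ℂ} (hz : 0 < z.re) :
    ‖z ^ (1 / 2 : ℂ)‖ ≤ Real.sqrt 2 * (z ^ (1 / 2 : ℂ)).re := by
  set f := z ^ (1 / 2 : ℂ) with hf
  have hz0 : z ≠ 0 := fun h => by rw [h] at hz; simp at hz
  have hsq : f * f = z := by
    rw [hf, ← Complex.cpow_add _ _ hz0]; norm_num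
  have hre : 0 ≤ f.re := by
    rw [hf, Complex.cpow_def_of_ne_zero hz0, Complex.exp_re]
    refine mul_nonneg (Real.exp_pos _).le (Real.cos_nonneg_of_mem_Icc ?_)
    have h1 := Complex.neg_pi_lt_arg z
    have h2 := Complex.arg_le_pi z
    have h3 : (Complex.log z * (1 / 2)).im = z.arg / 2 := by
      rw [show (1 / 2 : ℂ) = ((1 / 2 : ℝ) : ℂ) by push_cast; rfl, Complex.im_mul_ofReal,
        Complex.log_im]
      ring
    rw [h3]
    constructor <;> linarith
  have h1 : f.im ^ 2 ≤ f.re ^ 2 := by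
    have h2 := congrArg Complex.re hsq
    rw [Complex.mul_re] at h2
    nlinarith
  refine le_of_sq_le_sq ?_ (by positivity)
  rw [mul_pow, Real.sq_sqrt zero_le_two, Complex.sq_norm, Complex.normSq_apply]
  nlinarith

/-- A weak-type bound for boundary values of analytic functions with positive real part. -/
theorem integral_sqrt_norm_le {F : ℂ → ℂ} {a R : ℝ} (ha : 0 ≤ a) (hR : 0 < R)
    (hd : ∀ ζ : ℂ, 0 ≤ ζ.im → DifferentiableAt ℂ F ζ)
    (hre : ∀ ζ : ℂ, 0 ≤ ζ.im → 0 < (F ζ).re)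
    (hF : ∀ ζ : ℂ, 0 < ζ.im → ‖F ζ‖ ≤ a / ζ.im) :
    ∫ t in (-R)..R, Real.sqrt ‖F t‖ ≤ 12 * Real.sqrt (R * a) := by
  set f : ℂ → ℂ := fun ζ => F ζ ^ (1 / 2 : ℂ) with hf
  have hfd : ∀ ζ : ℂ, 0 ≤ ζ.im → DifferentiableAt ℂ f ζ := fun ζ hζ =>
    (hd ζ hζ).cpow_const (Or.inl (hre ζ hζ))
  have hnorm : ∀ ζ : ℂ, 0 ≤ ζ.im → ‖f ζ‖ = Real.sqrt ‖F ζ‖ := fun ζ hζ => by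
    have h0 : F ζ ≠ 0 := fun h => by have := hre ζ hζ; rw [h] at this; simp at this
    have hsq : f ζ * f ζ = F ζ := by
      simp only [hf]
      rw [← Complex.cpow_add _ _ h0]; norm_num
    rw [← hsq, norm_mul, Real.sqrt_mul_self (norm_nonneg _)]
  have hle : ∀ ζ : ℂ, 0 < ζ.im → ‖f ζ‖ ≤ Real.sqrt a * ζ.im ^ (-(1 / 2) : ℝ) := fun ζ hζ => by
    rw [hnorm ζ hζ.le, Real.rpow_neg hζ.le, ← Real.sqrt_eq_rpow, ← div_eq_mul_inv,
      ← Real.sqrt_div ha]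
    exact Real.sqrt_le_sqrt (hF ζ hζ)
  -- Cauchy's theorem on [-R,R] × [0,R]. The square root turns the bound a/Im ζ into the integrable
  -- singularity y^(-1/2), so each vertical side and the top contribute at most 2√(Ra). The constant
  -- 12 is 6 times the crude bound √2 ≤ 2.
  have hrect := Complex.integral_boundary_rect_eq_zero_of_differentiableOn f
    ((-R : ℝ) : ℂ) ((R : ℂ) + R * Complex.I) (fun ζ hζ => (hfd ζ (by
      have := hζ.2
      simp only [Set.mem_preimage, Complex.ofReal_im, Complex.add_im, Complex.mul_im,
        Complex.ofReal_re, Complex.I_im, Complex.I_re, mul_one, mul_zero, add_zero, zero_add,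
        Set.uIcc_of_le hR.le, Set.mem_Icc] at this
      exact this.1)).differentiableWithinAt)
  simp only [Complex.ofReal_re, Complex.ofReal_im, Complex.add_re, Complex.add_im, Complex.mul_re,
    Complex.mul_im, Complex.I_re, Complex.I_im, mul_zero, mul_one, sub_zero, zero_add, add_zero,
    zero_mul, Complex.ofReal_zero, smul_eq_mul] at hrect
  have hpow : ∫ y in (0 : ℝ)..R, Real.sqrt a * y ^ (-(1 / 2) : ℝ) = 2 * Real.sqrt (R * a) := by
    rw [intervalIntegral.integral_const_mul, integral_rpow (Or.inl (by norm_num)),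
      Real.zero_rpow (by norm_num), Real.sqrt_mul hR.le, Real.sqrt_eq_rpow R]
    norm_num
    ring
  have hint : IntervalIntegrable (fun y : ℝ => Real.sqrt a * y ^ (-(1 / 2) : ℝ)) volume 0 R :=
    (intervalIntegral.intervalIntegrable_rpow' (by norm_num)).const_mul _
  have hvert : ∀ x : ℝ, ‖∫ y in (0 : ℝ)..R, f (x + y * Complex.I)‖ ≤ 2 * Real.sqrt (R * a) :=
    fun x => by
      rw [← hpow]
      refine intervalIntegral.norm_integral_le_of_norm_le hR.le
        (Filter.Eventually.of_forall fun y hy => ?_) hint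
      refine (hle _ ?_).trans_eq ?_
      · simpa using hy.1
      · simp
  have htop : ‖∫ x in (-R)..R, f (x + R * Complex.I)‖ ≤ 2 * Real.sqrt (R * a) := by
    refine (intervalIntegral.norm_integral_le_of_norm_le_const
      (C := Real.sqrt a * R ^ (-(1 / 2) : ℝ)) fun x _ => ?_).trans_eq ?_
    · refine (hle _ ?_).trans_eq ?_
      · simpa using hR
      · simp
    · rw [Real.rpow_neg hR.le, ← Real.sqrt_eq_rpow, sub_neg_eq_add, abs_of_pos (by linarith),
        Real.sqrt_mul hR.le]
      have h0 := Real.sqrt_pos.2 hR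
      field_simp
      rw [Real.sq_sqrt hR.le]
      ring
  have hbot : ‖∫ x in (-R)..R, f x‖ ≤ 6 * Real.sqrt (R * a) := by
    have h1 : ∫ x in (-R)..R, f x = (∫ x in (-R)..R, f (x + R * Complex.I)) -
        Complex.I * (∫ y in (0 : ℝ)..R, f (R + y * Complex.I)) +
        Complex.I * (∫ y in (0 : ℝ)..R, f ((-R : ℝ) + y * Complex.I)) := by
      linear_combination hrect
    rw [h1]
    refine (norm_add_le _ _).trans ?_
    refine (add_le_add (norm_sub_le _ _) le_rfl).trans ?_
    rw [norm_mul, norm_mul, Complex.norm_I, one_mul, one_mul]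
    linarith [hvert R, hvert (-R)]
  have hcont : ContinuousOn (fun t : ℝ => f t) (Set.uIcc (-R) R) :=
    fun t _ => (ContinuousAt.comp (f := fun t : ℝ => (t : ℂ)) (hfd t (by simp)).continuousAt
      Complex.continuous_ofReal.continuousAt).continuousWithinAt
  have hfi : IntervalIntegrable (fun t : ℝ => f t) volume (-R) R := hcont.intervalIntegrable
  have hreI : ∫ t in (-R)..R, (f t).re = (∫ t in (-R)..R, f t).re := by
    have := Complex.reCLM.intervalIntegral_comp_comm hfi
    simpa using this
  calc ∫ t in (-R)..R, Real.sqrt ‖F t‖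
      ≤ ∫ t in (-R)..R, Real.sqrt 2 * (f t).re := by
        refine intervalIntegral.integral_mono_on (by linarith) ?_ ?_ fun t _ => ?_
        · refine ContinuousOn.intervalIntegrable ?_
          refine hcont.norm.congr fun t _ => (hnorm t (by simp)).symm
        · exact ((Complex.continuous_re.comp_continuousOn hcont).const_mul _).intervalIntegrable
        · rw [← hnorm t (by simp)]
          exact norm_cpow_half_le (hre t (by simp))
    _ = Real.sqrt 2 * (∫ t in (-R)..R, f t).re := by
        rw [intervalIntegral.integral_const_mul, hreI]
    _ ≤ 2 * (6 * Real.sqrt (R * a)) := by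
        have h2 : Real.sqrt 2 ≤ 2 := (Real.sqrt_le_left zero_le_two).2 (by norm_num)
        exact mul_le_mul_of_nonneg h2 ((Complex.re_le_norm _).trans hbot) (Real.sqrt_nonneg 2)
          (by positivity)
    _ = _ := by ring

theorem IsDissipative.add_mul {α : Type} {c : ℝ} {w : α → ℂ} (hw : IsDissipative c w)
    {U : α → ℝ} (hU : ∀ a, 0 ≤ U a) (hB : ∃ B : ℝ, ∀ a, U a ≤ B) {ζ : ℂ} (hζ : 0 ≤ ζ.im) :
    IsDissipative c fun a => w a + ζ * U a := by
  obtain ⟨K, hK⟩ := hw.bdd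
  obtain ⟨B, hB⟩ := hB
  refine ⟨hw.pos, ⟨K + ‖ζ‖ * B, fun a => ?_⟩, fun a => ?_⟩
  · refine (norm_add_le _ _).trans (add_le_add (hK a) ?_)
    rw [norm_mul, Complex.norm_of_nonneg (hU a)]
    exact mul_le_mul_of_nonneg_left (hB a) (norm_nonneg _)
  · rw [Complex.add_im, Complex.im_mul_ofReal]
    have := mul_nonneg hζ (hU a)
    linarith [hw.le_im a]

theorem differentiableAt_res {d : ℕ} (Γ : Set (Lattice d)) {c : ℝ} {w : Lattice d → ℂ}
    (hw : IsDissipative c w) {U : Lattice d → ℝ} (hU : ∀ a, 0 ≤ U a)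
    (hB : ∃ B : ℝ, ∀ a, U a ≤ B) {ζ : ℂ} (hζ : 0 ≤ ζ.im) :
    DifferentiableAt ℂ (fun ζ : ℂ => res Γ fun x => w x + ζ * U x) ζ := by
  obtain ⟨B, hB'⟩ := hB
  have hUb : ∃ K : ℝ, ∀ a, ‖(U a : ℂ)‖ ≤ K :=
    ⟨B, fun a => by rw [Complex.norm_of_nonneg (hU a)]; exact hB' a⟩
  have hop : ∀ ζ : ℂ, op Γ (fun x => w x + ζ * U x) = op Γ w + ζ • mulC fun x => (U x : ℂ) := by
    intro ζ
    rw [op, op, add_assoc]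
    congr 1
    obtain ⟨K, hK⟩ := hw.bdd
    obtain ⟨K', hK'⟩ := hUb
    ext ψ x
    rw [add_apply, lp.coeFn_add, Pi.add_apply, smul_apply, lp.coeFn_smul, Pi.smul_apply,
      mulC_apply ⟨K, hK⟩, mulC_apply ⟨K', hK'⟩, mulC_apply ⟨K + ‖ζ‖ * K', fun a => ?_⟩, smul_eq_mul]
    · ring
    · refine (norm_add_le _ _).trans (add_le_add (hK a) ?_)
      rw [norm_mul]
      exact mul_le_mul_of_nonneg_left (hK' a) (norm_nonneg _)
  have hu : IsUnit (op Γ fun x => w x + ζ * U x) := isUnit_op Γ (hw.add_mul hU ⟨B, hB'⟩ hζ)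
  rw [hop] at hu
  simp only [res, hop]
  exact DifferentiableAt.inverse
    ((differentiableAt_const _).add (differentiableAt_id.smul_const _)) hu

/-- With g the resolvent applied to φ, Im⟨g,φ⟩ is at least m‖χ_J g‖², while |⟨g,φ⟩| ≤ ‖χ_J g‖ ‖φ‖.
Dissipation on the support of φ suffices, and the bound does not see c. -/
theorem norm_inner_res_le {d : ℕ} (Γ J : Set (Lattice d)) {c m : ℝ} {w : Lattice d → ℂ}
    (hw : IsDissipative c w) (hm : 0 < m) (hJ : ∀ x ∈ J, m ≤ (w x).im)
    {φ : ℓ²(Lattice d, ℂ)} (hφ : cutoff J φ = φ) :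
    ‖inner ℂ (res Γ w φ) φ‖ ≤ ‖φ‖ ^ 2 / m := by
  classical
  set g := res Γ w φ with hg
  have h1 := hasSum_im_inner_op Γ hw g
  rw [hg, op_res Γ hw, ← hg] at h1
  have h2 : m * ‖cutoff J g‖ ^ 2 ≤ (inner ℂ g φ).im := by
    refine hasSum_le (fun x => ?_) ((norm_sq_hasSum (cutoff J g)).mul_left m) h1
    rw [cutoff_apply]
    split_ifs with hx
    · exact mul_le_mul_of_nonneg_right (hJ x hx) (by positivity)
    · rw [norm_zero]
      have := mul_nonneg (hw.pos.le.trans (hw.le_im x)) (sq_nonneg ‖g x‖)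
      simpa using this
  have h3 : (inner ℂ g φ).im ≤ ‖inner ℂ g φ‖ := (le_abs_self _).trans (Complex.abs_im_le_norm _)
  have h4 : ‖inner ℂ g φ‖ ≤ ‖cutoff J g‖ * ‖φ‖ := by
    have h5 : inner ℂ g φ = inner ℂ (cutoff J g) φ := by
      nth_rw 1 [← hφ]
      exact ((isSelfAdjoint_cutoff J).isSymmetric g φ).symm
    rw [h5]
    exact norm_inner_le_norm _ _
  rw [le_div_iff₀ hm]
  set s := ‖inner ℂ g φ‖
  rcases (norm_nonneg (cutoff J g)).eq_or_lt with h | h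
  · rw [← h, zero_mul] at h4
    nlinarith [sq_nonneg ‖φ‖]
  · have h6 : m * ‖cutoff J g‖ ≤ ‖φ‖ := by
      have : m * ‖cutoff J g‖ ^ 2 ≤ ‖cutoff J g‖ * ‖φ‖ := h2.trans (h3.trans h4)
      nlinarith
    calc s * m ≤ ‖cutoff J g‖ * ‖φ‖ * m := mul_le_mul_of_nonneg_right h4 hm.le
      _ = m * ‖cutoff J g‖ * ‖φ‖ := by ring
      _ ≤ ‖φ‖ * ‖φ‖ := mul_le_mul_of_nonneg_right h6 (norm_nonneg _)
      _ = ‖φ‖ ^ 2 := (sq _).symm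

/-- For U ≥ 0 the function F(ζ) = i⟨φ, R(ζ)φ⟩, with R(ζ) the resolvent for w + ζU, is analytic on
the closed upper half-plane and has positive real part there. Complex ζ adds dissipation m·Im ζ on
J, so the half-moment bound for such functions applies with a = 4/m. -/
theorem sqrt_norm_inner_res {d : ℕ} (Γ J : Set (Lattice d)) {c m R : ℝ}
    {w : Lattice d → ℂ} (hw : IsDissipative c w) {U : Lattice d → ℝ} (hU : ∀ x, 0 ≤ U x)
    (hB : ∃ B : ℝ, ∀ x, U x ≤ B) (hm : 0 < m) (hJ : ∀ x ∈ J, m ≤ U x) (hR : 0 < R)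
    {φ : ℓ²(Lattice d, ℂ)} (hφ : cutoff J φ = φ) (hn : ‖φ‖ ≤ 2) :
    ∫⁻ t in Set.Icc (-R) R, ‖inner ℂ (res Γ (fun x => w x + (t : ℂ) * U x) φ) φ‖ₑ ^ (1 / 2 : ℝ) ≤
      ENNReal.ofReal (24 * Real.sqrt (R / m)) := by
  rcases eq_or_ne φ 0 with h0 | h0
  · subst h0
    simp
  set F : ℂ → ℂ := fun ζ => Complex.I * inner ℂ φ (res Γ (fun x => w x + ζ * U x) φ) with hF
  have hd : ∀ ζ : ℂ, 0 ≤ ζ.im → DifferentiableAt ℂ F ζ := fun ζ hζ => by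
    have h1 := (differentiableAt_res Γ hw hU hB hζ).clm_apply (differentiableAt_const φ)
    exact (((innerSL ℂ φ).differentiableAt).comp ζ h1).const_mul Complex.I
  have hnorm : ∀ ζ : ℂ, ‖F ζ‖ = ‖inner ℂ (res Γ (fun x => w x + ζ * U x) φ) φ‖ := fun ζ => by
    rw [hF, norm_mul, Complex.norm_I, one_mul, norm_inner_symm]
  have hre : ∀ ζ : ℂ, 0 ≤ ζ.im → 0 < (F ζ).re := fun ζ hζ => by
    have hwζ := hw.add_mul hU hB hζ
    set g := res Γ (fun x => w x + ζ * U x) φ with hg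
    have h1 := le_im_inner_op Γ hwζ g
    rw [hg, op_res Γ hwζ, ← hg] at h1
    have hg0 : g ≠ 0 := fun h => h0 (by rw [← op_res Γ hwζ φ, ← hg, h, map_zero])
    have h2 : (F ζ).re = (inner ℂ g φ).im := by
      rw [← inner_conj_symm g φ, Complex.conj_im, hF, Complex.I_mul_re]
    rw [h2]
    exact (mul_pos hw.pos (pow_pos (norm_pos_iff.2 hg0) 2)).trans_le h1
  have hle : ∀ ζ : ℂ, 0 < ζ.im → ‖F ζ‖ ≤ (4 / m) / ζ.im := fun ζ hζ => by
    rw [hnorm]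
    refine (norm_inner_res_le Γ J (hw.add_mul hU hB hζ.le) (mul_pos hm hζ) (fun x hx => ?_)
      hφ).trans ?_
    · rw [Complex.add_im, Complex.im_mul_ofReal, mul_comm]
      have := mul_le_mul_of_nonneg_left (hJ x hx) hζ.le
      linarith [hw.pos.le.trans (hw.le_im x)]
    · rw [div_div]
      refine div_le_div_of_nonneg_right ?_ (by positivity)
      nlinarith [norm_nonneg φ]
  have hint := integral_sqrt_norm_le (F := F) (a := 4 / m) (by positivity) hR hd hre hle
  have hcont : ContinuousOn (fun t : ℝ => Real.sqrt ‖F t‖) (Set.Icc (-R) R) := fun t _ =>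
    ((ContinuousAt.comp (f := fun t : ℝ => (t : ℂ)) (hd t (by simp)).continuousAt
      Complex.continuous_ofReal.continuousAt).norm.sqrt).continuousWithinAt
  have hconv : ∀ t : ℝ, ‖inner ℂ (res Γ (fun x => w x + (t : ℂ) * U x) φ) φ‖ₑ ^ (1 / 2 : ℝ) =
      ENNReal.ofReal (Real.sqrt ‖F t‖) := fun t => by
    rw [hnorm, Real.sqrt_eq_rpow, ← ENNReal.ofReal_rpow_of_nonneg (norm_nonneg _) (by norm_num),
      ofReal_norm]
  simp only [hconv]
  rw [← ofReal_integral_eq_lintegral_ofReal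
    (hcont.integrableOn_Icc) (Filter.Eventually.of_forall fun t => Real.sqrt_nonneg _),
    integral_Icc_eq_integral_Ioc, ← intervalIntegral.integral_of_le (by linarith)]
  refine ENNReal.ofReal_le_ofReal (hint.trans_eq ?_)
  rw [show R * (4 / m) = 2 ^ 2 * (R / m) by ring, Real.sqrt_mul (by positivity),
    Real.sqrt_sq zero_le_two]
  ring

/-- Fractional moment bound for the Green function between sites on which the random
potential is monotone. -/
theorem lintegral_gr_le_of_monotone {d : ℕ} (Γ : Set (Lattice d)) {c m R : ℝ}
    {w : Lattice d → ℂ} (hw : IsDissipative c w) {U : Lattice d → ℝ} (hU : ∀ x, 0 ≤ U x)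
    (hB : ∃ B : ℝ, ∀ x, U x ≤ B) (hm : 0 < m) {j j' : Lattice d} (hj : m ≤ U j) (hj' : m ≤ U j')
    (hR : 0 < R) :
    ∫⁻ t in Set.Icc (-R) R, ‖gr Γ (fun x => w x + ((t : ℝ) : ℂ) * U x) j j'‖ₑ ^ (1 / 2 : ℝ) ≤
      4 * ENNReal.ofReal (24 * Real.sqrt (R / m)) := by
  classical
  set J : Set (Lattice d) := {j, j'} with hJdef
  have hJ : ∀ x ∈ J, m ≤ U x := by
    rintro x (rfl | rfl) <;> assumption
  set δ : Lattice d → ℓ²(Lattice d, ℂ) := fun y => lp.single 2 y (1 : ℂ) with hδ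
  have hcut : ∀ y ∈ J, cutoff J (δ y) = δ y := fun y hy => by
    ext x
    rw [cutoff_apply]
    split_ifs with hx
    · rfl
    · exact (lp.single_apply_ne (E := fun _ => ℂ) 2 y 1 (fun h => hx (h ▸ hy) : x ≠ y)).symm
  have hcj := hcut j (by simp [hJdef])
  have hcj' := hcut j' (by simp [hJdef])
  have hnδ : ∀ y, ‖δ y‖ = 1 := fun y => norm_single_one y
  set W : ℝ → Lattice d → ℂ := fun t x => w x + (t : ℂ) * U x with hW
  set Q : ℓ²(Lattice d, ℂ) → ℝ → ℝ≥0∞ :=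
    fun φ t => ‖inner ℂ (res Γ (W t) φ) φ‖ₑ ^ (1 / 2 : ℝ) with hQ
  have hmeas : ∀ φ, Measurable (Q φ) := fun φ => by
    have hc : Continuous fun t : ℝ => inner ℂ (res Γ (W t) φ) φ := by
      rw [continuous_iff_continuousAt]
      intro t
      have h1 := (differentiableAt_res Γ hw hU hB (ζ := (t : ℂ)) (by simp)).clm_apply
        (differentiableAt_const φ)
      have h2 := ContinuousAt.comp (f := fun t : ℝ => (t : ℂ)) h1.continuousAt
        Complex.continuous_ofReal.continuousAt
      exact h2.inner continuousAt_const
    exact hc.enorm.measurable.pow_const _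
  have hbound : ∀ φ, cutoff J φ = φ → ‖φ‖ ≤ 2 →
      ∫⁻ t in Set.Icc (-R) R, Q φ t ≤ ENNReal.ofReal (24 * Real.sqrt (R / m)) :=
    fun φ h1 h2 => sqrt_norm_inner_res Γ J hw hU hB hm hJ hR h1 h2
  -- Polarization expresses the off-diagonal entry by four diagonal ones, with vectors of norm at
  -- most 2 supported in {j, j'}; subadditivity of the square root separates them.
  have hpol : ∀ t, ‖gr Γ (W t) j j'‖ₑ ^ (1 / 2 : ℝ) ≤
      Q (δ j + δ j') t + Q (δ j - δ j') t + Q (δ j + Complex.I • δ j') t +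
        Q (δ j - Complex.I • δ j') t := fun t => by
    have h := inner_map_polarization (res Γ (W t)).toLinearMap (δ j) (δ j')
    simp only [ContinuousLinearMap.coe_coe] at h
    have h1 : ‖gr Γ (W t) j j'‖ = ‖inner ℂ (res Γ (W t) (δ j')) (δ j)‖ := by
      simp [hδ, lp.inner_single_right, gr]
    have h2 : ∀ a b e f : ℂ, ‖(a - b + Complex.I * e - Complex.I * f) / 4‖ₑ ≤
        ‖a‖ₑ + ‖b‖ₑ + ‖e‖ₑ + ‖f‖ₑ := fun a b e f => by
      have : ‖(a - b + Complex.I * e - Complex.I * f) / 4‖ ≤ ‖a‖ + ‖b‖ + ‖e‖ + ‖f‖ := by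
        rw [norm_div]
        have h3 := norm_sub_le (a - b + Complex.I * e) (Complex.I * f)
        have h4 := norm_add_le (a - b) (Complex.I * e)
        have h5 := norm_sub_le a b
        rw [norm_mul, Complex.norm_I, one_mul] at h3 h4
        have h6 : ‖(4 : ℂ)‖ = 4 := by norm_num
        rw [h6, div_le_iff₀ (by norm_num)]
        nlinarith [norm_nonneg a, norm_nonneg b, norm_nonneg e, norm_nonneg f]
      simp only [← ofReal_norm]
      rw [← ENNReal.ofReal_add (by positivity) (by positivity),
        ← ENNReal.ofReal_add (by positivity) (by positivity),
        ← ENNReal.ofReal_add (by positivity) (by positivity)]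
      exact ENNReal.ofReal_le_ofReal this
    have h3 : ∀ a b : ℝ≥0∞, (a + b) ^ (1 / 2 : ℝ) ≤ a ^ (1 / 2 : ℝ) + b ^ (1 / 2 : ℝ) :=
      fun a b => ENNReal.rpow_add_le_add_rpow a b (by norm_num) (by norm_num)
    rw [← ofReal_norm, h1, ofReal_norm, h]
    refine (ENNReal.rpow_le_rpow (h2 _ _ _ _) (by norm_num)).trans ?_
    refine (h3 _ _).trans (add_le_add ?_ le_rfl)
    refine (h3 _ _).trans (add_le_add ?_ le_rfl)
    exact h3 _ _
  have hI : ‖Complex.I • δ j'‖ = 1 := by rw [norm_smul, Complex.norm_I, hnδ, one_mul]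
  calc _ ≤ ∫⁻ t in Set.Icc (-R) R, (Q (δ j + δ j') t + Q (δ j - δ j') t +
        Q (δ j + Complex.I • δ j') t + Q (δ j - Complex.I • δ j') t) := lintegral_mono hpol
    _ = (∫⁻ t in Set.Icc (-R) R, Q (δ j + δ j') t) + (∫⁻ t in Set.Icc (-R) R, Q (δ j - δ j') t) +
        (∫⁻ t in Set.Icc (-R) R, Q (δ j + Complex.I • δ j') t) +
        ∫⁻ t in Set.Icc (-R) R, Q (δ j - Complex.I • δ j') t := by
      rw [lintegral_add_right _ (hmeas _), lintegral_add_right _ (hmeas _),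
        lintegral_add_right _ (hmeas _)]
    _ ≤ ENNReal.ofReal (24 * Real.sqrt (R / m)) + ENNReal.ofReal (24 * Real.sqrt (R / m)) +
        ENNReal.ofReal (24 * Real.sqrt (R / m)) + ENNReal.ofReal (24 * Real.sqrt (R / m)) := by
      refine add_le_add (add_le_add (add_le_add ?_ ?_) ?_) ?_
      · refine hbound _ (by rw [map_add, hcj, hcj']) ((norm_add_le _ _).trans ?_)
        rw [hnδ, hnδ]; norm_num
      · refine hbound _ (by rw [map_sub, hcj, hcj']) ((norm_sub_le _ _).trans ?_)
        rw [hnδ, hnδ]; norm_num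
      · refine hbound _ (by rw [map_add, map_smul, hcj, hcj']) ((norm_add_le _ _).trans ?_)
        rw [hnδ, hI]; norm_num
      · refine hbound _ (by rw [map_sub, map_smul, hcj, hcj']) ((norm_sub_le _ _).trans ?_)
        rw [hnδ, hI]; norm_num
    _ = _ := by ring

/-! ### Averaging the inverse of a matrix pencil -/

theorem lintegral_abs_rpow_lt_top :
    ∫⁻ r in Set.Icc (-1 : ℝ) 1, ENNReal.ofReal (|r| ^ (-(1 / 2) : ℝ)) < ∞ := by
  have hpos : ∫⁻ r in Set.Icc (0 : ℝ) 1, ENNReal.ofReal (|r| ^ (-(1 / 2) : ℝ)) < ∞ := by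
    have h : IntervalIntegrable (fun r : ℝ => r ^ (-(1 / 2) : ℝ)) volume 0 1 :=
      intervalIntegral.intervalIntegrable_rpow' (by norm_num)
    rw [intervalIntegrable_iff_integrableOn_Ioc_of_le zero_le_one,
      ← integrableOn_Icc_iff_integrableOn_Ioc] at h
    refine lt_of_eq_of_lt (setLIntegral_congr_fun measurableSet_Icc fun r hr => ?_) h.2
    simp only
    rw [abs_of_nonneg hr.1, Real.enorm_eq_ofReal (Real.rpow_nonneg hr.1 _)]
  have hneg : ∫⁻ r in Set.Icc (-1 : ℝ) 0, ENNReal.ofReal (|r| ^ (-(1 / 2) : ℝ)) < ∞ := by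
    have h := ((Measure.measurePreserving_neg (volume : Measure ℝ)).restrict_preimage
      (measurableSet_Icc (a := (0 : ℝ)) (b := 1))).lintegral_comp_emb
      (MeasurableEquiv.neg ℝ).measurableEmbedding
      (fun r => ENNReal.ofReal (|r| ^ (-(1 / 2) : ℝ)))
    simp only [abs_neg] at h
    have hset : Neg.neg ⁻¹' Set.Icc (0 : ℝ) 1 = Set.Icc (-1) 0 := by
      ext r; simp [neg_le, and_comm]
    rw [hset] at h
    rw [h]
    exact hpos
  rw [← Set.Icc_union_Icc_eq_Icc (by norm_num : (-1 : ℝ) ≤ 0) zero_le_one]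
  exact (lintegral_union_le _ _ _).trans_lt (ENNReal.add_lt_top.2 ⟨hneg, hpos⟩)

/-- The integrand exceeds 1 only within distance 1 of c, and that part is translation invariant;
hence the bound is uniform in the position of the singularity. -/
theorem exists_lintegral_abs_sub_rpow_le (R : ℝ) :
    ∃ K : ℝ≥0∞, K ≠ ∞ ∧ ∀ c : ℝ,
      ∫⁻ r in Set.Icc (-R) R, ENNReal.ofReal (|r - c| ^ (-(1 / 2) : ℝ)) ≤ K := by
  set f : ℝ → ℝ≥0∞ := fun r => ENNReal.ofReal (|r| ^ (-(1 / 2) : ℝ)) with hf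
  refine ⟨volume (Set.Icc (-R) R) + ∫⁻ r in Set.Icc (-1 : ℝ) 1, f r,
    ENNReal.add_ne_top.2 ⟨by simp, lintegral_abs_rpow_lt_top.ne⟩, fun c => ?_⟩
  have hle : ∀ r, f r ≤ 1 + (Set.Icc (-1 : ℝ) 1).indicator f r := fun r => by
    by_cases hr : r ∈ Set.Icc (-1 : ℝ) 1
    · rw [Set.indicator_of_mem hr]
      exact le_add_self
    · rw [Set.indicator_of_notMem hr, add_zero]
      have h1 : 1 ≤ |r| := by
        by_contra h
        exact hr (abs_le.1 (not_le.1 h).le)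
      rw [hf]
      exact ENNReal.ofReal_le_one.2 (Real.rpow_le_one_of_one_le_of_nonpos h1 (by norm_num))
  calc ∫⁻ r in Set.Icc (-R) R, f (r - c)
      ≤ ∫⁻ r in Set.Icc (-R) R, (1 + (Set.Icc (-1 : ℝ) 1).indicator f (r - c)) :=
        lintegral_mono fun r => hle _
    _ = volume (Set.Icc (-R) R) +
        ∫⁻ r in Set.Icc (-R) R, (Set.Icc (-1 : ℝ) 1).indicator f (r - c) := by
        rw [lintegral_add_left measurable_const, lintegral_const, one_mul,
          Measure.restrict_apply_univ]
    _ ≤ volume (Set.Icc (-R) R) + ∫⁻ r, (Set.Icc (-1 : ℝ) 1).indicator f (r - c) := by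
        gcongr
        exact Measure.restrict_le_self
    _ = _ := by
        rw [lintegral_sub_right_eq_self (fun r => (Set.Icc (-1 : ℝ) 1).indicator f r),
          lintegral_indicator measurableSet_Icc]

theorem exists_pow_le_prod_norm_sub {s : Multiset ℂ} (hs : s ≠ 0) (r : ℂ) :
    ∃ ρ ∈ s, ‖r - ρ‖ ^ s.card ≤ ‖(s.map fun ρ => r - ρ).prod‖ := by
  obtain ⟨ρ, hρ, hmin⟩ := Multiset.exists_min_image (fun ρ => ‖r - ρ‖) hs
  refine ⟨ρ, hρ, ?_⟩
  have key : ∀ (t : Multiset ℂ) (a : ℝ), 0 ≤ a → (∀ z ∈ t, a ≤ ‖r - z‖) →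
      a ^ t.card ≤ ‖(t.map fun ρ => r - ρ).prod‖ := fun t a ha => by
    induction t using Multiset.induction with
    | empty => simp
    | cons z t ih =>
      intro h
      rw [Multiset.map_cons, Multiset.prod_cons, norm_mul, Multiset.card_cons, pow_succ']
      exact mul_le_mul (h z (Multiset.mem_cons_self z t))
        (ih fun y hy => h y (Multiset.mem_cons_of_mem hy)) (by positivity) (norm_nonneg _)
  exact key s _ (norm_nonneg _) hmin

/-- With D the diagonal matrix of v, det(A + rD) equals det D times the characteristic polynomial of
-D⁻¹A at r. Each linear factor is at least the distance to the root nearest to r, and replacing that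
root by its real part only decreases the distance. -/
theorem exists_le_norm_det_add_diagonal {ι : Type} [Fintype ι] [DecidableEq ι] [Nonempty ι]
    (A : Matrix ι ι ℂ) {v : ι → ℝ} {m : ℝ} (hm : 0 < m) (hv : ∀ i, m ≤ |v i|) :
    ∃ s : Finset ℝ, s.card ≤ Fintype.card ι ∧ ∀ r : ℝ, ∃ c ∈ s,
      (m * |r - c|) ^ Fintype.card ι ≤
        ‖(A + Matrix.diagonal fun i => ((r * v i : ℝ) : ℂ)).det‖ := by
  classical
  have hv0 : ∀ i, (v i : ℂ) ≠ 0 := fun i => by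
    rw [Complex.ofReal_ne_zero]
    intro h
    have := hv i
    rw [h, abs_zero] at this
    linarith
  set M : Matrix ι ι ℂ := Matrix.of fun i j => -(v i : ℂ)⁻¹ * A i j with hM
  have hfac : ∀ r : ℝ, A + (Matrix.diagonal fun i => ((r * v i : ℝ) : ℂ)) =
      (Matrix.diagonal fun i => (v i : ℂ)) * (Matrix.scalar ι (r : ℂ) - M) := fun r => by
    ext i j
    have := hv0 i
    rw [Matrix.diagonal_mul, Matrix.add_apply, Matrix.sub_apply, Matrix.scalar_apply, hM,
      Matrix.of_apply]
    by_cases hij : i = j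
    · subst hij
      simp only [Matrix.diagonal_apply_eq, Complex.ofReal_mul]
      field_simp
      ring
    · simp only [Matrix.diagonal_apply_ne _ hij]
      field_simp
      ring
  have hsplit := IsAlgClosed.splits M.charpoly
  have hcard : M.charpoly.roots.card = Fintype.card ι := by
    rw [← hsplit.natDegree_eq_card_roots, Matrix.charpoly_natDegree_eq_dim]
  have hne : M.charpoly.roots ≠ 0 := fun h => by
    rw [h, Multiset.card_zero] at hcard
    exact Fintype.card_ne_zero hcard.symm
  refine ⟨M.charpoly.roots.toFinset.image Complex.re, ?_, fun r => ?_⟩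
  · exact Finset.card_image_le.trans ((Multiset.toFinset_card_le _).trans hcard.le)
  · obtain ⟨ρ, hρ, hle⟩ := exists_pow_le_prod_norm_sub hne (r : ℂ)
    refine ⟨ρ.re, Finset.mem_image_of_mem _ (Multiset.mem_toFinset.2 hρ), ?_⟩
    rw [hfac, Matrix.det_mul, Matrix.det_diagonal, ← Matrix.eval_charpoly,
      hsplit.eval_eq_prod_roots_of_monic M.charpoly_monic, norm_mul, mul_pow]
    refine mul_le_mul ?_ (le_trans ?_ hle) (by positivity) (norm_nonneg _)
    · rw [norm_prod, ← Finset.card_univ, ← Finset.prod_const]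
      refine Finset.prod_le_prod (fun _ _ => hm.le) fun i _ => ?_
      rw [Complex.norm_real]
      exact hv i
    · rw [hcard]
      refine pow_le_pow_left₀ (abs_nonneg _) ?_ _
      have := Complex.abs_re_le_norm ((r : ℂ) - ρ)
      simpa using this

theorem norm_adjugate_le {ι : Type} [Fintype ι] [DecidableEq ι] {M : Matrix ι ι ℂ} {x : ℝ}
    (hx : 1 ≤ x) (h : ∀ i j, ‖M i j‖ ≤ x) (i j : ι) :
    ‖M.adjugate i j‖ ≤ (Fintype.card ι).factorial * x ^ Fintype.card ι := by
  rw [Matrix.adjugate_apply]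
  have key := Matrix.det_le (abv := NormedField.toAbsoluteValue ℂ) (x := x)
    (A := M.updateRow j (Pi.single i 1)) (fun k l => by
      change ‖(M.updateRow j (Pi.single i 1)) k l‖ ≤ x
      rw [Matrix.updateRow_apply]
      split_ifs
      · by_cases hl : l = i
        · subst hl; simpa using hx
        · rw [Pi.single_eq_of_ne hl, norm_zero]; linarith
      · exact h k l)
  rw [nsmul_eq_mul] at key
  exact key

/-- Fractional moments of the entries of the inverse of `A + r D`, for a real invertible diagonal
matrix `D`, with polynomial dependence on the size of `A`. -/
theorem exists_lintegral_inv_add_diagonal_le (N : ℕ) {m B R τ : ℝ} (hm : 0 < m) (hB : 0 ≤ B)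
    (hR : 0 ≤ R) (hτ : 0 < τ) (hNτ : N * τ ≤ 1 / 2) :
    ∃ C : ℝ≥0∞, C ≠ ∞ ∧ ∀ (ι : Type) [Fintype ι] [DecidableEq ι], Fintype.card ι ≤ N →
      ∀ (A : Matrix ι ι ℂ) (v : ι → ℝ) (a : ℝ), 1 ≤ a → (∀ i j, ‖A i j‖ ≤ a) →
        (∀ i, m ≤ |v i|) → (∀ i, |v i| ≤ B) → ∀ i j,
        ∫⁻ r in Set.Icc (-R) R,
          ‖(A + Matrix.diagonal fun i => ((r * v i : ℝ) : ℂ))⁻¹ i j‖ₑ ^ τ ≤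
          C * ENNReal.ofReal (a ^ (N * τ)) := by
  obtain ⟨K, hK, hKle⟩ := exists_lintegral_abs_sub_rpow_le R
  -- Truncating m at 1 makes b ≥ 1, so powers with the actual dimension n can be raised to powers
  -- with the uniform N.
  set m' := min m 1 with hm'
  have hm'pos : 0 < m' := lt_min hm one_pos
  set b := (1 + R * B) / m' with hb
  have hRB : 0 ≤ R * B := mul_nonneg hR hB
  have hb1 : 1 ≤ b := by
    rw [hb, one_le_div hm'pos]
    linarith [min_le_right m 1]
  refine ⟨ENNReal.ofReal ((N.factorial * b ^ N) ^ τ) * (volume (Set.Icc (-R) R) + N * K),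
    ENNReal.mul_ne_top ENNReal.ofReal_ne_top (ENNReal.add_ne_top.2
      ⟨by simp, ENNReal.mul_ne_top (ENNReal.natCast_ne_top N) hK⟩), ?_⟩
  intro ι _ _ hN A v a ha hA hv hvB i j
  have : Nonempty ι := ⟨i⟩
  set n := Fintype.card ι with hn
  obtain ⟨s, hs, hdet⟩ := exists_le_norm_det_add_diagonal A hm'pos
    (fun i => (min_le_left m 1).trans (hv i))
  set Q : ℝ := N.factorial * b ^ N * a ^ N with hQ
  have hQ0 : 0 < Q := by positivity
  have hpt : ∀ r ∈ Set.Icc (-R) R, r ∉ s →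
      ‖(A + Matrix.diagonal fun i => ((r * v i : ℝ) : ℂ))⁻¹ i j‖ₑ ^ τ ≤
        ENNReal.ofReal (Q ^ τ) *
          (1 + ∑ c ∈ s, ENNReal.ofReal (|r - c| ^ (-(1 / 2) : ℝ))) := by
    intro r hr hrs
    obtain ⟨c, hc, hle⟩ := hdet r
    set M := A + Matrix.diagonal fun i => ((r * v i : ℝ) : ℂ) with hM
    have ht : 0 < |r - c| := abs_pos.2 (sub_ne_zero.2 fun h => hrs (h ▸ hc))
    set t := |r - c| with htdef
    have hdpos : 0 < ‖M.det‖ := lt_of_lt_of_le (by positivity) hle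
    have hentry : ∀ k l, ‖M k l‖ ≤ a * (1 + R * B) := fun k l => by
      have hd : ‖(Matrix.diagonal fun i => ((r * v i : ℝ) : ℂ)) k l‖ ≤ R * B := by
        by_cases hkl : k = l
        · subst hkl
          rw [Matrix.diagonal_apply_eq, Complex.norm_real, Real.norm_eq_abs, abs_mul]
          exact mul_le_mul (abs_le.2 hr) (hvB k) (abs_nonneg _) hR
        · rw [Matrix.diagonal_apply_ne _ hkl, norm_zero]
          exact hRB
      refine (norm_add_le _ _).trans ((add_le_add (hA k l) hd).trans ?_)
      nlinarith
    have hadj := norm_adjugate_le (one_le_mul_of_one_le_of_one_le ha (by linarith)) hentry i j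
    -- Cramer's rule: the adjugate is bounded by its entries, and the determinant by the distance to
    -- the chosen root.
    have h1 : ‖M⁻¹ i j‖ ≤ Q * (t ^ n)⁻¹ := by
      rw [Matrix.inv_def, Ring.inverse_eq_inv', Matrix.smul_apply, smul_eq_mul, norm_mul, norm_inv,
        inv_mul_eq_div, div_le_iff₀ hdpos]
      calc ‖M.adjugate i j‖ ≤ n.factorial * (a * (1 + R * B)) ^ n := hadj
        _ = n.factorial * (a * b) ^ n * m' ^ n := by
          rw [hb, mul_assoc, ← mul_pow]
          congr 2
          field_simp
        _ ≤ N.factorial * (a * b) ^ N * m' ^ n := by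
          have h2 : (n.factorial : ℝ) ≤ N.factorial := by exact_mod_cast Nat.factorial_le hN
          have h3 : (a * b) ^ n ≤ (a * b) ^ N :=
            pow_le_pow_right₀ (one_le_mul_of_one_le_of_one_le ha hb1) hN
          gcongr
        _ = Q * (t ^ n)⁻¹ * (m' * t) ^ n := by
          rw [hQ]
          field_simp
          simp only [mul_pow]
          ring
        _ ≤ Q * (t ^ n)⁻¹ * ‖M.det‖ := by gcongr
    have h2 : ‖M⁻¹ i j‖ ^ τ ≤ Q ^ τ * (1 + t ^ (-(1 / 2) : ℝ)) := by
      refine (Real.rpow_le_rpow (norm_nonneg _) h1 hτ.le).trans ?_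
      rw [Real.mul_rpow hQ0.le (by positivity)]
      refine mul_le_mul_of_nonneg_left ?_ (by positivity)
      rw [← Real.rpow_natCast, ← Real.rpow_neg ht.le, ← Real.rpow_mul ht.le]
      have hnτ : (n : ℝ) * τ ≤ 1 / 2 :=
        (mul_le_mul_of_nonneg_right (by exact_mod_cast hN) hτ.le).trans hNτ
      -- Since 0 ≤ nτ ≤ 1/2, t^(-nτ) is at most 1 for t ≥ 1 and at most t^(-1/2) for t ≤ 1.
      rcases le_total 1 t with h | h
      · refine (Real.rpow_le_one_of_one_le_of_nonpos h ?_).trans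
          (le_add_of_nonneg_right (by positivity))
        have : 0 ≤ (n : ℝ) * τ := by positivity
        linarith
      · refine (Real.rpow_le_rpow_of_exponent_ge ht h ?_).trans (le_add_of_nonneg_left zero_le_one)
        linarith
    rw [← ofReal_norm, ENNReal.ofReal_rpow_of_nonneg (norm_nonneg _) hτ.le]
    refine (ENNReal.ofReal_le_ofReal h2).trans ?_
    rw [ENNReal.ofReal_mul (by positivity), ENNReal.ofReal_add zero_le_one (by positivity),
      ENNReal.ofReal_one]
    gcongr
    exact Finset.single_le_sum (f := fun c => ENNReal.ofReal (|r - c| ^ (-(1 / 2) : ℝ)))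
      (fun _ _ => zero_le) hc
  have hmeas : ∀ c : ℝ, Measurable fun r : ℝ => ENNReal.ofReal (|r - c| ^ (-(1 / 2) : ℝ)) :=
    fun c => by fun_prop
  have hQa : ENNReal.ofReal (Q ^ τ) =
      ENNReal.ofReal ((N.factorial * b ^ N) ^ τ) * ENNReal.ofReal (a ^ (N * τ)) := by
    rw [← ENNReal.ofReal_mul (by positivity), hQ, Real.mul_rpow (by positivity) (by positivity),
      ← Real.rpow_natCast a N, ← Real.rpow_mul (by linarith)]
  calc _ ≤ ∫⁻ r in Set.Icc (-R) R, ENNReal.ofReal (Q ^ τ) *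
          (1 + ∑ c ∈ s, ENNReal.ofReal (|r - c| ^ (-(1 / 2) : ℝ))) := by
        refine lintegral_mono_ae ?_
        have hnull : ∀ᵐ r : ℝ ∂volume.restrict (Set.Icc (-R) R), r ∉ s :=
          ae_restrict_of_ae (s.finite_toSet.countable.ae_notMem volume)
        filter_upwards [hnull, ae_restrict_mem measurableSet_Icc] with r hr1 hr2
        exact hpt r hr2 hr1
    _ = ENNReal.ofReal (Q ^ τ) * (volume (Set.Icc (-R) R) +
          ∑ c ∈ s, ∫⁻ r in Set.Icc (-R) R, ENNReal.ofReal (|r - c| ^ (-(1 / 2) : ℝ))) := by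
        rw [lintegral_const_mul' _ _ ENNReal.ofReal_ne_top, lintegral_add_left measurable_const,
          lintegral_const, one_mul, Measure.restrict_apply_univ,
          lintegral_finsetSum _ fun c _ => hmeas c]
    _ ≤ ENNReal.ofReal (Q ^ τ) * (volume (Set.Icc (-R) R) + N * K) := by
        gcongr
        refine (Finset.sum_le_card_nsmul _ _ K fun c _ => hKle c).trans ?_
        rw [nsmul_eq_mul]
        gcongr
        exact hs.trans hN
    _ = _ := by rw [hQa]; ring

/-! ### Averaging over one coupling constant -/

theorem IsDissipative.add_real {α : Type} {c : ℝ} {w : α → ℂ} (hw : IsDissipative c w)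
    {U : α → ℝ} {B : ℝ} (hB : ∀ a, |U a| ≤ B) :
    IsDissipative c fun a => w a + U a := by
  obtain ⟨K, hK⟩ := hw.bdd
  refine ⟨hw.pos, ⟨K + B, fun a => ?_⟩, fun a => ?_⟩
  · refine (norm_add_le _ _).trans (add_le_add (hK a) ?_)
    rw [Complex.norm_real]
    exact hB a
  · simpa using hw.le_im a

theorem norm_schur_le {d : ℕ} {Γ' : Set (Lattice d)} {w : Lattice d → ℂ} {k y : Lattice d}
    {a T : ℝ} (ha : ‖w y‖ ≤ a) (hT0 : 0 ≤ T)
    (hT : ∀ e ∈ unitVectors d, ∀ e' ∈ unitVectors d, y + e ∈ Γ' →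
      ‖gr Γ' w (k + e') (y + e)‖ ≤ T) :
    ‖schur Γ' w k y‖ ≤ a + (unitVectors d).card + (unitVectors d).card ^ 2 * T := by
  classical
  have h1 : ‖if k = y then w y else 0‖ ≤ a := by
    split_ifs
    · exact ha
    · rw [norm_zero]; exact (norm_nonneg _).trans ha
  have h2 : ‖∑ e ∈ unitVectors d, if k = y + e then (1 : ℂ) else 0‖ ≤ (unitVectors d).card := by
    refine (norm_sum_le_of_le _ (n := fun _ => (1 : ℝ)) fun e _ => ?_).trans_eq (by simp)
    split_ifs <;> simp
  have h3 : ‖∑ e ∈ unitVectors d, if y + e ∈ Γ' then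
      ∑ e' ∈ unitVectors d, gr Γ' w (k + e') (y + e) else 0‖ ≤ (unitVectors d).card ^ 2 * T := by
    refine (norm_sum_le_of_le _ (n := fun _ => (unitVectors d).card * T) fun e he => ?_).trans_eq
      (by simp; ring)
    split_ifs with h
    · exact (norm_sum_le_of_le _ (n := fun _ => T) fun e' he' => hT e he e' he' h).trans_eq
        (by simp)
    · rw [norm_zero]; positivity
  rw [schur]
  refine (norm_sub_le _ _).trans (add_le_add ((norm_sub_le _ _).trans (add_le_add ?_ ?_)) ?_)
  · exact h1
  · exact h2
  · exact h3

/-- Averaging over a coupling constant which enters the potential exactly on `S = Γ \ Γ'`. -/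
theorem exists_lintegral_gr_le {d : ℕ} (N : ℕ) {m B R τ K : ℝ} (hm : 0 < m) (hB : 0 ≤ B)
    (hR : 0 ≤ R) (hτ : 0 < τ) (hNτ : N * τ ≤ 1 / 2) (hK : 0 ≤ K) :
    ∃ C : ℝ≥0∞, C ≠ ∞ ∧ ∀ (lam : ℝ), 1 ≤ lam → ∀ (Γ Γ' : Set (Lattice d)) (_ : Γ' ⊆ Γ)
      (S : Finset (Lattice d)) (_ : ∀ k, k ∈ S ↔ k ∈ Γ ∧ k ∉ Γ') (_ : S.card ≤ N)
      (c : ℝ) (w : Lattice d → ℂ) (_ : IsDissipative c w) (U : Lattice d → ℝ)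
      (_ : ∀ k ∈ Γ', U k = 0) (_ : ∀ k ∈ S, m ≤ |U k|) (_ : ∀ k, |U k| ≤ B)
      (_ : ∀ k ∈ S, ‖w k‖ ≤ lam * K) (T : ℝ) (_ : 0 ≤ T)
      (_ : ∀ k ∈ S, ∀ y ∈ S, ∀ e ∈ unitVectors d, ∀ e' ∈ unitVectors d, y + e ∈ Γ' →
        ‖gr Γ' w (k + e') (y + e)‖ ≤ T) (x y : Lattice d), x ∈ S → y ∈ S →
      ∫⁻ r in Set.Icc (-R) R, ‖gr Γ (fun k => w k + ((lam * r * U k : ℝ) : ℂ)) x y‖ₑ ^ τ ≤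
        C * ENNReal.ofReal (lam ^ (-τ)) * ENNReal.ofReal ((1 + T) ^ (N * τ)) := by
  classical
  obtain ⟨C, hC, hCle⟩ := exists_lintegral_inv_add_diagonal_le N hm hB hR hτ hNτ
  set b : ℝ := K + 1 + (unitVectors d).card + (unitVectors d).card ^ 2 with hb
  have hb1 : 1 ≤ b := by
    have : (0 : ℝ) ≤ K + (unitVectors d).card + (unitVectors d).card ^ 2 := by positivity
    linarith
  refine ⟨C * ENNReal.ofReal (b ^ (N * τ)), ENNReal.mul_ne_top hC ENNReal.ofReal_ne_top, ?_⟩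
  intro lam hlam Γ Γ' hΓ S hS hSN c w hw U hU0 hUm hUB hwK T hT0 hT x y hx hy
  have hlam0 : 0 < lam := one_pos.trans_le hlam
  -- Dividing the Schur matrix by λ makes its size independent of λ, up to the factor 1 + T, and
  -- puts λ^(-τ) in front of the moment of its inverse. As U vanishes on Γ', r enters only through
  -- the diagonal.
  set A : Matrix S S ℂ := Matrix.of fun k l => (lam : ℂ)⁻¹ * schur Γ' w k l with hA
  have hAle : ∀ i j, ‖A i j‖ ≤ b * (1 + T) := fun i j => by
    have h1 := norm_schur_le (k := (i : Lattice d)) (hwK j j.2) hT0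
      fun e he e' he' h => hT i i.2 j j.2 e he e' he' h
    rw [hA, Matrix.of_apply, norm_mul, norm_inv, Complex.norm_of_nonneg hlam0.le, inv_mul_eq_div,
      div_le_iff₀ hlam0]
    refine h1.trans ?_
    set u : ℝ := ((unitVectors d).card : ℝ)
    have hu : 0 ≤ u := by positivity
    have h2 : u + u ^ 2 * T ≤ lam * (u + u ^ 2 * T) :=
      le_mul_of_one_le_left (by positivity) hlam
    have h3 : lam * K + lam * (u + u ^ 2 * T) ≤ b * (1 + T) * lam := by
      have : 0 ≤ lam * (1 + T + K * T + u * T + u ^ 2) := by positivity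
      rw [hb]
      nlinarith
    linarith
  have hdiss : ∀ r : ℝ, IsDissipative c fun k => w k + ((lam * r * U k : ℝ) : ℂ) := fun r =>
    hw.add_real (B := |lam * r| * B) fun k => by
      rw [abs_mul]
      exact mul_le_mul_of_nonneg_left (hUB k) (abs_nonneg _)
  have hschur : ∀ (r : ℝ) (k l : S), schur Γ' (fun k => w k + ((lam * r * U k : ℝ) : ℂ)) k l =
      lam * (A + Matrix.diagonal fun i : S => ((r * U i : ℝ) : ℂ)) k l := fun r k l => by
    have hg : ∀ (k' l' : Lattice d), l' ∈ Γ' →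
        gr Γ' (fun k => w k + ((lam * r * U k : ℝ) : ℂ)) k' l' = gr Γ' w k' l' :=
      fun k' l' hl' => gr_congr (hdiss r) hw (fun x hx => by simp [hU0 x hx]) k' hl'
    have hlamC : (lam : ℂ) ≠ 0 := Complex.ofReal_ne_zero.2 hlam0.ne'
    have hdiag : (lam : ℂ) * (Matrix.diagonal fun i : S => ((r * U i : ℝ) : ℂ)) k l =
        if (k : Lattice d) = l then ((lam * r * U l : ℝ) : ℂ) else 0 := by
      by_cases hkl : k = l
      · subst hkl
        simp [mul_assoc]
      · rw [Matrix.diagonal_apply_ne _ hkl, mul_zero, if_neg (fun h => hkl (Subtype.ext h))]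
    rw [Matrix.add_apply, mul_add, hdiag, hA, Matrix.of_apply, ← mul_assoc,
      mul_inv_cancel₀ hlamC, one_mul, schur, schur]
    have h3 : (∑ e ∈ unitVectors d, if (l : Lattice d) + e ∈ Γ' then ∑ e' ∈ unitVectors d,
        gr Γ' (fun k => w k + ((lam * r * U k : ℝ) : ℂ)) (k + e') (l + e) else 0) =
        ∑ e ∈ unitVectors d, if (l : Lattice d) + e ∈ Γ' then ∑ e' ∈ unitVectors d,
          gr Γ' w (k + e') (l + e) else 0 := by
      refine Finset.sum_congr rfl fun e _ => ?_
      split_ifs with h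
      · exact Finset.sum_congr rfl fun e' _ => hg _ _ h
      · rfl
    rw [h3]
    split_ifs <;> ring
  have hinv : ∀ r : ℝ, gr Γ (fun k => w k + ((lam * r * U k : ℝ) : ℂ)) x y =
      (lam : ℂ)⁻¹ * (A + Matrix.diagonal fun i : S => ((r * U i : ℝ) : ℂ))⁻¹ ⟨x, hx⟩ ⟨y, hy⟩ := by
    intro r
    set M := A + Matrix.diagonal fun i : S => ((r * U i : ℝ) : ℂ) with hM
    set G : Matrix S S ℂ := Matrix.of fun k l =>
      (lam : ℂ) * gr Γ (fun k => w k + ((lam * r * U k : ℝ) : ℂ)) k l with hG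
    have hGM : G * M = 1 := by
      ext k l
      have h := gr_mul_schur hΓ hS (hdiss r) k.2 l.2
      rw [Matrix.mul_apply, Matrix.one_apply]
      rw [← Finset.sum_coe_sort] at h
      simp only [hschur r _ l, ← hM] at h
      simp only [hG, Matrix.of_apply, Subtype.ext_iff]
      rw [← h]
      exact Finset.sum_congr rfl fun i _ => by ring
    have hMG : M⁻¹ = G := Matrix.inv_eq_left_inv hGM
    rw [hMG, hG, Matrix.of_apply, ← mul_assoc,
      inv_mul_cancel₀ (Complex.ofReal_ne_zero.2 hlam0.ne'), one_mul]
  have hscale : ∀ r : ℝ, ‖gr Γ (fun k => w k + ((lam * r * U k : ℝ) : ℂ)) x y‖ₑ ^ τ =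
      ENNReal.ofReal (lam ^ (-τ)) *
        ‖(A + Matrix.diagonal fun i : S => ((r * U i : ℝ) : ℂ))⁻¹ ⟨x, hx⟩ ⟨y, hy⟩‖ₑ ^ τ := by
    intro r
    rw [hinv, enorm_mul, ENNReal.mul_rpow_of_nonneg _ _ hτ.le]
    congr 1
    rw [← ofReal_norm, norm_inv, Complex.norm_of_nonneg hlam0.le,
      ENNReal.ofReal_rpow_of_nonneg (by positivity) hτ.le, Real.inv_rpow hlam0.le,
      Real.rpow_neg hlam0.le]
  simp only [hscale]
  rw [lintegral_const_mul' _ _ ENNReal.ofReal_ne_top]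
  have hfin := hCle S (by simpa using hSN) A (fun i => U i) (b * (1 + T))
    (one_le_mul_of_one_le_of_one_le hb1 (by linarith)) hAle (fun i => hUm i i.2)
    (fun i => hUB i) ⟨x, hx⟩ ⟨y, hy⟩
  calc _ ≤ ENNReal.ofReal (lam ^ (-τ)) *
        (C * ENNReal.ofReal ((b * (1 + T)) ^ (N * τ))) := mul_le_mul_right hfin _
    _ = _ := by
      rw [Real.mul_rpow (by linarith) (by linarith), ENNReal.ofReal_mul (by positivity)]
      ring

/-! ### Resampling finitely many coordinates of the product law -/

theorem pi_mono_measure {ι : Type*} [Fintype ι] {μ ν : ι → Measure ℝ}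
    [∀ i, SigmaFinite (μ i)] (h : ∀ i, μ i ≤ ν i) : Measure.pi μ ≤ Measure.pi ν := by
  have h1 : (Measure.pi μ).toOuterMeasure ≤
      OuterMeasure.pi fun i => (ν i).toOuterMeasure := by
    rw [OuterMeasure.le_pi]
    intro s _
    change Measure.pi μ (Set.univ.pi s) ≤ _
    rw [Measure.pi_pi]
    exact Finset.prod_le_prod' fun i _ => h i (s i)
  refine Measure.le_iff.2 fun s hs => ?_
  have h2 : Measure.pi ν s = OuterMeasure.pi (fun i => (ν i).toOuterMeasure) s := by
    rw [Measure.pi_def, toMeasure_apply _ _ hs]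
  rw [h2]
  exact h1 s

/-- Replacing the coordinates in T by an independent copy preserves the law; this is checked on
finite cylinders and gives Fubini for a finite block inside the infinite product. -/
theorem law_eq_map_updateFinset {d : ℕ} (μ : Measure ℝ) [IsProbabilityMeasure μ]
    (T : Finset (Lattice d)) :
    ((law d μ).prod (Measure.pi fun _ : T => μ)).map
      (fun p => Function.updateFinset p.1 T p.2) = law d μ := by
  refine Measure.eq_infinitePi _ fun s t ht => ?_
  rw [Measure.map_apply measurable_updateFinset'
    (MeasurableSet.pi s.countable_toSet fun i _ => ht i)]
  have hpre : (fun p : (Lattice d → ℝ) × (T → ℝ) => Function.updateFinset p.1 T p.2) ⁻¹'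
      (Set.pi s t) = (Set.pi (s \ T : Finset (Lattice d)) t) ×ˢ
        (Set.univ.pi fun i : T => if (i : Lattice d) ∈ s then t i else Set.univ) := by
    ext ⟨ω, y⟩
    simp only [Set.mem_preimage, Set.mem_pi, Finset.mem_coe, Set.mem_prod, Finset.mem_sdiff,
      Set.mem_univ, true_implies, Function.updateFinset]
    constructor
    · intro h
      refine ⟨fun i hi => ?_, fun i => ?_⟩
      · have := h i hi.1
        rwa [dif_neg hi.2] at this
      · split_ifs with hi
        · have := h i hi
          rwa [dif_pos i.2] at this
        · trivial
    · rintro ⟨h1, h2⟩ i hi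
      split_ifs with hT
      · have := h2 ⟨i, hT⟩
        rwa [if_pos hi] at this
      · exact h1 i ⟨hi, hT⟩
  rw [hpre, Measure.prod_prod, Measure.pi_pi, law, Measure.infinitePi_pi _ fun i _ => ht i]
  have h1 : ∀ i : T, μ (if (i : Lattice d) ∈ s then t i else Set.univ) =
      if (i : Lattice d) ∈ s then μ (t i) else 1 := fun i => by
    split_ifs
    · rfl
    · exact measure_univ
  simp only [h1]
  rw [Finset.prod_coe_sort T (fun i => if i ∈ s then μ (t i) else 1), ← Finset.prod_filter,
    Finset.filter_mem_eq_inter, Finset.inter_comm, mul_comm, Finset.prod_inter_mul_prod_sdiff]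

theorem lintegral_law_eq {d : ℕ} (μ : Measure ℝ) [IsProbabilityMeasure μ]
    (T : Finset (Lattice d)) {f : (Lattice d → ℝ) → ℝ≥0∞} (hf : Measurable f) :
    ∫⁻ ω, f ω ∂law d μ =
      ∫⁻ ω, ∫⁻ y, f (Function.updateFinset ω T y) ∂(Measure.pi fun _ : T => μ) ∂law d μ := by
  have : IsProbabilityMeasure (law d μ) := by unfold law; infer_instance
  nth_rw 1 [← law_eq_map_updateFinset μ T]
  rw [lintegral_map hf measurable_updateFinset',
    lintegral_prod (fun p => f (Function.updateFinset p.1 T p.2))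
      (hf.comp measurable_updateFinset').aemeasurable]

/-- The distribution `μ` has a density which is bounded by `K` and supported in `[-R, R]`. -/
structure HasBoundedDensity (μ : Measure ℝ) (K : ℝ≥0∞) (R : ℝ) : Prop where
  ne_top : K ≠ ∞
  pos : 0 < R
  le : μ ≤ K • volume.restrict (Set.Icc (-R) R)

theorem lintegral_law_le_update {d : ℕ} {μ : Measure ℝ} [IsProbabilityMeasure μ] {K : ℝ≥0∞}
    {R : ℝ} (hμ : HasBoundedDensity μ K R) (b : Lattice d) {f : (Lattice d → ℝ) → ℝ≥0∞}
    (hf : Measurable f) :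
    ∫⁻ ω, f ω ∂law d μ ≤
      ∫⁻ ω, (K * ∫⁻ r in Set.Icc (-R) R, f (Function.update ω b r)) ∂law d μ := by
  rw [lintegral_law_eq μ {b} hf]
  refine lintegral_mono fun ω => ?_
  have h := congrFun (lmarginal_singleton (μ := fun _ : Lattice d => μ) f b) ω
  simp only [lmarginal] at h
  rw [h]
  refine (lintegral_mono' hμ.le le_rfl).trans_eq ?_
  rw [lintegral_smul_measure, smul_eq_mul]

/-- If r + t lies in [-R,R] and |t| ≤ R, then |r| ≤ 2R. All these translates of μ are therefore
controlled by one t-independent measure on [-2R,2R]. -/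
theorem HasBoundedDensity.le_map_add {μ : Measure ℝ} {K : ℝ≥0∞} {R : ℝ}
    (hμ : HasBoundedDensity μ K R) {t : ℝ} (ht : t ∈ Set.Icc (-R) R) :
    μ ≤ (K • volume.restrict (Set.Icc (-(2 * R)) (2 * R))).map (fun r => r + t) := by
  refine hμ.le.trans ?_
  rw [Measure.map_smul]
  gcongr
  refine Measure.le_iff.2 fun s hs => ?_
  rw [Measure.map_apply (measurable_add_const t) hs, Measure.restrict_apply hs,
    Measure.restrict_apply (measurable_add_const t hs)]
  rw [← measure_preimage_add_right volume t (s ∩ Set.Icc (-R) R)]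
  refine measure_mono fun r hr => ⟨hr.1, ?_⟩
  have h2 := hr.2
  simp only [Set.mem_Icc] at h2 ht ⊢
  constructor <;> linarith

/-- For each shift t the integral is bounded by the shifted integral against a fixed finite measure.
Averaging over t in [-R,R] and exchanging integrals leaves the shift average, bounded by C, times
the total mass. -/
theorem lintegral_pi_le_of_shift {ι : Type*} [Fintype ι] {μ : Measure ℝ} [IsProbabilityMeasure μ]
    {K : ℝ≥0∞} {R : ℝ} (hμ : HasBoundedDensity μ K R) {h : (ι → ℝ) → ℝ≥0∞} (hh : Measurable h)
    {C : ℝ≥0∞} (hC : ∀ y : ι → ℝ, (∀ i, y i ∈ Set.Icc (-(2 * R)) (2 * R)) →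
      ∫⁻ t in Set.Icc (-R) R, h (fun i => y i + t) ≤ C) :
    ∫⁻ y, h y ∂(Measure.pi fun _ : ι => μ) ≤
      (ENNReal.ofReal (2 * R))⁻¹ * ((K * ENNReal.ofReal (4 * R)) ^ Fintype.card ι * C) := by
  set κ : Measure ℝ := K • volume.restrict (Set.Icc (-(2 * R)) (2 * R)) with hκ
  have hR := hμ.pos
  have hκu : κ Set.univ = K * ENNReal.ofReal (4 * R) := by
    rw [hκ, Measure.smul_apply, Measure.restrict_apply_univ, Real.volume_Icc, smul_eq_mul]
    congr 2
    ring
  have : IsFiniteMeasure κ :=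
    ⟨by rw [hκu]; exact ENNReal.mul_lt_top hμ.ne_top.lt_top ENNReal.ofReal_lt_top⟩
  have hshift : ∀ t ∈ Set.Icc (-R) R, ∫⁻ y, h y ∂(Measure.pi fun _ : ι => μ) ≤
      ∫⁻ y, h (fun i => y i + t) ∂(Measure.pi fun _ : ι => κ) := fun t ht => by
    refine (lintegral_mono' (pi_mono_measure fun _ => hμ.le_map_add ht) le_rfl).trans_eq ?_
    rw [← Measure.pi_map_pi (μ := fun _ : ι => κ) (f := fun _ r => r + t)
        fun _ => (measurable_add_const t).aemeasurable,
      lintegral_map hh (measurable_pi_lambda _ fun i => (measurable_pi_apply i).add_const t)]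
  have hv : volume (Set.Icc (-R) R) = ENNReal.ofReal (2 * R) := by
    rw [Real.volume_Icc]; congr 1; ring
  have havg : ENNReal.ofReal (2 * R) * ∫⁻ y, h y ∂(Measure.pi fun _ : ι => μ) ≤
      (K * ENNReal.ofReal (4 * R)) ^ Fintype.card ι * C := by
    calc ENNReal.ofReal (2 * R) * ∫⁻ y, h y ∂(Measure.pi fun _ : ι => μ)
        = ∫⁻ _ in Set.Icc (-R) R, ∫⁻ y, h y ∂(Measure.pi fun _ : ι => μ) := by
          rw [lintegral_const, Measure.restrict_apply_univ, hv, mul_comm]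
      _ ≤ ∫⁻ t in Set.Icc (-R) R, ∫⁻ y, h (fun i => y i + t) ∂(Measure.pi fun _ : ι => κ) :=
          setLIntegral_mono' measurableSet_Icc hshift
      _ = ∫⁻ y, (∫⁻ t in Set.Icc (-R) R, h (fun i => y i + t)) ∂(Measure.pi fun _ : ι => κ) := by
          refine lintegral_lintegral_swap (Measurable.aemeasurable ?_)
          refine hh.comp (measurable_pi_lambda _ fun i => ?_)
          exact ((measurable_pi_apply i).comp measurable_snd).add measurable_fst
      _ ≤ ∫⁻ _, C ∂(Measure.pi fun _ : ι => κ) := by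
          refine lintegral_mono_ae ?_
          have hae : ∀ᵐ y ∂(Measure.pi fun _ : ι => κ),
              ∀ i, y i ∈ Set.Icc (-(2 * R)) (2 * R) := by
            rw [ae_all_iff]
            intro i
            have h0 : ∀ᵐ r ∂κ, r ∈ Set.Icc (-(2 * R)) (2 * R) :=
              Measure.ae_smul_measure (ae_restrict_mem measurableSet_Icc) K
            exact (Measure.tendsto_eval_ae_ae (μ := fun _ : ι => κ) (i := i)).eventually h0
          filter_upwards [hae] with y hy
          exact hC y hy
      _ = _ := by
          rw [lintegral_const, Measure.pi_univ, Finset.prod_const, hκu, Finset.card_univ, mul_comm]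
  have h0 : ENNReal.ofReal (2 * R) ≠ 0 := by
    rw [Ne, ENNReal.ofReal_eq_zero, not_le]; linarith
  rw [← ENNReal.div_eq_inv_mul, ENNReal.le_div_iff_mul_le (Or.inl h0)
    (Or.inl ENNReal.ofReal_ne_top), mul_comm]
  exact havg

/-- Averaging of `h` over a common shift of the variables in `T`, decoupled from a factor `g` which
does not depend on these variables. -/
theorem lintegral_law_mul_le_of_shift {d : ℕ} {μ : Measure ℝ} [IsProbabilityMeasure μ] {K : ℝ≥0∞}
    {R : ℝ} (hμ : HasBoundedDensity μ K R) (T : Finset (Lattice d))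
    {h g : (Lattice d → ℝ) → ℝ≥0∞} (hh : Measurable h) (hg : Measurable g)
    (hgT : ∀ ω ω', (∀ i ∉ T, ω i = ω' i) → g ω = g ω') {C : ℝ≥0∞}
    (hC : ∀ ω : Lattice d → ℝ, (∀ i ∈ T, ω i ∈ Set.Icc (-(2 * R)) (2 * R)) →
      ∫⁻ t in Set.Icc (-R) R, h (fun i => ω i + if i ∈ T then t else 0) ≤ C) :
    ∫⁻ ω, h ω * g ω ∂law d μ ≤
      ((ENNReal.ofReal (2 * R))⁻¹ * ((K * ENNReal.ofReal (4 * R)) ^ T.card * C)) *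
        ∫⁻ ω, g ω ∂law d μ := by
  rw [lintegral_law_eq μ T (f := fun ω => h ω * g ω) (hh.mul hg), ← lintegral_const_mul _ hg]
  refine lintegral_mono fun ω => ?_
  have h1 : ∀ y : T → ℝ, g (Function.updateFinset ω T y) = g ω := fun y =>
    hgT _ _ fun i hi => by simp [Function.updateFinset, hi]
  simp only [h1]
  rw [lintegral_mul_const (g ω) (f := fun y => h (Function.updateFinset ω T y))
    (hh.comp measurable_updateFinset)]
  gcongr
  refine (lintegral_pi_le_of_shift hμ (hh.comp measurable_updateFinset) (C := C)
    fun y hy => ?_).trans_eq (by rw [Fintype.card_coe])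
  have h2 := hC (Function.updateFinset ω T y) fun i hi => by
    simpa [Function.updateFinset, hi] using hy ⟨i, hi⟩
  refine le_trans (le_of_eq ?_) h2
  refine lintegral_congr fun t => ?_
  refine congrArg h (funext fun i => ?_)
  by_cases hi : i ∈ T <;> simp [Function.updateFinset, hi]

/-! ### Green functions of the model as Green functions on the full lattice -/

theorem potential_eq_sum {d : ℕ} {u : Lattice d → ℝ} (hu : (Function.support u).Finite)
    (ω : Lattice d → ℝ) (x : Lattice d) :
    potential u ω x = ∑ θ ∈ hu.toFinset, ω (x - θ) * u θ := by
  rw [potential, ← (Equiv.subLeft x).tsum_eq]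
  simp only [Equiv.subLeft_apply, sub_sub_cancel]
  refine tsum_eq_sum fun θ hθ => ?_
  have : u θ = 0 := by simpa using hθ
  rw [this, mul_zero]

theorem mulOp_eq_mulC {α : Type} {v : α → ℝ} {K : ℝ} (hK : ∀ a, |v a| ≤ K) :
    mulOp v = mulC fun a => (v a : ℂ) := by
  ext ψ a
  rw [mulOp_apply hK, mulC_apply ⟨K, fun a => by simpa using hK a⟩]

theorem isSelfAdjoint_hamiltonianOn {d : ℕ} {u : Lattice d → ℝ} {lam K : ℝ} {ω : Lattice d → ℝ}
    (hK : ∀ x, |potential u ω x| ≤ K) (Γ : Set (Lattice d)) :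
    IsSelfAdjoint (hamiltonianOn u lam ω Γ) := by
  have h1 : IsSelfAdjoint (mulOp (potential u ω)) := by
    rw [mulOp_eq_mulC hK]
    exact isSelfAdjoint_mulC_ofReal ⟨K, fun a => by simpa using hK a⟩
  have h2 : IsSelfAdjoint (hamiltonian u lam ω) := by
    refine (isSelfAdjoint_laplacian d).neg.add (IsSelfAdjoint.smul ?_ h1)
    exact Complex.conj_ofReal lam
  exact h2.conj_adjoint (proj Γ)

theorem isUnit_sub_smul_id {H : Type*} [NormedAddCommGroup H] [InnerProductSpace ℂ H]
    [CompleteSpace H] {T : H →L[ℂ] H} (hT : IsSelfAdjoint T) {z : ℂ} (hz : z.im ≠ 0) :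
    IsUnit (T - z • ContinuousLinearMap.id ℂ H) := by
  refine ContinuousLinearMap.isUnit_of_forall_le_norm_inner_map _ (c := ⟨|z.im|, abs_nonneg _⟩)
    (abs_pos.2 hz) fun ψ => ?_
  have h0 : (inner ℂ ψ (T ψ)).im = 0 := hT.isSymmetric.im_inner_self_apply ψ
  have h2 : inner ℂ ψ ψ = ((‖ψ‖ ^ 2 : ℝ) : ℂ) := by
    rw [inner_self_eq_norm_sq_to_K]
    norm_cast
  have h1 : (inner ℂ ψ ((T - z • ContinuousLinearMap.id ℂ H) ψ)).im = -(z.im * ‖ψ‖ ^ 2) := by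
    rw [sub_apply, smul_apply, ContinuousLinearMap.id_apply, inner_sub_right, inner_smul_right,
      Complex.sub_im, h0, h2, zero_sub, Complex.im_mul_ofReal]
  rw [norm_inner_symm]
  refine le_trans (le_of_eq ?_) (Complex.abs_im_le_norm _)
  rw [h1, abs_neg, abs_mul, abs_of_nonneg (sq_nonneg ‖ψ‖), mul_comm]
  rfl

theorem adjoint_proj_apply_mem {d : ℕ} {Γ : Set (Lattice d)} (φ : ℓ²(Γ, ℂ)) (x : Γ) :
    ContinuousLinearMap.adjoint (proj Γ) φ x = φ x := by
  classical
  have h := ContinuousLinearMap.adjoint_inner_right (proj Γ)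
    (lp.single 2 (x : Lattice d) (1 : ℂ)) φ
  have h1 : proj Γ (lp.single 2 (x : Lattice d) (1 : ℂ)) = lp.single 2 x (1 : ℂ) := by
    ext a
    rw [proj, compOp_apply, lp.single_apply, lp.single_apply, Pi.single_apply, Pi.single_apply]
    simp only [Subtype.ext_iff]
  rw [h1, lp.inner_single_left, lp.inner_single_left] at h
  simpa using h

theorem adjoint_proj_apply_notMem {d : ℕ} {Γ : Set (Lattice d)} (φ : ℓ²(Γ, ℂ)) {x : Lattice d}
    (hx : x ∉ Γ) : ContinuousLinearMap.adjoint (proj Γ) φ x = 0 := by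
  classical
  have h := ContinuousLinearMap.adjoint_inner_right (proj Γ) (lp.single 2 x (1 : ℂ)) φ
  have h1 : proj Γ (lp.single 2 x (1 : ℂ)) = 0 := by
    ext a
    rw [proj, compOp_apply, lp.single_apply, Pi.single_apply,
      if_neg (fun h : (a : Lattice d) = x => hx (h ▸ a.2))]
    rfl
  rw [h1, lp.inner_single_left, inner_zero_left] at h
  simpa using h

/-- The column of the full-lattice resolvent is supported in Γ; its restriction solves the equation
defining the column of the resolvent on ℓ²(Γ), which is unique since z is not real. -/
theorem green_eq_gr {d : ℕ} {u : Lattice d → ℝ} {lam K : ℝ} {ω : Lattice d → ℝ}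
    (hK : ∀ x, |potential u ω x| ≤ K) {Γ : Set (Lattice d)} {z : ℂ} {c : ℝ}
    (hz : z.im ≠ 0) {w : Lattice d → ℂ} (hw : IsDissipative c w)
    (hwv : ∀ x, w x = (lam * potential u ω x : ℝ) - z) (x y : Γ) :
    green u lam ω Γ z x y = gr Γ w x y := by
  classical
  set A := hamiltonianOn u lam ω Γ - z • ContinuousLinearMap.id ℂ ℓ²(Γ, ℂ) with hA
  have hu : IsUnit A := isUnit_sub_smul_id (isSelfAdjoint_hamiltonianOn hK Γ) hz
  set ψ := res Γ w (lp.single 2 (y : Lattice d) (1 : ℂ)) with hψ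
  have hP : ContinuousLinearMap.adjoint (proj Γ) (proj Γ ψ) = ψ := by
    ext k
    by_cases hk : k ∈ Γ
    · exact adjoint_proj_apply_mem (proj Γ ψ) ⟨k, hk⟩
    · rw [adjoint_proj_apply_notMem _ hk]
      exact (gr_eq_zero hw hk y.2).symm
  have key : A (proj Γ ψ) = lp.single 2 y (1 : ℂ) := by
    ext a
    have h1 := congrArg (fun φ : ℓ²(Lattice d, ℂ) => φ a)
      (op_res Γ hw (lp.single 2 (y : Lattice d) (1 : ℂ)))
    simp only [op_apply Γ hw, if_pos a.2, ← hψ] at h1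
    have h2 : ∀ e, (if (a : Lattice d) + e ∈ Γ then ψ ((a : Lattice d) + e) else 0) =
        ψ ((a : Lattice d) + e) := fun e => by
      split_ifs with h
      · rfl
      · exact (gr_eq_zero hw h y.2).symm
    simp only [h2] at h1
    have h3 : A (proj Γ ψ) a = -(∑ e ∈ unitVectors d, ψ ((a : Lattice d) + e)) + w a * ψ a := by
      rw [hA, sub_apply, smul_apply, ContinuousLinearMap.id_apply, hamiltonianOn,
        ContinuousLinearMap.comp_apply, ContinuousLinearMap.comp_apply, hP, lp.coeFn_sub,
        lp.coeFn_smul, Pi.sub_apply, Pi.smul_apply, proj, compOp_apply, compOp_apply, hamiltonian,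
        add_apply, neg_apply, smul_apply, lp.coeFn_add, lp.coeFn_neg, lp.coeFn_smul, Pi.add_apply,
        Pi.neg_apply, Pi.smul_apply, laplacian_apply, mulOp_apply hK, hwv]
      push_cast
      simp only [smul_eq_mul]
      ring
    rw [h3, h1, lp.single_apply, lp.single_apply, Pi.single_apply, Pi.single_apply]
    simp only [Subtype.ext_iff]
  have hinv : Ring.inverse A (lp.single 2 y (1 : ℂ)) = proj Γ ψ := by
    rw [← key]
    exact congrArg (fun T : ℓ²(Γ, ℂ) →L[ℂ] ℓ²(Γ, ℂ) => T (proj Γ ψ))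
      (Ring.inverse_mul_cancel A hu)
  have hgr : gr Γ w x y = proj Γ ψ x := rfl
  rw [hgr, ← hinv, green, lp.inner_single_left]
  simp only [RCLike.inner_apply, map_one, mul_one]
  congr!

/-- Self-adjointness exchanges z with its conjugate and x with y, so it suffices to treat Im z < 0,
where λV - z is dissipative. -/
theorem norm_green_conj {d : ℕ} {u : Lattice d → ℝ} {lam K : ℝ} {ω : Lattice d → ℝ}
    (hK : ∀ x, |potential u ω x| ≤ K) {Γ : Set (Lattice d)} {z : ℂ} (x y : Γ) :
    ‖green u lam ω Γ z x y‖ = ‖green u lam ω Γ (starRingEnd ℂ z) y x‖ := by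
  have hsa := isSelfAdjoint_hamiltonianOn (lam := lam) hK Γ
  have h1 : hamiltonianOn u lam ω Γ - starRingEnd ℂ z • ContinuousLinearMap.id ℂ ℓ²(Γ, ℂ) =
      star (hamiltonianOn u lam ω Γ - z • ContinuousLinearMap.id ℂ ℓ²(Γ, ℂ)) := by
    rw [star_sub, star_smul, hsa.star_eq]
    congr 2
    exact (star_one (ℓ²(Γ, ℂ) →L[ℂ] ℓ²(Γ, ℂ))).symm
  rw [green, green, h1, Ring.inverse_star, ContinuousLinearMap.star_eq_adjoint,
    ContinuousLinearMap.adjoint_inner_right, norm_inner_symm]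

theorem norm_le_one_of_mem_unitVectors {d : ℕ} {e : Lattice d} (he : e ∈ unitVectors d) :
    ‖e‖ ≤ 1 := by
  rw [mem_unitVectors] at he
  rw [pi_norm_le_iff_of_nonneg zero_le_one]
  intro i
  have h : |e i| ≤ 1 := by
    rw [← he]
    exact Finset.single_le_sum (f := fun j => |e j|) (fun j _ => abs_nonneg _) (Finset.mem_univ i)
  rw [Int.norm_eq_abs]
  exact_mod_cast h

/-! ### Cells, shells and the sign condition -/

/-- A single-site potential with finite support which is positive at all points of its support
having a neighbour outside, together with a bound `R` for the coupling constants. -/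
structure AlloyData (d : ℕ) where
  u : Lattice d → ℝ
  fin : (Function.support u).Finite
  zero : u 0 ≠ 0
  pos : ∀ k e, u k ≠ 0 → e ∈ unitVectors d → u (k + e) = 0 → 0 < u k
  R : ℝ
  R_pos : 0 < R

namespace AlloyData

variable {d : ℕ} (a : AlloyData d)

/-- The number of sites in the support of the single-site potential. -/
def N : ℕ := a.fin.toFinset.card

/-- The support of the single-site potential centred at `b`. -/
def cell (b : Lattice d) : Finset (Lattice d) := a.fin.toFinset.image fun θ => b + θ

/-- The sites outside the cell at `b` which belong to a cell at a neighbour of `b`. -/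
def shell (b : Lattice d) : Finset (Lattice d) :=
  ((unitVectors d).biUnion fun e => a.cell (b + e)) \ a.cell b

theorem mem_cell {b k : Lattice d} : k ∈ a.cell b ↔ a.u (k - b) ≠ 0 := by
  rw [cell, Finset.mem_image]
  constructor
  · rintro ⟨θ, hθ, rfl⟩
    simpa using hθ
  · exact fun h => ⟨k - b, by simpa using h, add_sub_cancel b k⟩

theorem mem_shell {b k : Lattice d} :
    k ∈ a.shell b ↔ (∃ e ∈ unitVectors d, a.u (k - (b + e)) ≠ 0) ∧ a.u (k - b) = 0 := by
  simp only [shell, Finset.mem_sdiff, Finset.mem_biUnion, mem_cell, not_not]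

theorem self_mem_cell (b : Lattice d) : b ∈ a.cell b := by
  rw [mem_cell, sub_self]
  exact a.zero

theorem card_cell_le (b : Lattice d) : (a.cell b).card ≤ a.N := Finset.card_image_le

theorem card_shell_le (b : Lattice d) : (a.shell b).card ≤ (unitVectors d).card * a.N :=
  (Finset.card_le_card Finset.sdiff_subset).trans
    (Finset.card_biUnion_le_card_mul _ _ _ fun e _ => a.card_cell_le (b + e))

theorem add_mem_shell {b k e : Lattice d} (hk : k ∈ a.cell b) (he : e ∈ unitVectors d)
    (h : k + e ∉ a.cell b) : k + e ∈ a.shell b := by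
  rw [mem_cell] at hk
  rw [mem_cell, not_not] at h
  exact a.mem_shell.2 ⟨⟨e, he, by rwa [add_sub_add_right_eq_sub]⟩, h⟩

/-- This is where positivity on the boundary enters: if k - b - e lies in the support but k - b does
not, then k - b - e has a neighbour outside the support, hence u is positive there. -/
theorem u_nonneg {b k e : Lattice d} (hk : k ∉ a.cell b) (he : e ∈ unitVectors d) :
    0 ≤ a.u (k - (b + e)) := by
  rw [mem_cell, not_not] at hk
  rcases eq_or_ne (a.u (k - (b + e))) 0 with h | h
  · exact h.ge
  · refine (a.pos _ e h he ?_).le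
    rwa [show k - (b + e) + e = k - b by abel]

/-- A bound for the single-site potential. -/
def B : ℝ := ∑ θ ∈ a.fin.toFinset, |a.u θ|

theorem B_nonneg : 0 ≤ a.B := Finset.sum_nonneg fun _ _ => abs_nonneg _

theorem abs_u_le (k : Lattice d) : |a.u k| ≤ a.B := by
  rcases eq_or_ne (a.u k) 0 with h | h
  · rw [h, abs_zero]
    exact a.B_nonneg
  · exact Finset.single_le_sum (f := fun θ => |a.u θ|) (fun _ _ => abs_nonneg _)
      (by simpa using h)

theorem exists_le_abs_u : ∃ m : ℝ, 0 < m ∧ ∀ k, a.u k ≠ 0 → m ≤ |a.u k| := by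
  obtain ⟨θ, hθ, hmin⟩ := Finset.exists_min_image a.fin.toFinset (fun θ => |a.u θ|)
    ⟨0, by simpa using a.zero⟩
  exact ⟨|a.u θ|, abs_pos.2 (by simpa using hθ), fun k hk => hmin k (by simpa using hk)⟩

/-- The potential produced by unit coupling constants at all neighbours of `b`. -/
def ringPotential (b k : Lattice d) : ℝ := ∑ e ∈ unitVectors d, a.u (k - (b + e))

theorem ringPotential_nonneg {b k : Lattice d} (hk : k ∉ a.cell b) : 0 ≤ a.ringPotential b k :=
  Finset.sum_nonneg fun _ he => a.u_nonneg hk he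

theorem ringPotential_le (b k : Lattice d) : a.ringPotential b k ≤ (unitVectors d).card * a.B := by
  refine (Finset.sum_le_card_nsmul _ _ a.B fun e _ => ?_).trans_eq (nsmul_eq_mul _ _)
  exact (le_abs_self _).trans (a.abs_u_le _)

theorem le_ringPotential {m : ℝ} (hm : ∀ k, a.u k ≠ 0 → m ≤ |a.u k|) {b k : Lattice d}
    (hk : k ∈ a.shell b) : m ≤ a.ringPotential b k := by
  have hk' : k ∉ a.cell b := (Finset.mem_sdiff.1 hk).2
  obtain ⟨⟨e, he, hne⟩, -⟩ := a.mem_shell.1 hk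
  have h1 := a.u_nonneg hk' he
  refine (hm _ hne).trans ?_
  rw [abs_of_nonneg h1]
  exact Finset.single_le_sum (f := fun e => a.u (k - (b + e))) (fun e he => a.u_nonneg hk' he) he

theorem exists_norm_le_of_mem : ∃ L : ℝ, 0 ≤ L ∧
    (∀ b, ∀ k ∈ a.cell b, ‖b - k‖ ≤ L) ∧ ∀ b, ∀ k ∈ a.shell b, ‖b - k‖ ≤ L := by
  set L : ℝ := ∑ θ ∈ a.fin.toFinset, ‖θ‖ with hL
  have hL0 : 0 ≤ L := Finset.sum_nonneg fun _ _ => norm_nonneg _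
  have hcell : ∀ b, ∀ k ∈ a.cell b, ‖b - k‖ ≤ L := fun b k hk => by
    rw [norm_sub_rev]
    exact Finset.single_le_sum (f := fun θ : Lattice d => ‖θ‖) (fun _ _ => norm_nonneg _)
      (by simpa using a.mem_cell.1 hk)
  refine ⟨L + 1, by linarith, fun b k hk => (hcell b k hk).trans (by linarith), fun b k hk => ?_⟩
  obtain ⟨⟨e, he, hne⟩, -⟩ := a.mem_shell.1 hk
  have h1 := hcell (b + e) k (a.mem_cell.2 hne)
  calc ‖b - k‖ = ‖(b + e - k) - e‖ := by congr 1; abel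
    _ ≤ ‖b + e - k‖ + ‖e‖ := norm_sub_le _ _
    _ ≤ L + 1 := add_le_add h1 (norm_le_one_of_mem_unitVectors he)

/-! ### Truncated couplings and dependence of the potential on them -/

/-- Truncation of the coupling constants to `[-3R, 3R]`. -/
def clamp (t : ℝ) : ℝ := max (-(3 * a.R)) (min (3 * a.R) t)

theorem abs_clamp_le (t : ℝ) : |a.clamp t| ≤ 3 * a.R := by
  have := a.R_pos
  exact abs_le.2 ⟨le_max_left _ _, max_le (by linarith) (min_le_left _ _)⟩

theorem clamp_eq {t : ℝ} (ht : |t| ≤ 3 * a.R) : a.clamp t = t := by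
  rw [clamp, min_eq_right (abs_le.1 ht).2, max_eq_right (abs_le.1 ht).1]

theorem continuous_clamp : Continuous a.clamp :=
  continuous_const.max (continuous_const.min continuous_id)

/-- The alloy-type potential with truncated coupling constants. -/
def pot (ω : Lattice d → ℝ) (x : Lattice d) : ℝ := potential a.u (fun k => a.clamp (ω k)) x

theorem pot_eq (ω : Lattice d → ℝ) (x : Lattice d) :
    a.pot ω x = ∑ θ ∈ a.fin.toFinset, a.clamp (ω (x - θ)) * a.u θ :=
  potential_eq_sum a.fin _ x

theorem abs_pot_le (ω : Lattice d → ℝ) (x : Lattice d) : |a.pot ω x| ≤ 3 * a.R * a.B := by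
  rw [pot_eq, B, Finset.mul_sum]
  refine (Finset.abs_sum_le_sum_abs _ _).trans (Finset.sum_le_sum fun θ _ => ?_)
  rw [abs_mul]
  exact mul_le_mul_of_nonneg_right (a.abs_clamp_le _) (abs_nonneg _)

theorem continuous_pot (x : Lattice d) : Continuous fun ω => a.pot ω x := by
  simp only [pot_eq]
  exact continuous_finsetSum _ fun θ _ =>
    (a.continuous_clamp.comp (continuous_apply _)).mul continuous_const

theorem pot_congr {ω ω' : Lattice d → ℝ} {x : Lattice d}
    (h : ∀ k, a.u (x - k) ≠ 0 → ω k = ω' k) : a.pot ω x = a.pot ω' x := by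
  rw [pot_eq, pot_eq]
  refine Finset.sum_congr rfl fun θ hθ => ?_
  rw [h (x - θ) (by simpa using hθ)]

theorem pot_update {ω : Lattice d → ℝ} {b : Lattice d} {r : ℝ} (hr : r ∈ Set.Icc (-a.R) a.R)
    (x : Lattice d) :
    a.pot (Function.update ω b r) x = a.pot (Function.update ω b 0) x + r * a.u (x - b) := by
  have hR := a.R_pos
  have h0 : a.clamp 0 = 0 := a.clamp_eq (by rw [abs_zero]; linarith)
  have hr' : a.clamp r = r := a.clamp_eq ((abs_le.2 hr).trans (by linarith))
  have h1 : ∀ θ, a.clamp (Function.update ω b r (x - θ)) =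
      a.clamp (Function.update ω b 0 (x - θ)) + if θ = x - b then r else 0 := fun θ => by
    by_cases h : θ = x - b
    · subst h
      simp [h0, hr']
    · rw [if_neg h, add_zero, Function.update_of_ne (fun h' => h (by rw [← h']; abel)),
        Function.update_of_ne (fun h' => h (by rw [← h']; abel))]
  simp only [pot_eq, h1, add_mul, Finset.sum_add_distrib, ite_mul, zero_mul, Finset.sum_ite_eq']
  congr 1
  split_ifs with h
  · rfl
  · rw [show a.u (x - b) = 0 by simpa using h, mul_zero]

/-- The neighbours of a site. -/
def nbrs (b : Lattice d) : Finset (Lattice d) := (unitVectors d).image fun e => b + e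

theorem card_nbrs (b : Lattice d) : (nbrs b).card = (unitVectors d).card :=
  Finset.card_image_of_injective _ (add_right_injective b)

/-- Resampled couplings in [-2R,2R], shifted by |t| ≤ R, stay in [-3R,3R], where the truncation is
the identity. This fixes the level 3R. -/
theorem pot_shift {ω : Lattice d → ℝ} {b : Lattice d} {t : ℝ} (ht : t ∈ Set.Icc (-a.R) a.R)
    (hω : ∀ i ∈ nbrs b, ω i ∈ Set.Icc (-(2 * a.R)) (2 * a.R)) (x : Lattice d) :
    a.pot (fun i => ω i + if i ∈ nbrs b then t else 0) x =
      a.pot ω x + t * a.ringPotential b x := by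
  have hR := a.R_pos
  have h1 : ∀ i, a.clamp (ω i + if i ∈ nbrs b then t else 0) =
      a.clamp (ω i) + if i ∈ nbrs b then t else 0 := fun i => by
    by_cases hi : i ∈ nbrs b
    · have h2 := abs_le.2 (hω i hi)
      have h3 := abs_le.2 ht
      rw [if_pos hi, a.clamp_eq (h2.trans (by linarith)),
        a.clamp_eq ((abs_add_le _ _).trans (by linarith))]
    · rw [if_neg hi, add_zero, add_zero]
  have h2 : a.ringPotential b x =
      ∑ θ ∈ a.fin.toFinset, (if x - θ ∈ nbrs b then 1 else 0) * a.u θ := by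
    have h3 : ∀ θ, (if x - θ ∈ nbrs b then (1 : ℝ) else 0) =
        ∑ e ∈ unitVectors d, if x - (b + e) = θ then 1 else 0 := fun θ => by
      rw [← Finset.sum_image (s := unitVectors d) (g := fun e => b + e)
        (f := fun i => if x - i = θ then (1 : ℝ) else 0) (fun _ _ _ _ h => add_left_cancel h)]
      have h4 : ∀ i, (x - i = θ) ↔ (i = x - θ) := fun i =>
        ⟨fun h => by rw [← h]; abel, fun h => by rw [h]; abel⟩
      simp only [h4, Finset.sum_ite_eq', nbrs]
      congr
    simp only [h3, Finset.sum_mul]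
    rw [Finset.sum_comm, ringPotential]
    refine Finset.sum_congr rfl fun e _ => ?_
    simp only [ite_mul, one_mul, zero_mul, Finset.sum_ite_eq]
    split_ifs with h
    · rfl
    · simpa using h
  simp only [pot_eq, h1, h2, add_mul, Finset.sum_add_distrib, Finset.mul_sum]
  congr 1
  refine Finset.sum_congr rfl fun θ _ => ?_
  split_ifs <;> ring

/-- The complex potential `lam V_ω - z`. -/
def cpot (lam : ℝ) (z : ℂ) (ω : Lattice d → ℝ) (x : Lattice d) : ℂ := (lam * a.pot ω x : ℝ) - z

theorem norm_cpot_le {lam : ℝ} (hlam : 0 ≤ lam) (z : ℂ) (ω : Lattice d → ℝ) (x : Lattice d) :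
    ‖a.cpot lam z ω x‖ ≤ lam * (3 * a.R * a.B) + ‖z‖ := by
  refine (norm_sub_le _ _).trans (add_le_add ?_ le_rfl)
  rw [Complex.norm_real, Real.norm_eq_abs, abs_mul, abs_of_nonneg hlam]
  exact mul_le_mul_of_nonneg_left (a.abs_pot_le ω x) hlam

theorem isDissipative_cpot {lam : ℝ} (hlam : 0 ≤ lam) {z : ℂ} (hz : z.im < 0)
    (ω : Lattice d → ℝ) : IsDissipative (-z.im) (a.cpot lam z ω) where
  pos := by linarith
  bdd := ⟨_, a.norm_cpot_le hlam z ω⟩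
  le_im x := by simp [cpot]

theorem continuous_gr_cpot {lam : ℝ} (hlam : 0 ≤ lam) {z : ℂ} (hz : z.im < 0)
    (Γ : Set (Lattice d)) (x y : Lattice d) :
    Continuous fun ω => gr Γ (a.cpot lam z ω) x y :=
  continuous_gr Γ (a.isDissipative_cpot hlam hz) (a.norm_cpot_le hlam z)
    (fun x => (Complex.continuous_ofReal.comp (continuous_const.mul (a.continuous_pot x))).sub
      continuous_const) x y

theorem measurable_gr_cpot {lam : ℝ} (hlam : 0 ≤ lam) {z : ℂ} (hz : z.im < 0)
    (Γ : Set (Lattice d)) (x y : Lattice d) (p : ℝ) :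
    Measurable fun ω => ‖gr Γ (a.cpot lam z ω) x y‖ₑ ^ p :=
  ((a.continuous_gr_cpot hlam hz Γ x y).enorm.measurable).pow_const p

theorem gr_cpot_congr {lam : ℝ} (hlam : 0 ≤ lam) {z : ℂ} (hz : z.im < 0) {Γ : Set (Lattice d)}
    {ω ω' : Lattice d → ℝ} (h : ∀ x ∈ Γ, ∀ k, a.u (x - k) ≠ 0 → ω k = ω' k)
    (x : Lattice d) {y : Lattice d} (hy : y ∈ Γ) :
    gr Γ (a.cpot lam z ω) x y = gr Γ (a.cpot lam z ω') x y :=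
  gr_congr (a.isDissipative_cpot hlam hz ω) (a.isDissipative_cpot hlam hz ω')
    (fun p hp => by rw [cpot, cpot, a.pot_congr (h p hp)]) x hy

/-! ### Factorization of the Green function through cell and shell -/

open scoped Classical in
/-- The shell around `b` inside `Γ`. -/
def shellIn (Γ : Set (Lattice d)) (b : Lattice d) : Finset (Lattice d) :=
  (a.shell b).filter (· ∈ Γ)

open scoped Classical in
/-- The cell at `b` inside `Γ`. -/
def cellIn (Γ : Set (Lattice d)) (b : Lattice d) : Finset (Lattice d) :=
  (a.cell b).filter (· ∈ Γ)

/-- `Γ` without the cell at `b`. -/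
def outer (Γ : Set (Lattice d)) (b : Lattice d) : Set (Lattice d) := Γ \ a.cell b

/-- `Γ` without the cell at `b` and the shell around it. -/
def outer₂ (Γ : Set (Lattice d)) (b : Lattice d) : Set (Lattice d) := a.outer Γ b \ a.shell b

theorem mem_cellIn {Γ : Set (Lattice d)} {b k : Lattice d} :
    k ∈ a.cellIn Γ b ↔ k ∈ Γ ∧ k ∉ a.outer Γ b := by
  classical
  simp only [cellIn, outer, Finset.mem_filter, Set.mem_sdiff, Finset.mem_coe]
  tauto

theorem mem_shellIn {Γ : Set (Lattice d)} {b k : Lattice d} :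
    k ∈ a.shellIn Γ b ↔ k ∈ a.outer Γ b ∧ k ∉ a.outer₂ Γ b := by
  classical
  have : k ∈ a.shell b → k ∉ a.cell b := fun h => (Finset.mem_sdiff.1 h).2
  simp only [shellIn, outer₂, outer, Finset.mem_filter, Set.mem_sdiff, Finset.mem_coe]
  tauto

theorem add_mem_shellIn {Γ : Set (Lattice d)} {b k e : Lattice d} (hk : k ∈ a.cellIn Γ b)
    (he : e ∈ unitVectors d) (h : k + e ∈ a.outer Γ b) : k + e ∈ a.shellIn Γ b := by
  classical
  exact Finset.mem_filter.2 ⟨a.add_mem_shell (Finset.mem_filter.1 hk).1 he h.2, h.1⟩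

theorem card_shellIn_le (Γ : Set (Lattice d)) (b : Lattice d) :
    (a.shellIn Γ b).card ≤ (unitVectors d).card * a.N := by
  classical
  exact (Finset.card_filter_le _ _).trans (a.card_shell_le b)

theorem card_cellIn_le (Γ : Set (Lattice d)) (b : Lattice d) : (a.cellIn Γ b).card ≤ a.N := by
  classical
  exact (Finset.card_filter_le _ _).trans (a.card_cell_le b)

/-- The sum of the Green functions of `Γ` without the cell at `b` over pairs of shell sites. -/
def shellSum (Γ : Set (Lattice d)) (b : Lattice d) (w : Lattice d → ℂ) : ℝ≥0∞ :=
  ∑ j ∈ a.shellIn Γ b, ∑ j' ∈ a.shellIn Γ b, ‖gr (a.outer Γ b) w j j'‖ₑ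

open scoped Classical in
/-- The sum of the `p`-th powers of the Green functions at energy sites next to the shell around
`b`, replaced by `1` if `y` is in the cell or the shell. -/
def tailSum (p : ℝ) (Γ : Set (Lattice d)) (b : Lattice d) (w : Lattice d → ℂ)
    (y : Lattice d) : ℝ≥0∞ :=
  if y ∈ a.outer₂ Γ b then
    ∑ i ∈ a.shellIn Γ b, ∑ e ∈ unitVectors d, ‖gr (a.outer₂ Γ b) w (i + e) y‖ₑ ^ p
  else 1

theorem enorm_gr_outer_le {Γ : Set (Lattice d)} {b j j' : Lattice d} {w : Lattice d → ℂ}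
    (hj : j ∈ a.shellIn Γ b) (hj' : j' ∈ a.shellIn Γ b) :
    ‖gr (a.outer Γ b) w j j'‖ₑ ≤ a.shellSum Γ b w :=
  (Finset.single_le_sum (f := fun j' => ‖gr (a.outer Γ b) w j j'‖ₑ)
    (fun _ _ => zero_le) hj').trans
    (Finset.single_le_sum (f := fun j => ∑ j' ∈ a.shellIn Γ b, ‖gr (a.outer Γ b) w j j'‖ₑ)
      (fun _ _ => zero_le) hj)

/-- The second expansion, which removes the shell. If y itself is a shell site, no expansion is
needed and the default value 1 of the tail takes over. -/
theorem enorm_gr_outer_le_mul {Γ : Set (Lattice d)} {b j y : Lattice d} {c : ℝ}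
    {w : Lattice d → ℂ} (hw : IsDissipative c w) (hj : j ∈ a.shellIn Γ b)
    (hy : y ∈ a.outer Γ b) :
    ‖gr (a.outer Γ b) w j y‖ₑ ≤ a.shellSum Γ b w * a.tailSum 1 Γ b w y := by
  classical
  by_cases hy2 : y ∈ a.outer₂ Γ b
  · rw [tailSum, if_pos hy2, gr_expand (Γ' := a.outer₂ Γ b) Set.sdiff_subset (fun k => a.mem_shellIn) hw j hy2,
      gr_eq_zero hw (a.mem_shellIn.1 hj).2 hy2, zero_add]
    simp only [ENNReal.rpow_one]
    refine (enorm_sum_le _ _).trans ?_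
    rw [Finset.mul_sum]
    refine Finset.sum_le_sum fun i hi => ?_
    rw [enorm_mul, mul_comm]
    exact mul_le_mul' (a.enorm_gr_outer_le hj hi) (enorm_sum_le _ _)
  · rw [tailSum, if_neg hy2, mul_one]
    exact a.enorm_gr_outer_le hj (a.mem_shellIn.2 ⟨hy, hy2⟩)

/-- The first expansion, which removes the cell: a step from the cell into the remaining region
lands in the shell, where the second expansion takes over. The summands 1 allow one formula also
when y lies in the cell. -/
theorem enorm_gr_le_mul {Γ : Set (Lattice d)} {b x y : Lattice d} {c : ℝ}
    {w : Lattice d → ℂ} (hw : IsDissipative c w) (hx : x ∈ a.cellIn Γ b) (hy : y ∈ Γ) :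
    ‖gr Γ w x y‖ₑ ≤ (1 + (unitVectors d).card) * (∑ k ∈ a.cellIn Γ b, ‖gr Γ w x k‖ₑ) *
      (1 + a.shellSum Γ b w) * a.tailSum 1 Γ b w y := by
  classical
  by_cases hy1 : y ∈ a.outer Γ b
  · rw [gr_expand (Γ' := a.outer Γ b) Set.sdiff_subset (fun k => a.mem_cellIn) hw x hy1,
      gr_eq_zero hw (a.mem_cellIn.1 hx).2 hy1, zero_add]
    have h1 : ∀ k ∈ a.cellIn Γ b, ‖∑ e ∈ unitVectors d, gr (a.outer Γ b) w (k + e) y‖ₑ ≤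
        (unitVectors d).card * (a.shellSum Γ b w * a.tailSum 1 Γ b w y) := fun k hk => by
      refine (enorm_sum_le _ _).trans ?_
      rw [← nsmul_eq_mul]
      refine Finset.sum_le_card_nsmul _ _ _ fun e he => ?_
      by_cases hke : k + e ∈ a.outer Γ b
      · exact a.enorm_gr_outer_le_mul hw (a.add_mem_shellIn hk he hke) hy1
      · rw [gr_eq_zero hw hke hy1, enorm_zero]
        exact zero_le
    calc _ ≤ ∑ k ∈ a.cellIn Γ b, (unitVectors d).card *
          (a.shellSum Γ b w * a.tailSum 1 Γ b w y) * ‖gr Γ w x k‖ₑ := by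
          refine (enorm_sum_le _ _).trans (Finset.sum_le_sum fun k hk => ?_)
          rw [enorm_mul]
          exact mul_le_mul' (h1 k hk) le_rfl
      _ = (unitVectors d).card * (∑ k ∈ a.cellIn Γ b, ‖gr Γ w x k‖ₑ) * a.shellSum Γ b w *
          a.tailSum 1 Γ b w y := by rw [← Finset.mul_sum]; ring
      _ ≤ _ := by
          gcongr <;> exact le_add_self
  · have hyc : y ∈ a.cellIn Γ b := a.mem_cellIn.2 ⟨hy, hy1⟩
    have hy2 : y ∉ a.outer₂ Γ b := fun h => hy1 h.1
    rw [tailSum, if_neg hy2, mul_one]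
    calc ‖gr Γ w x y‖ₑ ≤ ∑ k ∈ a.cellIn Γ b, ‖gr Γ w x k‖ₑ :=
          Finset.single_le_sum (f := fun k => ‖gr Γ w x k‖ₑ) (fun _ _ => zero_le) hyc
      _ = 1 * (∑ k ∈ a.cellIn Γ b, ‖gr Γ w x k‖ₑ) * 1 := by ring
      _ ≤ _ := by
          gcongr <;> exact le_self_add

theorem _root_.ENNReal.sum_rpow_le {ι : Type*} (s : Finset ι) (f : ι → ℝ≥0∞) {p : ℝ} (hp : 0 < p)
    (hp1 : p ≤ 1) : (∑ i ∈ s, f i) ^ p ≤ ∑ i ∈ s, f i ^ p := by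
  classical
  induction s using Finset.induction_on with
  | empty => simp [hp]
  | insert i s hi ih =>
    rw [Finset.sum_insert hi, Finset.sum_insert hi]
    exact (ENNReal.rpow_add_le_add_rpow _ _ hp.le hp1).trans (add_le_add le_rfl ih)

theorem tailSum_rpow_le {p : ℝ} (hp : 0 < p) (hp1 : p ≤ 1) (Γ : Set (Lattice d)) (b : Lattice d)
    (w : Lattice d → ℂ) (y : Lattice d) : a.tailSum 1 Γ b w y ^ p ≤ a.tailSum p Γ b w y := by
  rw [tailSum, tailSum]
  split_ifs
  · refine (ENNReal.sum_rpow_le _ _ hp hp1).trans (Finset.sum_le_sum fun i _ => ?_)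
    refine (ENNReal.sum_rpow_le _ _ hp hp1).trans (Finset.sum_le_sum fun e _ => ?_)
    rw [ENNReal.rpow_one]
  · simp

theorem enorm_gr_rpow_le {Γ : Set (Lattice d)} {b x y : Lattice d} {c p : ℝ}
    {w : Lattice d → ℂ} (hw : IsDissipative c w) (hx : x ∈ a.cellIn Γ b) (hy : y ∈ Γ)
    (hp : 0 < p) (hp1 : p ≤ 1) :
    ‖gr Γ w x y‖ₑ ^ p ≤ (1 + (unitVectors d).card) * ∑ k ∈ a.cellIn Γ b,
      ‖gr Γ w x k‖ₑ ^ p * ((1 + a.shellSum Γ b w) ^ p * a.tailSum p Γ b w y) := by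
  refine (ENNReal.rpow_le_rpow (a.enorm_gr_le_mul hw hx hy) hp.le).trans ?_
  rw [ENNReal.mul_rpow_of_nonneg _ _ hp.le, ENNReal.mul_rpow_of_nonneg _ _ hp.le,
    ENNReal.mul_rpow_of_nonneg _ _ hp.le, ← Finset.sum_mul, mul_assoc, mul_assoc]
  refine mul_le_mul' ?_ (mul_le_mul' (ENNReal.sum_rpow_le _ _ hp hp1)
    (mul_le_mul' le_rfl (a.tailSum_rpow_le hp hp1 Γ b w y)))
  calc _ ≤ (1 + (unitVectors d).card : ℝ≥0∞) ^ (1 : ℝ) :=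
        ENNReal.rpow_le_rpow_of_exponent_le le_self_add hp1
    _ = _ := ENNReal.rpow_one _

end AlloyData

/-! ### The one-step moment estimate -/

namespace AlloyData

variable {d : ℕ} (a : AlloyData d)

theorem shellSum_ne_top (Γ : Set (Lattice d)) (b : Lattice d) (w : Lattice d → ℂ) :
    a.shellSum Γ b w ≠ ∞ :=
  ENNReal.sum_ne_top.2 fun _ _ => ENNReal.sum_ne_top.2 fun _ _ => enorm_ne_top

/-- The constant has to be uniform in z. For |z| of order λ the Schur complement average applies,
the shell sum bounding its entries; for larger |z| the deterministic bound 1/λ suffices. -/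
theorem exists_lintegral_gr_update_le {τ : ℝ} (hτ : 0 < τ) (hNτ : a.N * τ ≤ 1 / 2) :
    ∃ C : ℝ≥0∞, C ≠ ∞ ∧ ∀ lam : ℝ, 1 ≤ lam → ∀ z : ℂ, z.im < 0 → ∀ (Γ : Set (Lattice d))
      (b x k : Lattice d), x ∈ a.cellIn Γ b → k ∈ a.cellIn Γ b → ∀ ω : Lattice d → ℝ,
      ∫⁻ r in Set.Icc (-a.R) a.R, ‖gr Γ (a.cpot lam z (Function.update ω b r)) x k‖ₑ ^ τ ≤
        C * ENNReal.ofReal (lam ^ (-τ)) *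
          (1 + a.shellSum Γ b (a.cpot lam z (Function.update ω b 0))) ^ (a.N * τ) := by
  classical
  obtain ⟨m, hm, hmle⟩ := a.exists_le_abs_u
  have hR := a.R_pos
  have hB := a.B_nonneg
  -- Chosen so that |z| > λZ leaves |λV - z| ≥ λ plus the bound for the hopping norm, using λ ≥ 1.
  set Z : ℝ := 3 * a.R * a.B + 1 + (unitVectors d).card with hZ
  have hZ0 : 0 ≤ Z := by positivity
  obtain ⟨C, hC, hCle⟩ := exists_lintegral_gr_le (d := d) a.N hm hB hR.le hτ hNτ
    (K := 3 * a.R * a.B + Z) (by positivity)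
  refine ⟨C + volume (Set.Icc (-a.R) a.R), ENNReal.add_ne_top.2 ⟨hC, by simp⟩, ?_⟩
  intro lam hlam z hz Γ b x k hx hk ω
  have hlam0 : 0 < lam := one_pos.trans_le hlam
  set w := a.cpot lam z (Function.update ω b 0) with hw
  have hwd : IsDissipative (-z.im) w := a.isDissipative_cpot hlam0.le hz _
  have hNτ0 : 0 ≤ a.N * τ := by positivity
  rcases le_or_gt ‖z‖ (lam * Z) with hzZ | hzZ
  · set T : ℝ := (a.shellSum Γ b w).toReal with hT
    have h1 := hCle lam hlam Γ (a.outer Γ b) Set.sdiff_subset (a.cellIn Γ b)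
      (fun _ => a.mem_cellIn) (a.card_cellIn_le Γ b) (-z.im) w hwd (fun k => a.u (k - b))
      (fun k hk => not_not.1 (a.mem_cell.not.1 hk.2))
      (fun k hk => hmle _ (a.mem_cell.1 (Finset.mem_filter.1 hk).1)) (fun k => a.abs_u_le _)
      (fun k _ => (a.norm_cpot_le hlam0.le z _ k).trans (by nlinarith))
      T ENNReal.toReal_nonneg (fun k hk y hy e he e' he' hye => by
        by_cases hke : k + e' ∈ a.outer Γ b
        · rw [← toReal_enorm]
          exact ENNReal.toReal_mono (a.shellSum_ne_top Γ b w)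
            (a.enorm_gr_outer_le (a.add_mem_shellIn hk he' hke) (a.add_mem_shellIn hy he hye))
        · rw [gr_eq_zero hwd hke hye, norm_zero]
          exact ENNReal.toReal_nonneg) x k hx hk
    have h2 : ENNReal.ofReal ((1 + T) ^ (a.N * τ)) = (1 + a.shellSum Γ b w) ^ (a.N * τ) := by
      have hT0 : 0 ≤ T := ENNReal.toReal_nonneg
      rw [← ENNReal.ofReal_rpow_of_nonneg (by linarith) hNτ0,
        ENNReal.ofReal_add zero_le_one hT0, ENNReal.ofReal_one, hT,
        ENNReal.ofReal_toReal (a.shellSum_ne_top Γ b w)]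
    rw [h2] at h1
    refine le_trans (le_of_eq ?_) (h1.trans ?_)
    · refine setLIntegral_congr_fun measurableSet_Icc fun r hr => ?_
      have h3 : a.cpot lam z (Function.update ω b r) =
          fun k => w k + ((lam * r * a.u (k - b) : ℝ) : ℂ) := by
        funext k
        rw [hw, cpot, cpot, a.pot_update hr]
        push_cast
        ring
      simp only [h3]
    · gcongr
      exact le_self_add
  · have h1 : ∀ r, ‖gr Γ (a.cpot lam z (Function.update ω b r)) x k‖ₑ ^ τ ≤
        ENNReal.ofReal (lam ^ (-τ)) := fun r => by
      have h2 := norm_gr_le_of_le_norm Γ (a.isDissipative_cpot hlam0.le hz (Function.update ω b r))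
        hlam0 (fun p => by
          have h3 : ‖z‖ - lam * (3 * a.R * a.B) ≤ ‖a.cpot lam z (Function.update ω b r) p‖ := by
            rw [cpot, norm_sub_rev]
            refine le_trans (sub_le_sub_left ?_ _) (norm_sub_norm_le _ _)
            rw [Complex.norm_real, Real.norm_eq_abs, abs_mul, abs_of_pos hlam0]
            exact mul_le_mul_of_nonneg_left (a.abs_pot_le _ _) hlam0.le
          have h4 : ((unitVectors d).card : ℝ) ≤ lam * (unitVectors d).card :=
            le_mul_of_one_le_left (by positivity) hlam
          nlinarith) x k
      rw [Real.rpow_neg hlam0.le, ← Real.inv_rpow hlam0.le,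
        ← ENNReal.ofReal_rpow_of_nonneg (by positivity) hτ.le, ← ofReal_norm]
      exact ENNReal.rpow_le_rpow (ENNReal.ofReal_le_ofReal h2) hτ.le
    calc _ ≤ ∫⁻ _ in Set.Icc (-a.R) a.R, ENNReal.ofReal (lam ^ (-τ)) := lintegral_mono h1
      _ = volume (Set.Icc (-a.R) a.R) * ENNReal.ofReal (lam ^ (-τ)) * 1 := by
        rw [lintegral_const, Measure.restrict_apply_univ, mul_one, mul_comm]
      _ ≤ _ := by
        gcongr
        · exact le_add_self
        · refine (ENNReal.one_rpow (a.N * τ)).symm.le.trans ?_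
          exact ENNReal.rpow_le_rpow le_self_add hNτ0

/-- The fractional moment sum controlling `shellSum`. -/
def shellMoment (Γ : Set (Lattice d)) (b : Lattice d) (w : Lattice d → ℂ) : ℝ≥0∞ :=
  1 + ∑ j ∈ a.shellIn Γ b, ∑ j' ∈ a.shellIn Γ b, ‖gr (a.outer Γ b) w j j'‖ₑ ^ (1 / 2 : ℝ)

theorem shellSum_rpow_le (Γ : Set (Lattice d)) (b : Lattice d) (w : Lattice d → ℂ) :
    (1 + a.shellSum Γ b w) ^ (1 / 2 : ℝ) ≤ a.shellMoment Γ b w := by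
  refine (ENNReal.rpow_add_le_add_rpow _ _ (by norm_num) (by norm_num)).trans ?_
  rw [ENNReal.one_rpow, shellMoment, shellSum]
  gcongr
  refine (ENNReal.sum_rpow_le _ _ (by norm_num) (by norm_num)).trans
    (Finset.sum_le_sum fun j _ => ?_)
  exact ENNReal.sum_rpow_le _ _ (by norm_num) (by norm_num)

theorem measurable_shellMoment {lam : ℝ} (hlam : 0 ≤ lam) {z : ℂ} (hz : z.im < 0)
    (Γ : Set (Lattice d)) (b : Lattice d) :
    Measurable fun ω => a.shellMoment Γ b (a.cpot lam z ω) :=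
  (Finset.measurable_sum _ fun j _ => Finset.measurable_sum _ fun j' _ =>
    a.measurable_gr_cpot hlam hz (a.outer Γ b) j j' _).const_add _

/-- A common shift t of the neighbouring couplings adds λt times the ring potential, nonnegative off
the cell and at least m on the shell. Since λ ≥ 1 the monotone bound holds with m itself, hence
uniformly in λ, z, Γ and the other couplings. -/
theorem exists_lintegral_shellMoment_le :
    ∃ C : ℝ≥0∞, C ≠ ∞ ∧ ∀ lam : ℝ, 1 ≤ lam → ∀ z : ℂ, z.im < 0 → ∀ (Γ : Set (Lattice d))
      (b : Lattice d) (ω : Lattice d → ℝ),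
      (∀ i ∈ nbrs b, ω i ∈ Set.Icc (-(2 * a.R)) (2 * a.R)) →
      ∫⁻ t in Set.Icc (-a.R) a.R,
        a.shellMoment Γ b (a.cpot lam z fun i => ω i + if i ∈ nbrs b then t else 0) ≤ C := by
  classical
  obtain ⟨m, hm, hmle⟩ := a.exists_le_abs_u
  set C₀ : ℝ≥0∞ := 4 * ENNReal.ofReal (24 * Real.sqrt (a.R / m)) with hC₀
  set n : ℝ≥0∞ := (((unitVectors d).card * a.N : ℕ) : ℝ≥0∞) with hn
  refine ⟨volume (Set.Icc (-a.R) a.R) + n * (n * C₀), ?_, ?_⟩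
  · refine ENNReal.add_ne_top.2 ⟨by simp, ?_⟩
    exact ENNReal.mul_ne_top (ENNReal.natCast_ne_top _) (ENNReal.mul_ne_top
      (ENNReal.natCast_ne_top _) (ENNReal.mul_ne_top (by norm_num) ENNReal.ofReal_ne_top))
  intro lam hlam z hz Γ b ω hω
  have hlam0 : 0 < lam := one_pos.trans_le hlam
  -- In the cell the ring potential may be negative; it is set to zero there, which does not affect
  -- Green functions of the region without the cell.
  set U : Lattice d → ℝ := fun k => if k ∈ a.cell b then 0 else lam * a.ringPotential b k with hU
  have hU0 : ∀ k, 0 ≤ U k := fun k => by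
    simp only [hU]
    split_ifs with h
    · exact le_rfl
    · exact mul_nonneg hlam0.le (a.ringPotential_nonneg h)
  have hUB : ∀ k, U k ≤ lam * ((unitVectors d).card * a.B) := fun k => by
    have h0 := a.B_nonneg
    simp only [hU]
    split_ifs with h
    · positivity
    · exact mul_le_mul_of_nonneg_left (a.ringPotential_le b k) hlam0.le
  have hUm : ∀ k ∈ a.shellIn Γ b, m ≤ U k := fun k hk => by
    have h1 := (a.mem_shellIn.1 hk).1.2
    have h2 := a.le_ringPotential hmle (Finset.mem_filter.1 hk).1
    rw [hU]
    simp only [Finset.mem_coe] at h1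
    simp only [if_neg h1]
    exact h2.trans (le_mul_of_one_le_left (a.ringPotential_nonneg h1) hlam)
  set W : ℝ → Lattice d → ℝ := fun t i => ω i + if i ∈ nbrs b then t else 0 with hW
  have hwd := a.isDissipative_cpot hlam0.le hz ω
  have hmeas : ∀ j j', Measurable fun t =>
      ‖gr (a.outer Γ b) (a.cpot lam z (W t)) j j'‖ₑ ^ (1 / 2 : ℝ) := fun j j' => by
    refine (a.measurable_gr_cpot hlam0.le hz (a.outer Γ b) j j' (1 / 2)).comp (g := fun ω =>
      ‖gr (a.outer Γ b) (a.cpot lam z ω) j j'‖ₑ ^ (1 / 2 : ℝ)) (f := W) ?_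
    refine measurable_pi_lambda _ fun i => ?_
    by_cases hi : i ∈ nbrs b
    · simp only [hW, if_pos hi]
      exact measurable_const.add measurable_id
    · simp only [hW, if_neg hi]
      exact measurable_const
  have hpair : ∀ j ∈ a.shellIn Γ b, ∀ j' ∈ a.shellIn Γ b,
      ∫⁻ t in Set.Icc (-a.R) a.R,
        ‖gr (a.outer Γ b) (a.cpot lam z (W t)) j j'‖ₑ ^ (1 / 2 : ℝ) ≤ C₀ := fun j hj j' hj' => by
    refine le_trans (le_of_eq ?_) (lintegral_gr_le_of_monotone (a.outer Γ b) hwd hU0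
      ⟨_, hUB⟩ hm (hUm j hj) (hUm j' hj') a.R_pos)
    refine setLIntegral_congr_fun measurableSet_Icc fun t ht => ?_
    rw [gr_congr (a.isDissipative_cpot hlam0.le hz (W t))
      (hwd.add_mul hU0 ⟨_, hUB⟩ (ζ := (t : ℂ)) (by simp)) (fun p hp => ?_) j
      (a.mem_shellIn.1 hj').1]
    have hp' : p ∉ a.cell b := hp.2
    have hUp : U p = lam * a.ringPotential b p := if_neg hp'
    rw [cpot, cpot, hW, a.pot_shift ht hω, hUp]
    push_cast
    ring
  have hcard : ((a.shellIn Γ b).card : ℝ≥0∞) ≤ n := by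
    rw [hn]
    exact_mod_cast a.card_shellIn_le Γ b
  simp only [shellMoment]
  rw [lintegral_add_left measurable_const, lintegral_const, one_mul, Measure.restrict_apply_univ,
    lintegral_finsetSum _ fun j _ => Finset.measurable_sum _ fun j' _ => hmeas j j']
  gcongr
  refine (Finset.sum_le_card_nsmul _ _ (n * C₀) fun j hj => ?_).trans ?_
  · rw [lintegral_finsetSum _ fun j' _ => hmeas j j']
    refine (Finset.sum_le_card_nsmul _ _ C₀ fun j' hj' => hpair j hj j' hj').trans ?_
    rw [nsmul_eq_mul]
    gcongr
  · rw [nsmul_eq_mul]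
    gcongr

theorem mem_nbrs {b i : Lattice d} : i ∈ nbrs b ↔ ∃ e ∈ unitVectors d, b + e = i := by
  rw [nbrs, Finset.mem_image]

theorem shellSum_congr {lam : ℝ} (hlam : 0 ≤ lam) {z : ℂ} (hz : z.im < 0) (Γ : Set (Lattice d))
    {b : Lattice d} {ω ω' : Lattice d → ℝ} (h : ∀ i, i ≠ b → ω i = ω' i) :
    a.shellSum Γ b (a.cpot lam z ω) = a.shellSum Γ b (a.cpot lam z ω') := by
  refine Finset.sum_congr rfl fun j _ => Finset.sum_congr rfl fun j' hj' => ?_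
  rw [a.gr_cpot_congr hlam hz (fun p hp k hk => h k fun hkb => ?_) j (a.mem_shellIn.1 hj').1]
  exact hp.2 (a.mem_cell.2 (hkb ▸ hk))

/-- Removing cell and shell removes every site reached by the couplings at b and its neighbours, so
the tail is untouched by both averages. -/
theorem tailSum_congr {lam : ℝ} (hlam : 0 ≤ lam) {z : ℂ} (hz : z.im < 0) (p : ℝ)
    (Γ : Set (Lattice d)) {b : Lattice d} (y : Lattice d) {ω ω' : Lattice d → ℝ}
    (h : ∀ i, i ≠ b → i ∉ nbrs b → ω i = ω' i) :
    a.tailSum p Γ b (a.cpot lam z ω) y = a.tailSum p Γ b (a.cpot lam z ω') y := by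
  rw [tailSum, tailSum]
  split_ifs with hy
  · refine Finset.sum_congr rfl fun j _ => Finset.sum_congr rfl fun e _ => ?_
    rw [a.gr_cpot_congr hlam hz (fun q hq k hk => h k (fun hkb => ?_) fun hkn => ?_) _ hy]
    · exact hq.1.2 (a.mem_cell.2 (hkb ▸ hk))
    · obtain ⟨e, he, rfl⟩ := mem_nbrs.1 hkn
      exact hq.2 (a.mem_shell.2 ⟨⟨e, he, hk⟩, not_not.1 (a.mem_cell.not.1 hq.1.2)⟩)
  · rfl

theorem measurable_tailSum {lam : ℝ} (hlam : 0 ≤ lam) {z : ℂ} (hz : z.im < 0) (p : ℝ)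
    (Γ : Set (Lattice d)) (b y : Lattice d) :
    Measurable fun ω => a.tailSum p Γ b (a.cpot lam z ω) y := by
  unfold tailSum
  split_ifs
  · exact Finset.measurable_sum _ fun j _ => Finset.measurable_sum _ fun e _ =>
      a.measurable_gr_cpot hlam hz _ _ _ _
  · exact measurable_const

theorem measurable_shellSum {lam : ℝ} (hlam : 0 ≤ lam) {z : ℂ} (hz : z.im < 0)
    (Γ : Set (Lattice d)) (b : Lattice d) :
    Measurable fun ω => a.shellSum Γ b (a.cpot lam z ω) :=
  Finset.measurable_sum _ fun j _ => Finset.measurable_sum _ fun j' _ =>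
    (a.continuous_gr_cpot hlam hz (a.outer Γ b) j j').enorm.measurable

/-- The basic step: the fractional moment between `x` and `y` is bounded by fractional moments
between sites near `x` and `y` in a smaller region. -/
theorem exists_lintegral_gr_le_tailSum {μ : Measure ℝ} [IsProbabilityMeasure μ] {K : ℝ≥0∞}
    (hμ : HasBoundedDensity μ K a.R) {τ : ℝ} (hτ : 0 < τ) (hNτ : (a.N + 1) * τ ≤ 1 / 2) :
    ∃ C : ℝ≥0∞, C ≠ ∞ ∧ ∀ lam : ℝ, 1 ≤ lam → ∀ z : ℂ, z.im < 0 → ∀ (Γ : Set (Lattice d)),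
      ∀ x ∈ Γ, ∀ y ∈ Γ,
      ∫⁻ ω, ‖gr Γ (a.cpot lam z ω) x y‖ₑ ^ τ ∂law d μ ≤
        C * ENNReal.ofReal (lam ^ (-τ)) *
          ∫⁻ ω, a.tailSum τ Γ x (a.cpot lam z ω) y ∂law d μ := by
  classical
  have hNτ' : a.N * τ ≤ 1 / 2 := by nlinarith
  have hτ1 : τ ≤ 1 := by
    have : 0 ≤ a.N * τ := by positivity
    nlinarith
  obtain ⟨C₁, hC₁, hC₁le⟩ := a.exists_lintegral_gr_update_le hτ hNτ'
  obtain ⟨C₂, hC₂, hC₂le⟩ := a.exists_lintegral_shellMoment_le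
  have hR := a.R_pos
  set C₃ : ℝ≥0∞ := (ENNReal.ofReal (2 * a.R))⁻¹ *
    ((K * ENNReal.ofReal (4 * a.R)) ^ (unitVectors d).card * C₂) with hC₃
  have hC₃top : C₃ ≠ ∞ := by
    refine ENNReal.mul_ne_top (ENNReal.inv_ne_top.2 ?_) (ENNReal.mul_ne_top (ENNReal.pow_ne_top
      (ENNReal.mul_ne_top hμ.ne_top ENNReal.ofReal_ne_top)) hC₂)
    rw [Ne, ENNReal.ofReal_eq_zero, not_le]
    linarith
  refine ⟨(1 + (unitVectors d).card) * (a.N * (K * C₁ * C₃)), ?_, ?_⟩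
  · refine ENNReal.mul_ne_top (ENNReal.add_ne_top.2
      ⟨ENNReal.one_ne_top, ENNReal.natCast_ne_top _⟩) ?_
    exact ENNReal.mul_ne_top (ENNReal.natCast_ne_top _)
      (ENNReal.mul_ne_top (ENNReal.mul_ne_top hμ.ne_top hC₁) hC₃top)
  intro lam hlam z hz Γ x hx y hy
  have hlam0 : 0 ≤ lam := zero_le_one.trans hlam
  have hxc : x ∈ a.cellIn Γ x := Finset.mem_filter.2 ⟨a.self_mem_cell x, hx⟩
  set ℓ : ℝ≥0∞ := ENNReal.ofReal (lam ^ (-τ)) with hℓ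
  set S : (Lattice d → ℝ) → ℝ≥0∞ := fun ω => a.shellSum Γ x (a.cpot lam z ω) with hS
  set Y : (Lattice d → ℝ) → ℝ≥0∞ := fun ω => a.tailSum τ Γ x (a.cpot lam z ω) y with hY
  set G : Lattice d → (Lattice d → ℝ) → ℝ≥0∞ :=
    fun k ω => ‖gr Γ (a.cpot lam z ω) x k‖ₑ ^ τ with hG
  have hSm : Measurable S := a.measurable_shellSum hlam0 hz Γ x
  have hYm : Measurable Y := a.measurable_tailSum hlam0 hz τ Γ x y
  have hGm : ∀ k, Measurable (G k) := fun k => a.measurable_gr_cpot hlam0 hz Γ x k τ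
  have hFm : ∀ k, Measurable fun ω => G k ω * ((1 + S ω) ^ τ * Y ω) := fun k =>
    (hGm k).mul (((hSm.const_add 1).pow_const τ).mul hYm)
  have hstep : ∀ k ∈ a.cellIn Γ x,
      ∫⁻ ω, G k ω * ((1 + S ω) ^ τ * Y ω) ∂law d μ ≤ K * C₁ * C₃ * ℓ * ∫⁻ ω, Y ω ∂law d μ := by
    intro k hk
    calc ∫⁻ ω, G k ω * ((1 + S ω) ^ τ * Y ω) ∂law d μ
        ≤ ∫⁻ ω, (K * ∫⁻ r in Set.Icc (-a.R) a.R, G k (Function.update ω x r) *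
            ((1 + S (Function.update ω x r)) ^ τ * Y (Function.update ω x r))) ∂law d μ :=
          lintegral_law_le_update hμ x (hFm k)
      _ ≤ ∫⁻ ω, K * C₁ * ℓ * (a.shellMoment Γ x (a.cpot lam z ω) * Y ω) ∂law d μ := by
          refine lintegral_mono fun ω => ?_
          have hSr : ∀ r, S (Function.update ω x r) = S ω := fun r =>
            a.shellSum_congr hlam0 hz Γ fun i hi => Function.update_of_ne hi r ω
          have hYr : ∀ r, Y (Function.update ω x r) = Y ω := fun r =>
            a.tailSum_congr hlam0 hz τ Γ y fun i hi _ => Function.update_of_ne hi r ω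
          have h1 := hC₁le lam hlam z hz Γ x x k hxc hk ω
          have h0 : a.shellSum Γ x (a.cpot lam z (Function.update ω x 0)) = S ω := hSr 0
          rw [h0] at h1
          have hmr : Measurable fun r => G k (Function.update ω x r) :=
            (hGm k).comp (measurable_update ω)
          simp only [hSr, hYr]
          rw [lintegral_mul_const _ hmr]
          calc K * ((∫⁻ r in Set.Icc (-a.R) a.R, G k (Function.update ω x r)) *
                ((1 + S ω) ^ τ * Y ω))
              ≤ K * (C₁ * ℓ * (1 + S ω) ^ (a.N * τ) * ((1 + S ω) ^ τ * Y ω)) := by gcongr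
            _ = K * C₁ * ℓ * ((1 + S ω) ^ ((a.N + 1) * τ) * Y ω) := by
                rw [add_mul, one_mul, ENNReal.rpow_add_of_nonneg _ _ (by positivity) hτ.le]
                ring
            -- The shell sum carries Nτ from the average over the coupling at x and τ from the
            -- expansion; (N+1)τ ≤ 1/2 keeps it within the available half moment.
            _ ≤ K * C₁ * ℓ * (a.shellMoment Γ x (a.cpot lam z ω) * Y ω) := by
                gcongr
                exact (ENNReal.rpow_le_rpow_of_exponent_le le_self_add hNτ).trans
                  (a.shellSum_rpow_le Γ x _)
      _ = K * C₁ * ℓ * ∫⁻ ω, a.shellMoment Γ x (a.cpot lam z ω) * Y ω ∂law d μ :=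
          lintegral_const_mul _ ((a.measurable_shellMoment hlam0 hz Γ x).mul hYm)
      _ ≤ K * C₁ * ℓ * (C₃ * ∫⁻ ω, Y ω ∂law d μ) := by
          gcongr
          have h2 := lintegral_law_mul_le_of_shift hμ (nbrs x)
            (a.measurable_shellMoment hlam0 hz Γ x) hYm
            (fun ω ω' h => a.tailSum_congr hlam0 hz τ Γ y fun i _ hi => h i hi)
            (fun ω hω => hC₂le lam hlam z hz Γ x ω hω)
          rwa [card_nbrs] at h2
      _ = _ := by ring
  calc ∫⁻ ω, ‖gr Γ (a.cpot lam z ω) x y‖ₑ ^ τ ∂law d μ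
      ≤ ∫⁻ ω, (1 + (unitVectors d).card) *
          ∑ k ∈ a.cellIn Γ x, G k ω * ((1 + S ω) ^ τ * Y ω) ∂law d μ :=
        lintegral_mono fun ω =>
          a.enorm_gr_rpow_le (a.isDissipative_cpot hlam0 hz ω) hxc hy hτ hτ1
    _ = (1 + (unitVectors d).card) *
          ∑ k ∈ a.cellIn Γ x, ∫⁻ ω, G k ω * ((1 + S ω) ^ τ * Y ω) ∂law d μ := by
        rw [lintegral_const_mul _ (Finset.measurable_sum _ fun k _ => hFm k),
          lintegral_finsetSum _ fun k _ => hFm k]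
    _ ≤ (1 + (unitVectors d).card) * (a.N * (K * C₁ * C₃ * ℓ * ∫⁻ ω, Y ω ∂law d μ)) := by
        gcongr
        refine (Finset.sum_le_card_nsmul _ _ _ hstep).trans ?_
        rw [nsmul_eq_mul]
        gcongr
        exact a.card_cellIn_le Γ x
    _ = _ := by ring

end AlloyData

/-! ### Iteration and exponential decay -/

theorem isProbabilityMeasure_law (d : ℕ) (μ : Measure ℝ) [IsProbabilityMeasure μ] :
    IsProbabilityMeasure (law d μ) := by
  unfold law
  infer_instance

namespace AlloyData

variable {d : ℕ} (a : AlloyData d)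

/-- Each step moves the starting point by at most L + 1 and produces at most n terms. The threshold
for λ absorbs n and the loss e^(L+1), so the decay rate can be taken to be 1. -/
theorem exists_lintegral_gr_le_exp {μ : Measure ℝ} [IsProbabilityMeasure μ] {K : ℝ≥0∞}
    (hμ : HasBoundedDensity μ K a.R) {τ : ℝ} (hτ : 0 < τ) (hNτ : (a.N + 1) * τ ≤ 1 / 2) :
    ∃ lam₀ : ℝ, 1 ≤ lam₀ ∧ ∃ A : ℝ, 0 < A ∧ ∀ lam : ℝ, lam₀ ≤ lam → ∀ z : ℂ, z.im < 0 →
      ∀ (Γ : Set (Lattice d)), ∀ x ∈ Γ, ∀ y ∈ Γ,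
      ∫⁻ ω, ‖gr Γ (a.cpot lam z ω) x y‖ₑ ^ τ ∂law d μ ≤
        ENNReal.ofReal (A * Real.exp (-‖x - y‖)) := by
  classical
  have hprob := isProbabilityMeasure_law d μ
  obtain ⟨C, hC, hCle⟩ := a.exists_lintegral_gr_le_tailSum hμ hτ hNτ
  obtain ⟨L, hL0, hLcell, hLshell⟩ := a.exists_norm_le_of_mem
  set n : ℝ≥0∞ := (((unitVectors d).card * a.N * (unitVectors d).card : ℕ) : ℝ≥0∞) with hn
  set E : ℝ≥0∞ := ENNReal.ofReal (Real.exp (L + 1)) with hE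
  have hE1 : 1 ≤ E := by
    rw [hE, ENNReal.one_le_ofReal]
    exact Real.one_le_exp (by linarith)
  -- Using n + 1 instead of n also yields q ≤ 1, needed when y is within the cell or shell, even if
  -- n = 0.
  have htend : Filter.Tendsto (fun lam : ℝ => C * ENNReal.ofReal (lam ^ (-τ)) * ((n + 1) * E))
      Filter.atTop (nhds 0) := by
    have h1 : Filter.Tendsto (fun lam : ℝ => ENNReal.ofReal (lam ^ (-τ))) Filter.atTop
        (nhds 0) := by
      rw [← ENNReal.ofReal_zero]
      exact ENNReal.tendsto_ofReal (tendsto_rpow_neg_atTop hτ)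
    have h2 := ENNReal.Tendsto.mul_const (b := (n + 1) * E)
      (ENNReal.Tendsto.const_mul (a := C) h1 (Or.inr hC))
      (Or.inr (ENNReal.mul_ne_top (ENNReal.add_ne_top.2
        ⟨ENNReal.natCast_ne_top _, ENNReal.one_ne_top⟩) ENNReal.ofReal_ne_top))
    simpa using h2
  have hev : ∀ᶠ lam : ℝ in Filter.atTop,
      C * ENNReal.ofReal (lam ^ (-τ)) * ((n + 1) * E) < 2⁻¹ :=
    htend.eventually_lt_const (by simp)
  obtain ⟨lam₀, hlam₀⟩ := Filter.eventually_atTop.1 hev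
  refine ⟨max 1 lam₀, le_max_left _ _, Real.exp L, Real.exp_pos L, ?_⟩
  intro lam hlam z hz
  have hlam1 : 1 ≤ lam := (le_max_left _ _).trans hlam
  have hlam0 : 0 ≤ lam := zero_le_one.trans hlam1
  set q : ℝ≥0∞ := C * ENNReal.ofReal (lam ^ (-τ)) with hq
  have hqn : q * ((n + 1) * E) ≤ 2⁻¹ := (hlam₀ lam ((le_max_right _ _).trans hlam)).le
  have hq1 : q ≤ 1 := by
    calc q = q * (1 * 1) := by ring
      _ ≤ q * ((n + 1) * E) := by gcongr; exact le_add_self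
      _ ≤ 1 := hqn.trans (by simp)
  have hqE : q * (n * E) ≤ 2⁻¹ := le_trans (by gcongr; exact le_self_add) hqn
  have hq' : q * n ≤ 2⁻¹ := le_trans (by gcongr; exact le_mul_of_one_le_right' hE1) hqE
  set E₀ : ℝ≥0∞ := ENNReal.ofReal (-z.im)⁻¹ ^ τ with hE₀
  have hE₀top : E₀ ≠ ∞ := ENNReal.rpow_ne_top_of_nonneg hτ.le ENNReal.ofReal_ne_top
  set b : Lattice d → Lattice d → ℝ≥0∞ :=
    fun x y => ENNReal.ofReal (Real.exp L * Real.exp (-‖x - y‖)) with hb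
  -- The induction runs over all regions at once, since each step shrinks Γ. The a priori bound E₀,
  -- the only quantity depending on Im z, is halved at each step and disappears in the limit.
  have key : ∀ k : ℕ, ∀ (Γ : Set (Lattice d)), ∀ x ∈ Γ, ∀ y ∈ Γ,
      ∫⁻ ω, ‖gr Γ (a.cpot lam z ω) x y‖ₑ ^ τ ∂law d μ ≤ b x y + 2⁻¹ ^ k * E₀ := by
    intro k
    induction k with
    | zero =>
      intro Γ x hx y hy
      rw [pow_zero, one_mul]
      refine le_trans ?_ le_add_self
      calc _ ≤ ∫⁻ _, E₀ ∂law d μ := lintegral_mono fun ω => by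
            refine ENNReal.rpow_le_rpow ?_ hτ.le
            rw [← ofReal_norm]
            exact ENNReal.ofReal_le_ofReal
              (norm_gr_le Γ (a.isDissipative_cpot hlam0 hz ω) x y)
        _ = E₀ := by rw [lintegral_const, measure_univ, mul_one]
    | succ k ih =>
      intro Γ x hx y hy
      refine (hCle lam hlam1 z hz Γ x hx y hy).trans ?_
      by_cases hy2 : y ∈ a.outer₂ Γ x
      · simp only [tailSum, if_pos hy2]
        have hmeas : ∀ i e, Measurable fun ω =>
            ‖gr (a.outer₂ Γ x) (a.cpot lam z ω) (i + e) y‖ₑ ^ τ := fun i e =>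
          a.measurable_gr_cpot hlam0 hz _ _ _ _
        have hterm : ∀ i ∈ a.shellIn Γ x, ∀ e ∈ unitVectors d,
            ∫⁻ ω, ‖gr (a.outer₂ Γ x) (a.cpot lam z ω) (i + e) y‖ₑ ^ τ ∂law d μ ≤
              E * b x y + 2⁻¹ ^ k * E₀ := by
          intro i hi e he
          by_cases hie : i + e ∈ a.outer₂ Γ x
          · refine (ih _ (i + e) hie y hy2).trans ?_
            gcongr
            rw [hE, hb, ← ENNReal.ofReal_mul (Real.exp_pos _).le]
            refine ENNReal.ofReal_le_ofReal ?_
            rw [← Real.exp_add, ← Real.exp_add, ← Real.exp_add]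
            refine Real.exp_le_exp.2 ?_
            have h1 := hLshell x i (Finset.mem_filter.1 hi).1
            have h2 := norm_le_one_of_mem_unitVectors he
            have h3 : ‖x - y‖ ≤ ‖x - i‖ + ‖e‖ + ‖i + e - y‖ := by
              calc ‖x - y‖ = ‖(x - i) - e + (i + e - y)‖ := by congr 1; abel
                _ ≤ ‖(x - i) - e‖ + ‖i + e - y‖ := norm_add_le _ _
                _ ≤ _ := add_le_add (norm_sub_le _ _) le_rfl
            linarith
          · have h0 : ∀ ω, ‖gr (a.outer₂ Γ x) (a.cpot lam z ω) (i + e) y‖ₑ ^ τ = 0 := fun ω => by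
              rw [gr_eq_zero (a.isDissipative_cpot hlam0 hz ω) hie hy2, enorm_zero,
                ENNReal.zero_rpow_of_pos hτ]
            simp only [h0, lintegral_zero]
            exact zero_le
        rw [lintegral_finsetSum _ fun i _ => Finset.measurable_sum _ fun e _ => hmeas i e]
        have hsum : ∑ i ∈ a.shellIn Γ x, ∫⁻ ω, ∑ e ∈ unitVectors d,
            ‖gr (a.outer₂ Γ x) (a.cpot lam z ω) (i + e) y‖ₑ ^ τ ∂law d μ ≤
              n * (E * b x y + 2⁻¹ ^ k * E₀) := by
          refine (Finset.sum_le_card_nsmul _ _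
            ((unitVectors d).card * (E * b x y + 2⁻¹ ^ k * E₀)) fun i hi => ?_).trans ?_
          · rw [lintegral_finsetSum _ fun e _ => hmeas i e, ← nsmul_eq_mul]
            exact Finset.sum_le_card_nsmul _ _ _ (hterm i hi)
          · rw [nsmul_eq_mul, ← mul_assoc, hn, Nat.cast_mul]
            gcongr
            exact a.card_shellIn_le Γ x
        calc _ ≤ q * (n * (E * b x y + 2⁻¹ ^ k * E₀)) := by gcongr
          _ = q * (n * E) * b x y + q * n * (2⁻¹ ^ k * E₀) := by ring
          _ ≤ 1 * b x y + 2⁻¹ * (2⁻¹ ^ k * E₀) := by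
            gcongr
            exact hqE.trans (by simp)
          _ = _ := by rw [pow_succ']; ring
      · simp only [tailSum, if_neg hy2]
        rw [lintegral_const, measure_univ, one_mul, mul_one]
        refine hq1.trans (le_trans ?_ le_self_add)
        simp only [hb]
        rw [← Real.exp_add, ENNReal.one_le_ofReal]
        refine Real.one_le_exp ?_
        have hxy : ‖x - y‖ ≤ L := by
          by_cases hyc : y ∈ a.cell x
          · exact hLcell x y hyc
          · refine hLshell x y ?_
            by_contra hys
            exact hy2 ⟨⟨hy, hyc⟩, hys⟩
        linarith
  intro Γ x hx y hy
  have hlim : Filter.Tendsto (fun k : ℕ => b x y + 2⁻¹ ^ k * E₀) Filter.atTop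
      (nhds (b x y + 0 * E₀)) := by
    refine tendsto_const_nhds.add (ENNReal.Tendsto.mul_const ?_ (Or.inr hE₀top))
    exact ENNReal.tendsto_pow_atTop_nhds_zero_of_lt_one (by simp)
  rw [zero_mul, add_zero] at hlim
  exact ge_of_tendsto' hlim fun k => key k Γ x hx y hy

end AlloyData

/-! ### From the hypotheses of the theorem to the abstract data -/

theorem card_unitVectors_le (d : ℕ) : (unitVectors d).card ≤ 2 * d := by
  have hsub : unitVectors d ⊆ (Finset.univ : Finset (Fin d × Bool)).image
      fun p => Pi.single p.1 (if p.2 then (1 : ℤ) else -1) := by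
    intro e he
    rw [mem_unitVectors, l1Norm] at he
    have hex : ∃ i, e i ≠ 0 := by
      by_contra! h
      simp [h] at he
    obtain ⟨i, hi⟩ := hex
    have hsplit := Finset.add_sum_erase Finset.univ (fun j => |e j|) (Finset.mem_univ i)
    simp only [he] at hsplit
    have hrest : 0 ≤ ∑ j ∈ Finset.univ.erase i, |e j| := Finset.sum_nonneg fun _ _ => abs_nonneg _
    have hpos : 0 < |e i| := abs_pos.2 hi
    have hzero : ∑ j ∈ Finset.univ.erase i, |e j| = 0 := by omega
    have hone : |e i| = 1 := by omega
    have hj : ∀ j, j ≠ i → e j = 0 := fun j hj => by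
      have := (Finset.sum_eq_zero_iff_of_nonneg fun _ _ => abs_nonneg _).1 hzero j
        (Finset.mem_erase.2 ⟨hj, Finset.mem_univ j⟩)
      simpa using this
    rw [Finset.mem_image]
    rcases (abs_eq zero_le_one).1 hone with h | h
    · refine ⟨(i, true), Finset.mem_univ _, funext fun j => ?_⟩
      by_cases hji : j = i
      · subst hji; simp [h]
      · simp [hji, hj j hji]
    · refine ⟨(i, false), Finset.mem_univ _, funext fun j => ?_⟩
      by_cases hji : j = i
      · subst hji; simp [h]
      · simp [hji, hj j hji]
  refine (Finset.card_le_card hsub).trans (Finset.card_image_le.trans ?_)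
  simp [mul_comm]

/-- The neighbours in S correspond to unit vectors, and one unit vector is missing. Only the upper
bound 2d on the number of unit vectors is needed. -/
theorem mem_interiorBoundary {d : ℕ} {S : Set (Lattice d)} {k e : Lattice d} (hk : k ∈ S)
    (he : e ∈ unitVectors d) (hke : k + e ∉ S) : k ∈ interiorBoundary S := by
  refine ⟨hk, ?_⟩
  have hne : -e ∈ unitVectors d := neg_mem_unitVectors he
  have hsub : {j | j ∈ S ∧ l1Norm (k - j) = 1} ⊆
      (((unitVectors d).erase (-e)).image fun v => k - v : Finset (Lattice d)) := by
    rintro j ⟨hj, hkj⟩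
    rw [Finset.mem_coe, Finset.mem_image]
    refine ⟨k - j, Finset.mem_erase.2 ⟨fun h => hke ?_, (mem_unitVectors _).2 hkj⟩,
      sub_sub_cancel k j⟩
    rwa [show k + e = j by rw [← neg_neg e, ← h]; abel]
  calc _ ≤ (((unitVectors d).erase (-e)).image fun v => k - v).card := by
        rw [← Set.ncard_coe_finset]
        exact Set.ncard_le_ncard hsub (Finset.finite_toSet _)
    _ ≤ ((unitVectors d).erase (-e)).card := Finset.card_image_le
    _ < (unitVectors d).card := Finset.card_erase_lt_of_mem hne
    _ ≤ 2 * d := card_unitVectors_le d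

theorem exists_hasBoundedDensity {μ : Measure ℝ} {ρ : ℝ → ℝ} (hρ_nonneg : ∀ t, 0 ≤ ρ t)
    (hρ_bdd : MemLp ρ ∞ volume) (hρ_supp : HasCompactSupport ρ)
    (hμ : μ = volume.withDensity (fun t => ENNReal.ofReal (ρ t))) :
    ∃ K R, HasBoundedDensity μ K R := by
  obtain ⟨R, hR⟩ := hρ_supp.isCompact.isBounded.subset_closedBall 0
  refine ⟨eLpNorm ρ ∞ volume, max R 1, hρ_bdd.eLpNorm_ne_top, by positivity, ?_⟩
  refine Measure.le_iff.2 fun s hs => ?_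
  rw [hμ, withDensity_apply _ hs, Measure.smul_apply, smul_eq_mul, Measure.restrict_apply hs]
  have hae : ∀ᵐ t, ‖ρ t‖ₑ ≤ eLpNorm ρ ∞ volume := by
    rw [eLpNorm_exponent_top]
    exact ae_le_eLpNormEssSup
  calc ∫⁻ t in s, ENNReal.ofReal (ρ t)
      ≤ ∫⁻ t in s, (Set.Icc (-max R 1) (max R 1)).indicator (fun _ => eLpNorm ρ ∞ volume) t := by
        refine lintegral_mono_ae (ae_restrict_of_ae ?_)
        filter_upwards [hae] with t ht
        by_cases hmem : t ∈ Set.Icc (-max R 1) (max R 1)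
        · rw [Set.indicator_of_mem hmem]
          rwa [Real.enorm_eq_ofReal (hρ_nonneg t)] at ht
        · have h0 : ρ t = 0 := by
            by_contra h
            have h1 := hR (subset_tsupport ρ h)
            rw [Metric.mem_closedBall, dist_zero_right, Real.norm_eq_abs] at h1
            exact hmem (abs_le.1 (h1.trans (le_max_left _ _)))
          rw [h0, ENNReal.ofReal_zero]
          exact zero_le
    _ = _ := by
        rw [lintegral_indicator measurableSet_Icc, lintegral_const, Measure.restrict_apply_univ,
          Measure.restrict_apply measurableSet_Icc, Set.inter_comm]

theorem ae_abs_le {d : ℕ} {μ : Measure ℝ} [IsProbabilityMeasure μ] {K : ℝ≥0∞} {R : ℝ}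
    (hμ : HasBoundedDensity μ K R) : ∀ᵐ ω ∂law d μ, ∀ k, |ω k| ≤ R := by
  rw [ae_all_iff]
  intro k
  have h0 : ∀ᵐ t ∂μ, |t| ≤ R := by
    have h1 : ∀ᵐ t ∂(K • volume.restrict (Set.Icc (-R) R)), t ∈ Set.Icc (-R) R :=
      Measure.ae_smul_measure (ae_restrict_mem measurableSet_Icc) K
    have h2 := Filter.Eventually.filter_mono (ae_mono hμ.le) h1
    exact h2.mono fun t ht => abs_le.2 ht
  exact (measurePreserving_eval_infinitePi (fun _ : Lattice d => μ) k).quasiMeasurePreserving.ae h0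

theorem AlloyData.ae_green_eq {d : ℕ} (a : AlloyData d) {μ : Measure ℝ} [IsProbabilityMeasure μ]
    {K : ℝ≥0∞} (hμ : HasBoundedDensity μ K a.R) {lam : ℝ} (hlam : 0 ≤ lam)
    (Γ : Set (Lattice d)) : ∀ᵐ ω ∂law d μ, ∀ (z : ℂ) (x y : Γ),
      (z.im < 0 → green a.u lam ω Γ z x y = gr Γ (a.cpot lam z ω) x y) ∧
      ‖green a.u lam ω Γ z x y‖ = ‖green a.u lam ω Γ (starRingEnd ℂ z) y x‖ := by
  filter_upwards [ae_abs_le hμ] with ω hω z x y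
  have hR := a.R_pos
  have hcl : (fun k => a.clamp (ω k)) = ω :=
    funext fun k => a.clamp_eq ((hω k).trans (by linarith))
  have hpot : ∀ x, a.pot ω x = potential a.u ω x := fun x => by rw [pot, hcl]
  have hbd : ∀ x, |potential a.u ω x| ≤ 3 * a.R * a.B := fun x => by
    rw [← hpot]
    exact a.abs_pot_le ω x
  exact ⟨fun hz => green_eq_gr hbd hz.ne (a.isDissipative_cpot hlam hz ω)
    (fun x => by rw [cpot, hpot]) x y, norm_green_conj hbd x y⟩

end AlloyModel

end

theorem mainTheorem7 (d : ℕ) (hd : 1 ≤ d)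
    (μ : Measure ℝ) [IsProbabilityMeasure μ]
    (ρ : ℝ → ℝ) (hρ_nonneg : ∀ t, 0 ≤ ρ t) (hρ_bdd : MemLp ρ ∞ volume)
    (hρ_supp : HasCompactSupport ρ)
    (hμ : μ = volume.withDensity (fun t => ENNReal.ofReal (ρ t)))
    (u : AlloyModel.Lattice d → ℝ) (hu_zero : u 0 ≠ 0)
    (hu_fin : (Function.support u).Finite)
    (hu_pos : ∀ k ∈ AlloyModel.interiorBoundary (Function.support u), 0 < u k)
    (s : ℝ) (hs_pos : 0 < s) (hs_lt : s < 1 / 3) :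
    ∃ lam₀ : ℝ, 0 < lam₀ ∧ ∀ lam : ℝ, lam₀ ≤ lam →
      ∃ A γ : ℝ, 0 < A ∧ 0 < γ ∧
        ∀ (Γ : Set (AlloyModel.Lattice d)) (z : ℂ), z.im ≠ 0 → ∀ x y : Γ,
          Integrable
            (fun ω => ‖AlloyModel.green u lam ω Γ z x y‖
              ^ (s / (2 * ((Function.support u).ncard : ℝ)))) (AlloyModel.law d μ) ∧
          ∫ ω, ‖AlloyModel.green u lam ω Γ z x y‖
              ^ (s / (2 * ((Function.support u).ncard : ℝ))) ∂(AlloyModel.law d μ)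
            ≤ A * Real.exp (-γ * ‖(x : AlloyModel.Lattice d) - (y : AlloyModel.Lattice d)‖) := by
  obtain ⟨K, R, hKR⟩ := AlloyModel.exists_hasBoundedDensity hρ_nonneg hρ_bdd hρ_supp hμ
  set a : AlloyModel.AlloyData d :=
    { u := u
      fin := hu_fin
      zero := hu_zero
      pos := fun k e hk he hke => hu_pos k
        (AlloyModel.mem_interiorBoundary hk he (fun h => h hke))
      R := R
      R_pos := hKR.pos } with ha
  have hN : (Function.support u).ncard = a.N := Set.ncard_eq_toFinset_card _ hu_fin
  have hN1 : (1 : ℝ) ≤ a.N := by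
    have : 0 < a.N := Finset.card_pos.2 ⟨0, by simpa using hu_zero⟩
    exact_mod_cast this
  rw [hN]
  set τ : ℝ := s / (2 * (a.N : ℝ)) with hτdef
  have hτ : 0 < τ := by positivity
  -- Since N ≥ 1, (N+1)/(2N) ≤ 1, so the left side is at most s < 1/3.
  have hNτ : (a.N + 1) * τ ≤ 1 / 2 := by
    rw [hτdef, mul_div_assoc', div_le_iff₀ (by positivity)]
    nlinarith
  obtain ⟨lam₀, hlam₀, A, hA, hmain⟩ := a.exists_lintegral_gr_le_exp hKR hτ hNτ
  refine ⟨lam₀, one_pos.trans_le hlam₀, fun lam hlam => ⟨A, 1, hA, one_pos, ?_⟩⟩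
  intro Γ z hz x y
  have hlam0 : 0 ≤ lam := zero_le_one.trans (hlam₀.trans hlam)
  have key : ∃ (z' : ℂ) (x' y' : Γ), z'.im < 0 ∧
      ‖(x' : AlloyModel.Lattice d) - y'‖ = ‖(x : AlloyModel.Lattice d) - y‖ ∧
      (fun ω => ‖AlloyModel.green u lam ω Γ z x y‖ ^ τ) =ᵐ[AlloyModel.law d μ]
        fun ω => ‖AlloyModel.gr Γ (a.cpot lam z' ω) x' y'‖ ^ τ := by
    have hae := a.ae_green_eq hKR hlam0 Γ
    -- In the upper half-plane the conjugate energy with x and y exchanged is used; the distance is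
    -- unchanged.
    rcases hz.lt_or_gt with h | h
    · refine ⟨z, x, y, h, rfl, ?_⟩
      filter_upwards [hae] with ω hω
      rw [← (hω z x y).1 h]
    · have h' : (starRingEnd ℂ z).im < 0 := by simpa using h
      refine ⟨starRingEnd ℂ z, y, x, h', norm_sub_rev _ _, ?_⟩
      filter_upwards [hae] with ω hω
      rw [← (hω (starRingEnd ℂ z) y x).1 h', ← (hω z x y).2]
  obtain ⟨z', x', y', hz', hxy, hae⟩ := key
  have hbound := hmain lam hlam z' hz' Γ x' x'.2 y' y'.2
  rw [hxy] at hbound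
  have hcont := a.continuous_gr_cpot hlam0 hz' Γ x' y'
  have hmeas : Measurable fun ω => ‖AlloyModel.gr Γ (a.cpot lam z' ω) x' y'‖ ^ τ :=
    hcont.norm.measurable.pow_const τ
  have hconv : ∀ ω, ENNReal.ofReal (‖AlloyModel.gr Γ (a.cpot lam z' ω) x' y'‖ ^ τ) =
      ‖AlloyModel.gr Γ (a.cpot lam z' ω) x' y'‖ₑ ^ τ := fun ω => by
    rw [← ENNReal.ofReal_rpow_of_nonneg (norm_nonneg _) hτ.le, ofReal_norm]
  have hnonneg : ∀ ω, 0 ≤ ‖AlloyModel.gr Γ (a.cpot lam z' ω) x' y'‖ ^ τ := fun ω => by positivity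
  constructor
  · rw [integrable_congr hae]
    refine ⟨hmeas.aestronglyMeasurable, ?_⟩
    rw [hasFiniteIntegral_iff_ofReal (Filter.Eventually.of_forall hnonneg)]
    simp only [hconv]
    exact hbound.trans_lt ENNReal.ofReal_lt_top
  · rw [integral_congr_ae hae, integral_eq_lintegral_of_nonneg_ae
      (Filter.Eventually.of_forall hnonneg) hmeas.aestronglyMeasurable]
    simp only [hconv]
    refine ENNReal.toReal_le_of_le_ofReal (by positivity) (hbound.trans_eq ?_)
    rw [neg_one_mul]
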